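/- Throughout $d\ge 1$, $\log=\log_2$, and $\mathcal A$ is a finite alphabet. $\mathbb Z^d$ acts on $\mathcal A^{\mathbb Z^d}$ by shifts $(\sigma_g x)_a=x_{a+g}$; a subshift is a closed shift-invariant set $X\subset\mathcal A^{\mathbb Z^d}$, and $X|F$ is the set of restrictions of points of $X$ to $F\subset\mathbb Z^d$. A finite set $D\subset\mathbb Z^d$ is a window for $X$ if $X$ is the set of all $x$ such that no pattern $(x_{g+v})_{v\in D}$, $g\in\mathbb Z^d$, lies in some fixed set of forbidden patterns on $D$; $X$ is an SFT if it has a window, and $w\in\mathbb R$ is a window size for $X$ if $X$ has a window $D\ni 0$ with $\|v\|_\infty\le w$ for all $v\in D$. $X$ is nontrivial if it has at least two points. $X$ is contractible if there is a continuous shift-commuting map $h:\{0,1\}^{\mathbb Z^d}\times X\times X\to X$ with $h(0^{\mathbb Z^d},x,y)=x$ and $h(1^{\mathbb Z^d},x,y)=y$. $X$ has strong density of periodic points if for every decreasing sequence $(F_n)$ of finite index subgroups of $\mathbb Z^d$ with trivial intersection, the points fixed by all shifts in some $F_n$ are dense in $X$. $h_{top}(X)=\lim_n \frac{1}{|F_n|}\log\big|X|F_n\big|$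 with $F_n=[-n,n]^d$. $\mathrm{Aut}^{(\infty)}(X)$ is the group of self-homeomorphisms of $X$ commuting with $\sigma_g$ for all $g$ in some finite index subgroup of $\mathbb Z^d$, and $\mathcal Z_X\subset \mathrm{Aut}^{(\infty)}(X)$ is the subgroup of shifts. A Følner sequence $\mathcal F=(F_n)$ in $L$ consists of nonempty finite sets with $|gF_n\triangle F_n|/|F_n|\to0$ for all $g\in L$. A function $f$ of pairs $(\mathcal F,n)$ is controlled if $\log f(\mathcal F,n)/|F_n|\to0$ for every $\mathcal F$. For finite $F\subset\mathbb Z^d$ and $S>0$ let $\partial_SF=\{x\in F: \|x-y\|_\infty\le S\text{ for some }y\notin F\}$, and for $u\in X|\partial_SF$ let $E(u)=\{p\in X|F: p|\partial_SF=u\}$. A real-valued controlled $f$ is an $S$-BEEPS function for $X$ if for every Følner sequence $\mathcal F=(F_n)$ in $\mathbb Z^d$, all sufficiently large $n$ and all $u,v\in X|\partial_SF_n$ one has $|E(v)|>1$ and $$2\,\frac{|E(u)|}{|E(v)|}\,\frac{\log|E(u)|}{\log|E(v)|}\le f(\mathcal F,n).$$ $X$ has the BEEPS property if it has an $S$-BEEPS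 function for every $S>0$. An $L$-tower is a decreasing sequence $\mathcal H=(H_m)$ of finite index normal subgroups of $L$ with trivial intersection that admits a Følner section, i.e. a Følner sequence $\mathcal D=(D_m)$ such that $D_m$ is a fundamental domain for $H_m$, $\mathrm{id}\in D_m\subset D_{m+1}$, $\bigcup_m D_m=L$, and $D_n=\bigcup_{g\in D_n\cap H_m}gD_m$ for $n>m$. An entropy class selector $\mathcal Q$ for $L$ assigns to every Følner sequence $\mathcal F$ in $L$ and every $k$ an isomorphism-closed class $\mathcal Q(\mathcal F,k)$ of finite groups. For a group $G\supset L$, a sequence $(K_m)$ of subgroups of $G$ is $\mathcal H,\mathcal D$-locally $\mathcal Q$ if $K_m\subset C_G(H_m)$ for all $m$, $K_m\in\mathcal Q(\mathcal D,m)$ for all but finitely many $m$, and some $\varphi\ne\mathrm{id}$ lies in every $K_m$. If such a sequence exists for some $\mathcal H,\mathcal D$, the local $\mathcal Q$ entropy $h_{\mathcal Q}(G,L)$ is defined, and it is the supremum of $$\limsup_{m\to\infty}\frac1{[L:H_m]}\log\log|K_m|$$ over all $\mathcal H$, all Følner sections $\mathcal D$ for $\mathcal H$ and all $\mathcal H,\mathcal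 D$-locally $\mathcal Q$ sequences $(K_m)$. For real $M$ and $N\in\mathbb N$ let $\mathcal P^s(M,N)$ be the class of finite groups isomorphic to $\prod_{i=1}^rA_i$ with $r\le N$, each $A_i$ nontrivial simple, and $\log|A_i|/\log|A_j|\le M$ for all $i,j$. Put $v_{R,\kappa}(\mathcal F,n)=\kappa^{|\partial_RF_n|}$ and $\mathcal Q(f,v_{R,\kappa})(\mathcal F,n)=\mathcal P^s\big(f(\mathcal F,n),v_{R,\kappa}(\mathcal F,n)\big)$. **Theorem.** (a) Let $X\subset\mathcal A^{\mathbb Z^d}$ be either a nontrivial contractible SFT, or a nonempty SFT with the BEEPS property and strong density of periodic points. Let $w$ be a window size for $X$, let $R\ge S>w$, let $f_S$ be an $S$-BEEPS function for $X$, and let $\kappa\ge|\mathcal A|$ be an integer. Then $\mathbb Z^d$ acts faithfully on $X$ (so $\mathcal Z_X\cong\mathbb Z^d$), the local $\mathcal Q(f_S,v_{R,\kappa})$ entropy of $(\mathrm{Aut}^{(\infty)}(X),\mathcal Z_X)$ is defined, and $$h_{\mathcal Q(f_S,v_{R,\kappa})}\big(\mathrm{Aut}^{(\infty)}(X),\mathcal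 Z_X\big)=h_{top}(X).$$ (b) For every nontrivial contractible $\mathbb Z^d$-SFT $X$ there is an entropy class selector $\mathcal Q$ for which the local $\mathcal Q$ entropy of $(\mathrm{Aut}^{(\infty)}(X),\mathcal Z_X)$ is defined and equals $h_{top}(X)$. -/

import Mathlib

open Filter Topology
open SymbolicDynamics.FullShift (Subshift shift)

noncomputable section

namespace LocalQEntropy

universe u v w

/-! ### Følner sequences, towers, entropy class selectors and local `𝒬` entropy

The group `L` is written additively. A pointed group `(G, L)` is given by the group `G` and a
homomorphism `ι : Multiplicative L →* G`, injective in the case of interest, whose image is the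
distinguished subgroup. -/

section General

variable (L : Type v) [AddGroup L]

open Classical in
/-- Følner sequences of nonempty finite subsets of `L`:
`|(g + F n) ∆ F n| / |F n| → 0` for every `g`. -/
structure FolnerSeq where
  toFun : ℕ → Finset L
  nonempty : ∀ n, (toFun n).Nonempty
  folner : ∀ g : L, Tendsto
    (fun n => ((symmDiff ((toFun n).image (fun x => g + x)) (toFun n)).card : ℝ)
      / ((toFun n).card : ℝ)) atTop (𝓝 0)

instance : CoeFun (FolnerSeq L) (fun _ => ℕ → Finset L) := ⟨FolnerSeq.toFun⟩

variable {L}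

/-- `D` is a Følner section for the sequence of subgroups `H`: each `D m` is a fundamental domain
of `H m`, the `D m` contain the identity, increase and exhaust `L`, for `m < n` the set `D n` is
the union of the translates `g + D m` with `g ∈ D n ∩ H m`, and (as part of the type of `D`) the
`D m` form a Følner sequence. -/
structure IsFolnerSection (H : ℕ → AddSubgroup L) (D : FolnerSeq L) : Prop where
  fundamental : ∀ m, AddSubgroup.IsComplement (D m : Set L) (H m : Set L)
  zero_mem : ∀ m, (0 : L) ∈ D m
  mono : ∀ m, D m ⊆ D (m + 1)
  exhaust : ∀ g : L, ∃ m, g ∈ D m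
  tile : ∀ m n, m < n → ∀ x : L, x ∈ D n ↔ ∃ g ∈ D n, g ∈ H m ∧ ∃ y ∈ D m, x = g + y

/-- `L`-towers: nested sequences of finite index normal subgroups with trivial intersection which
admit a Følner section. -/
structure IsTower (H : ℕ → AddSubgroup L) : Prop where
  normal : ∀ m, (H m).Normal
  finiteIndex : ∀ m, (H m).FiniteIndex
  nested : Antitone H
  iInf_eq : ⨅ m, H m = ⊥
  exists_section : ∃ D : FolnerSeq L, IsFolnerSection H D

variable (L) in
/-- An entropy class selector assigns to each Følner sequence and each `k` a class of finite
groups closed under isomorphism. -/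
structure EntropyClassSelector where
  mem : FolnerSeq L → ℕ → (K : Type u) → [Group K] → Prop
  finite : ∀ (F : FolnerSeq L) (k : ℕ) (K : Type u) [Group K], mem F k K → Finite K
  iso : ∀ (F : FolnerSeq L) (k : ℕ) (K K' : Type u) [Group K] [Group K'],
    Nonempty (K ≃* K') → mem F k K → mem F k K'

variable {G : Type u} [Group G]

/-- `K` is an `H, D`-locally `Q` sequence of subgroups of the pointed group `ι`. -/
structure IsLocallyQ (ι : Multiplicative L →* G) (Q : EntropyClassSelector.{u} L)
    (H : ℕ → AddSubgroup L) (D : FolnerSeq L) (K : ℕ → Subgroup G) : Prop where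
  le_centralizer : ∀ m, K m ≤
    Subgroup.centralizer {z : G | ∃ h ∈ H m, ι (Multiplicative.ofAdd h) = z}
  eventually_mem : ∀ᶠ m in atTop, Q.mem D m (K m)
  common : ∃ φ : G, φ ≠ 1 ∧ ∀ m, φ ∈ K m

/-- The pointed group contains an `L`-locally `Q` sequence, so its local `Q` entropy is defined. -/
def HasLocallyQ (ι : Multiplicative L →* G) (Q : EntropyClassSelector.{u} L) : Prop :=
  ∃ (H : ℕ → AddSubgroup L) (D : FolnerSeq L) (K : ℕ → Subgroup G),
    IsTower H ∧ IsFolnerSection H D ∧ IsLocallyQ ι Q H D K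

/-- The local `Q` entropy of a pointed group (logarithms in base two), as an extended real. -/
def localQEntropy (ι : Multiplicative L →* G) (Q : EntropyClassSelector.{u} L) : EReal :=
  ⨆ (H : ℕ → AddSubgroup L) (_ : IsTower H) (D : FolnerSeq L) (_ : IsFolnerSection H D)
    (K : ℕ → Subgroup G) (_ : IsLocallyQ ι Q H D K),
    limsup (fun m =>
      ((Real.logb 2 (Real.logb 2 (Nat.card (K m) : ℝ)) / ((H m).index : ℝ) : ℝ) : EReal)) atTop

/-- The class `𝒫ˢ(M, N)` of finite groups isomorphic to a product of at most `N` finite nontrivial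
simple groups the logarithms of whose orders have pairwise ratios at most `M`. -/
def SimpleProduct (M : ℝ) (N : ℕ) (K : Type u) [Group K] : Prop :=
  ∃ (r : ℕ) (B : Fin r → Type) (_ : ∀ i, Group (B i)),
    r ≤ N ∧ (∀ i, Finite (B i)) ∧ (∀ i, IsSimpleGroup (B i)) ∧
    (∀ i j, Real.logb 2 (Nat.card (B i) : ℝ) / Real.logb 2 (Nat.card (B j) : ℝ) ≤ M) ∧
    Nonempty (K ≃* ((i : Fin r) → B i))

/-- The entropy class selector `𝒬(f, g)`, sending `(F, m)` to `𝒫ˢ(f (F, m), g (F, m))`. -/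
def selector (f : FolnerSeq L → ℕ → ℝ) (g : FolnerSeq L → ℕ → ℕ) :
    EntropyClassSelector.{u} L where
  mem F m K _ := SimpleProduct (f F m) (g F m) K
  finite := by
    rintro F k K _ ⟨r, B, _, -, hfin, -, -, ⟨e⟩⟩
    have := hfin
    exact Finite.of_equiv _ e.symm.toEquiv
  iso := by
    rintro F k K K' _ _ ⟨e'⟩ ⟨r, B, iB, h1, h2, h3, h4, ⟨e⟩⟩
    exact ⟨r, B, iB, h1, h2, h3, h4, ⟨e'.symm.trans e⟩⟩

/-- Controlled functions: `log f (F, m) / |F m| → 0` along every Følner sequence `F`. -/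
def Controlled (f : FolnerSeq L → ℕ → ℝ) : Prop :=
  ∀ F : FolnerSeq L,
    Tendsto (fun m => Real.logb 2 (f F m) / ((F m).card : ℝ)) atTop (𝓝 0)

end General

/-! ### Subshifts over `ℤ^d` -/

section Boundary

variable {d : ℕ}

open Classical in
/-- The inner boundary `∂_S F`: points of `F` at sup-distance at most `S` from the complement. -/
def boundary (S : ℝ) (F : Finset (Fin d → ℤ)) : Finset (Fin d → ℤ) :=
  F.filter (fun x => ∃ y : Fin d → ℤ, y ∉ F ∧ ‖x - y‖ ≤ S)

lemma boundary_subset (S : ℝ) (F : Finset (Fin d → ℤ)) : boundary S F ⊆ F := by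
  classical
  exact fun _ hx => (Finset.mem_filter.1 hx).1

/-- `v_{R,κ}(F, n) = κ ^ |∂_R (F n)|`. -/
def boundaryCount (R : ℝ) (κ : ℕ) (F : FolnerSeq (Fin d → ℤ)) (n : ℕ) : ℕ :=
  κ ^ (boundary R (F n)).card

end Boundary

section Subshifts

variable {d : ℕ} {A : Type u} [TopologicalSpace A] (X : Subshift A (Fin d → ℤ))

/-- `D` is a window for `X`: for some set `W` of patterns on `D`, `X` consists of the
configurations none of whose translates shows a pattern of `W` on `D`. -/
def IsWindow (D : Finset (Fin d → ℤ)) : Prop :=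
  ∃ W : Set (D → A), X.carrier = {x | ∀ g, D.restrict (shift g x) ∉ W}

/-- Shifts of finite type (over a finite alphabet). -/
def IsSFT : Prop := ∃ D : Finset (Fin d → ℤ), IsWindow X D

/-- `w` is a window size for `X`: `X` has a window containing the origin all of whose elements
have sup-norm at most `w`. -/
def IsWindowSize (w : ℝ) : Prop :=
  ∃ D : Finset (Fin d → ℤ), IsWindow X D ∧ 0 ∈ D ∧ ∀ v ∈ D, ‖v‖ ≤ w

/-- The shift by `g`, as a self-homeomorphism of `X`. -/
def shiftHomeo (g : Fin d → ℤ) : X.carrier ≃ₜ X.carrier where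
  toFun x := ⟨shift g x.1, X.mapsTo g x.2⟩
  invFun x := ⟨shift (-g) x.1, X.mapsTo (-g) x.2⟩
  left_inv x := by ext h; simp
  right_inv x := by ext h; simp
  continuous_toFun := by fun_prop
  continuous_invFun := by fun_prop

/-- The shift action of `ℤ^d` on `X`. -/
def shiftHom : Multiplicative (Fin d → ℤ) →* (X.carrier ≃ₜ X.carrier) where
  toFun g := shiftHomeo X g.toAdd
  map_one' := by
    ext x h
    simp [shiftHomeo]
  map_mul' a b := by
    ext x h
    change x.1 (a.toAdd + b.toAdd + h) = x.1 (b.toAdd + (a.toAdd + h))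
    exact congrArg x.1 (by rw [← add_assoc, add_comm b.toAdd a.toAdd])

/-- `Aut(X, H)`: self-homeomorphisms of `X` commuting with the shifts by elements of `H`. -/
def aut (H : AddSubgroup (Fin d → ℤ)) : Subgroup (X.carrier ≃ₜ X.carrier) :=
  Subgroup.centralizer {σ | ∃ h ∈ H, shiftHomeo X h = σ}

lemma aut_anti {H H' : AddSubgroup (Fin d → ℤ)} (h : H ≤ H') : aut X H' ≤ aut X H := by
  apply Subgroup.centralizer_le
  rintro σ ⟨g, hg, rfl⟩
  exact ⟨g, h hg, rfl⟩

/-- The stabilized automorphism group: the union of the groups `Aut(X, H)` over all finite index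
subgroups `H` of `ℤ^d`. -/
def stabAut : Subgroup (X.carrier ≃ₜ X.carrier) where
  carrier := {φ | ∃ H : AddSubgroup (Fin d → ℤ), H.FiniteIndex ∧ φ ∈ aut X H}
  one_mem' := ⟨⊤, inferInstance, one_mem _⟩
  mul_mem' := by
    rintro φ ψ ⟨H, hH, hφ⟩ ⟨H', hH', hψ⟩
    have := hH
    have := hH'
    exact ⟨H ⊓ H', inferInstance,
      mul_mem (aut_anti X inf_le_left hφ) (aut_anti X inf_le_right hψ)⟩
  inv_mem' := by
    rintro φ ⟨H, hH, hφ⟩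
    exact ⟨H, hH, inv_mem hφ⟩

lemma shiftHom_mem_stabAut (g : Multiplicative (Fin d → ℤ)) : shiftHom X g ∈ stabAut X := by
  refine ⟨⊤, inferInstance, ?_⟩
  rw [aut, Subgroup.mem_centralizer_iff]
  rintro _ ⟨h, -, rfl⟩
  change shiftHom X (Multiplicative.ofAdd h) * _ = _ * shiftHom X (Multiplicative.ofAdd h)
  rw [← map_mul, ← map_mul, mul_comm]

/-- The embedding of `ℤ^d` onto the subgroup `𝒵_X` of shifts in the stabilized automorphism
group; it presents the pointed group `(Aut^∞(X), 𝒵_X)`. -/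
def shiftsInStabAut : Multiplicative (Fin d → ℤ) →* stabAut X :=
  (shiftHom X).codRestrict (stabAut X) (shiftHom_mem_stabAut X)

/-- `X` is contractible: there is a block map (continuous and shift-commuting)
`h : {0,1}^{ℤ^d} × X × X → X` with `h (0, x, y) = x` and `h (1, x, y) = y`. -/
def IsContractible : Prop :=
  ∃ h : ((Fin d → ℤ) → Bool) × X.carrier × X.carrier → X.carrier, Continuous h ∧
    (∀ g c x y, h (shift g c, shiftHomeo X g x, shiftHomeo X g y) = shiftHomeo X g (h (c, x, y))) ∧
    (∀ x y, h (fun _ => false, x, y) = x) ∧ (∀ x y, h (fun _ => true, x, y) = y)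

/-- Points of `X` fixed by the shifts by all elements of `H`. -/
def fixedPoints (H : AddSubgroup (Fin d → ℤ)) : Set ((Fin d → ℤ) → A) :=
  {x ∈ X.carrier | ∀ g ∈ H, shift g x = x}

/-- Strong density of periodic points. -/
def StrongPeriodicDensity : Prop :=
  ∀ H : ℕ → AddSubgroup (Fin d → ℤ), (∀ n, (H n).FiniteIndex) → Antitone H → ⨅ n, H n = ⊥ →
    X.carrier ⊆ closure (⋃ n, fixedPoints X (H n))

/-- `X|F`, the set of restrictions to `F` of points of `X`. -/
def patterns (F : Finset (Fin d → ℤ)) : Set (F → A) := F.restrict '' X.carrier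

/-- `E(u)`, the set of patterns in `X|F` extending the pattern `u` on `∂_S F`. -/
def extensions (S : ℝ) (F : Finset (Fin d → ℤ)) (u : boundary S F → A) : Set (F → A) :=
  {p ∈ patterns X F | Finset.restrict₂ (π := fun _ => A) (boundary_subset S F) p = u}

/-- `f` is an `S`-BEEPS function for `X`. The condition `1 < |E(v)|` says that the fraction
`log |E(u)| / log |E(v)|` in the defining inequality is meaningful. -/
def IsBEEPSFunction (S : ℝ) (f : FolnerSeq (Fin d → ℤ) → ℕ → ℝ) : Prop :=
  Controlled f ∧ ∀ F : FolnerSeq (Fin d → ℤ), ∀ᶠ n in atTop,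
    ∀ u ∈ patterns X (boundary S (F n)), ∀ v ∈ patterns X (boundary S (F n)),
      1 < (extensions X S (F n) v).ncard ∧
      2 * (((extensions X S (F n) u).ncard : ℝ) / ((extensions X S (F n) v).ncard : ℝ)) *
          (Real.logb 2 ((extensions X S (F n) u).ncard : ℝ) /
            Real.logb 2 ((extensions X S (F n) v).ncard : ℝ)) ≤ f F n

/-- The boundary extension entropy production similarity property. -/
def HasBEEPS : Prop := ∀ S : ℝ, 0 < S → ∃ f, IsBEEPSFunction X S f

/-- The box `[-n, n]^d`. -/
def box (d n : ℕ) : Finset (Fin d → ℤ) := Finset.Icc (fun _ => -(n : ℤ)) (fun _ => (n : ℤ))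

/-- Topological entropy in base two, computed along the Følner sequence of boxes `[-n, n]^d`
(the limit exists, by subadditivity). -/
def topEntropy : EReal :=
  limsup (fun n : ℕ =>
    ((Real.logb 2 ((patterns X (box d n)).ncard : ℝ) / ((box d n).card : ℝ) : ℝ) : EReal)) atTop

end Subshifts

end LocalQEntropy

end

/-! Upper bound. Let `K m` be a locally `𝒬` sequence with common element `φ ≠ 1`. Since periodic
points are dense, for large `m` some point fixed by `H m` is moved by `φ`, so `K m` acts
nontrivially on the points fixed by `H m`. There are at most `P = |X|D m|` of these, because such a
point is determined by its pattern on the fundamental domain `D m`. By simplicity some factor of `K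
m` embeds in the symmetric group of this set and has order at most `P ^ P`. The bounds on the ratios
and on the number of factors then control all of `K m`, and `log log |K m| ≤ log P + o(|D m|)`
(`logb_logb_card_le`, `limsup_le_entropyInf`).

Lower bound. On the patterns of one cell choose a permutation of order three that preserves boundary
patterns and moves at least half of each fibre over a boundary pattern (`exists_isMixing`). Applied
in all cells of a tiling it gives an automorphism `φ` commuting with a lattice. On a larger box made
of cells, `φ` induces a permutation with the same properties (`IsMixing.refine`). So for every
boundary pattern the three-cycles in its fibre number at least a fixed fraction of the extensions.
Divide them into blocks whose sizes come from a short list `c i`, and let one alternating group on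
`c i` three-cycles act on all blocks of size `c i` at once (`exists_blockHom`). The product of these
groups contains `φ` as the simultaneous rotation, and the number of its simple factors is bounded by
the number of sizes, however many blocks there are. A list of `m + 1` sizes with comparable
logarithms of group orders represents every large number (`exists_blockSizes_of_le`), and its least
member has nearly the logarithm of the least number of extensions. By BEEPS the latter is about the
entropy times the volume (`eventually_le_logb_minExtensions`).

The `m + 1` factors are permitted as soon as `κ ^ |∂_R D m| ≥ m + 1`. In dimension one boxes have
bounded boundary, so a Følner section with growing boundary is built (`isFolnerSection_tileSeq`,
`le_card_boundary_tileSeq`). If `R < 1`, boundaries are empty, but then the window size is below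
one, a single fibre remains and a single block suffices. The function `f` enters only through being
controlled and eventually at least `2`.

Contractible shifts of finite type. The contraction acts as a local switch between two points
(`exists_switch`). Replacing boundary patterns with it yields BEEPS (`IsContractible.hasBEEPS`).
Gluing translates of a point along linear functionals, one independent period at a time, yields
dense periodic points (`IsContractible.strongPeriodicDensity`). -/

namespace LocalQEntropy

/-! ### Boxes, boundaries and Følner sequences in `ℤ^d` -/

section Leave

variable {L : Type*} [AddCommGroup L]

/-- The points of `F` which leave `F` when translated by `g`. -/
noncomputable def leave (F : Finset (L)) (g : L) : Finset (L) :=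
  open Classical in F.filter (fun x => x + g ∉ F)

lemma mem_leave {F : Finset (L)} {g x : L} :
    x ∈ leave F g ↔ x ∈ F ∧ x + g ∉ F := by
  classical
  simp [leave]

open Classical in
lemma card_leave_le (F : Finset (L)) (g : L) :
    (leave F g).card ≤ (symmDiff (F.image (fun x => g + x)) F).card := by
  refine Finset.card_le_card_of_injOn (fun x => g + x) ?_ (fun x _ y _ h => add_left_cancel h)
  intro x hx
  obtain ⟨h1, h2⟩ := mem_leave.1 (Finset.mem_coe.1 hx)
  refine Finset.mem_coe.2 (Finset.mem_symmDiff.2 (Or.inl ⟨Finset.mem_image_of_mem _ h1, ?_⟩))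
  simpa [add_comm] using h2

open Classical in
lemma card_symmDiff_le (F : Finset (L)) (g : L) :
    (symmDiff (F.image (fun x => g + x)) F).card ≤ (leave F g).card + (leave F (-g)).card := by
  have h : symmDiff (F.image (fun x => g + x)) F ⊆
      (leave F g).image (fun x => g + x) ∪ leave F (-g) := by
    intro x hx
    rw [Finset.mem_symmDiff] at hx
    rw [Finset.mem_union]
    rcases hx with ⟨h1, h2⟩ | ⟨h1, h2⟩
    · left
      obtain ⟨y, hy, rfl⟩ := Finset.mem_image.1 h1
      refine Finset.mem_image_of_mem _ (mem_leave.2 ⟨hy, ?_⟩)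
      rwa [add_comm]
    · right
      refine mem_leave.2 ⟨h1, fun h3 => h2 (Finset.mem_image.2 ⟨_, h3, by abel⟩)⟩
  exact (Finset.card_le_card h).trans
    ((Finset.card_union_le _ _).trans (Nat.add_le_add_right Finset.card_image_le _))

end Leave

section Lattice

variable {d : ℕ}

lemma mem_box {n : ℕ} {v : Fin d → ℤ} : v ∈ box d n ↔ ‖v‖ ≤ n := by
  rw [box, Finset.mem_Icc, pi_norm_le_iff_of_nonneg (Nat.cast_nonneg n), Pi.le_def, Pi.le_def,
    ← forall_and]
  refine forall_congr' fun i => ?_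
  rw [Int.norm_eq_abs, ← abs_le, ← Int.cast_abs]
  norm_cast

lemma card_box (n : ℕ) : (box d n).card = (2 * n + 1) ^ d := by
  rw [box, Pi.card_Icc]
  simp only [Int.card_Icc, Finset.prod_const, Finset.card_univ, Fintype.card_fin]
  congr 1
  omega

lemma zero_mem_box (n : ℕ) : (0 : Fin d → ℤ) ∈ box d n := by
  rw [mem_box, norm_zero]
  positivity

lemma box_nonempty (n : ℕ) : (box d n).Nonempty := ⟨0, zero_mem_box n⟩

lemma norm_le_floor {v : Fin d → ℤ} {w : ℝ} (h : ‖v‖ ≤ w) : ‖v‖ ≤ (⌊w⌋₊ : ℝ) := by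
  have hw : 0 ≤ w := (norm_nonneg v).trans h
  rw [pi_norm_le_iff_of_nonneg (Nat.cast_nonneg _)]
  intro i
  have h1 : ‖v i‖ ≤ w := (norm_le_pi_norm v i).trans h
  rw [Int.norm_eq_abs, ← Int.cast_abs, Int.abs_eq_natAbs] at h1 ⊢
  have : (v i).natAbs ≤ ⌊w⌋₊ := Nat.le_floor (by simpa using h1)
  exact_mod_cast this

lemma mem_boundary {S : ℝ} {F : Finset (Fin d → ℤ)} {x : Fin d → ℤ} :
    x ∈ boundary S F ↔ x ∈ F ∧ ∃ y, y ∉ F ∧ ‖x - y‖ ≤ S := by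
  classical
  simp [boundary]

lemma mem_of_notMem_boundary {S : ℝ} {F : Finset (Fin d → ℤ)} {x y : Fin d → ℤ} (hx : x ∈ F)
    (h : x ∉ boundary S F) (hxy : ‖x - y‖ ≤ S) : y ∈ F := by
  by_contra hy
  exact h (mem_boundary.2 ⟨hx, y, hy, hxy⟩)

lemma FolnerSeq.card_pos (F : FolnerSeq (Fin d → ℤ)) (n : ℕ) : 0 < ((F n).card : ℝ) := by
  exact_mod_cast (F.nonempty n).card_pos

lemma FolnerSeq.tendsto_leave (F : FolnerSeq (Fin d → ℤ)) (g : Fin d → ℤ) :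
    Tendsto (fun n => ((leave (F n) g).card : ℝ) / ((F n).card : ℝ)) atTop (𝓝 0) := by
  refine squeeze_zero (fun n => by positivity) (fun n => ?_) (F.folner g)
  exact div_le_div_of_nonneg_right (Nat.cast_le.2 (card_leave_le _ _)) (Nat.cast_nonneg _)

/-- A sequence of nonempty sets most of whose points are not moved out of the set by a given
translation is a Følner sequence. -/
noncomputable def FolnerSeq.ofLeave (F : ℕ → Finset (Fin d → ℤ)) (hne : ∀ n, (F n).Nonempty)
    (h : ∀ g, Tendsto (fun n => ((leave (F n) g).card : ℝ) / ((F n).card : ℝ)) atTop (𝓝 0)) :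
    FolnerSeq (Fin d → ℤ) where
  toFun := F
  nonempty := hne
  folner g := by
    have h2 := (h g).add (h (-g))
    rw [add_zero] at h2
    refine squeeze_zero (fun n => by positivity) (fun n => ?_) h2
    rw [← add_div, ← Nat.cast_add]
    exact div_le_div_of_nonneg_right (Nat.cast_le.2 (card_symmDiff_le _ _)) (Nat.cast_nonneg _)

/-- A boundary point leaves `F n` under one of the finitely many translations of norm at most `S`,
each of which moves out only a vanishing proportion. -/
lemma FolnerSeq.tendsto_boundary (F : FolnerSeq (Fin d → ℤ)) (S : ℝ) :
    Tendsto (fun n => ((boundary S (F n)).card : ℝ) / ((F n).card : ℝ)) atTop (𝓝 0) := by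
  classical
  have h : Tendsto (fun n => ∑ g ∈ box d ⌊S⌋₊, ((leave (F n) g).card : ℝ) / ((F n).card : ℝ))
      atTop (𝓝 0) := by
    simpa using tendsto_finsetSum (box d ⌊S⌋₊) (fun g _ => F.tendsto_leave g)
  refine squeeze_zero (fun n => by positivity) (fun n => ?_) h
  rw [← Finset.sum_div]
  gcongr
  have h2 : boundary S (F n) ⊆ (box d ⌊S⌋₊).biUnion (fun g => leave (F n) g) := by
    intro x hx
    obtain ⟨h1, y, h2, h3⟩ := mem_boundary.1 hx
    refine Finset.mem_biUnion.2 ⟨y - x, mem_box.2 (norm_le_floor ?_), mem_leave.2 ⟨h1, ?_⟩⟩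
    · rwa [norm_sub_rev]
    · rwa [add_sub_cancel]
  exact_mod_cast (Finset.card_le_card h2).trans Finset.card_biUnion_le

lemma FolnerSeq.eventually_exists_notMem_boundary (F : FolnerSeq (Fin d → ℤ)) (S : ℝ) :
    ∀ᶠ n in atTop, ∃ a ∈ F n, a ∉ boundary S (F n) := by
  filter_upwards [(F.tendsto_boundary S).eventually (gt_mem_nhds one_pos)] with n hn
  rw [div_lt_one (F.card_pos n)] at hn
  by_contra! h
  exact absurd (Finset.card_le_card (fun a ha => h a ha)) (not_le.2 (by exact_mod_cast hn))

/-- Eventually the set has a point deeper than any given radius, hence contains a whole ball; for `d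
> 0` balls grow without bound. -/
lemma FolnerSeq.tendsto_card (hd : 0 < d) (F : FolnerSeq (Fin d → ℤ)) :
    Tendsto (fun n => ((F n).card : ℝ)) atTop atTop := by
  refine tendsto_atTop.2 fun b => ?_
  filter_upwards [F.eventually_exists_notMem_boundary ⌈b⌉₊] with n hn
  obtain ⟨a, ha, hab⟩ := hn
  have h1 : (box d ⌈b⌉₊).card ≤ (F n).card := by
    refine Finset.card_le_card_of_injOn (fun x => a + x) ?_ (fun x _ y _ h => add_left_cancel h)
    intro x hx
    refine mem_of_notMem_boundary ha hab ?_
    simpa using mem_box.1 (Finset.mem_coe.1 hx)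
  rw [card_box] at h1
  have h2 : ⌈b⌉₊ ≤ (2 * ⌈b⌉₊ + 1) ^ d :=
    le_trans (by omega) (Nat.le_self_pow hd.ne' _)
  exact (Nat.le_ceil b).trans (by exact_mod_cast h2.trans h1)

lemma leave_box_subset {n k : ℕ} {g : Fin d → ℤ} (hg : ‖g‖ ≤ k) (hk : k ≤ n) :
    leave (box d n) g ⊆ box d n \ box d (n - k) := by
  intro x hx
  obtain ⟨h1, h2⟩ := mem_leave.1 hx
  refine Finset.mem_sdiff.2 ⟨h1, fun h3 => h2 (mem_box.2 ?_)⟩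
  have := mem_box.1 h3
  rw [Nat.cast_sub hk] at this
  linarith [norm_add_le x g]

lemma exists_norm_le_nat (g : Fin d → ℤ) : ∃ k : ℕ, ‖g‖ ≤ k := ⟨⌈‖g‖⌉₊, Nat.le_ceil _⟩

variable (d) in
/-- The Følner sequence of the boxes `[-n, n]^d`. -/
noncomputable def boxSeq : FolnerSeq (Fin d → ℤ) :=
  FolnerSeq.ofLeave (box d) box_nonempty <| by
    intro g
    obtain ⟨k, hk⟩ := exists_norm_le_nat g
    have hlim : Tendsto (fun n : ℕ => 1 - (1 - (2 * k : ℝ) / (2 * n + 1)) ^ d) atTop (𝓝 0) := by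
      have h1 : Tendsto (fun n : ℕ => (2 * n + 1 : ℝ)) atTop atTop :=
        tendsto_atTop_add_const_right _ _
          (Tendsto.const_mul_atTop (by norm_num) tendsto_natCast_atTop_atTop)
      have h2 := (((h1.const_div_atTop (2 * k : ℝ)).const_sub 1).pow d).const_sub 1
      simpa using h2
    refine squeeze_zero' (Eventually.of_forall fun n => by positivity) ?_ hlim
    filter_upwards [eventually_ge_atTop k] with n hn
    have h1 := Finset.card_le_card (leave_box_subset hk hn)
    have hsub : box d (n - k) ⊆ box d n := fun x hx => mem_box.2
      ((mem_box.1 hx).trans (by exact_mod_cast Nat.sub_le n k))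
    rw [Finset.card_sdiff_of_subset hsub] at h1
    have h2 : ((leave (box d n) g).card : ℝ) ≤ (2 * n + 1) ^ d - (2 * (n - k) + 1) ^ d := by
      have h3 : ((leave (box d n) g).card : ℝ) ≤ ((box d n).card : ℝ) - (box d (n - k)).card := by
        rw [← Nat.cast_sub (Finset.card_le_card hsub)]
        exact_mod_cast h1
      simpa [card_box, Nat.cast_sub hn] using h3
    have h4 : (0 : ℝ) < 2 * n + 1 := by positivity
    rw [card_box, div_le_iff₀ (by positivity)]
    push_cast
    refine h2.trans (le_of_eq ?_)
    rw [sub_mul, one_mul, ← mul_pow, sub_mul, div_mul_cancel₀ _ h4.ne']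
    ring

@[simp] lemma boxSeq_apply (n : ℕ) : boxSeq d n = box d n := rfl

end Lattice

/-! ### Local membership and gluing -/

section Gluing

universe u

variable {d : ℕ} {A : Type u} [TopologicalSpace A] {X : Subshift A (Fin d → ℤ)}

/-- Membership in `X` can be checked on balls of radius `ω`. -/
def IsLocal (X : Subshift A (Fin d → ℤ)) (ω : ℕ) : Prop :=
  ∀ x : (Fin d → ℤ) → A, (∀ g, ∃ y ∈ X.carrier, ∀ a, ‖a - g‖ ≤ ω → x a = y a) → x ∈ X.carrier

/-- Each forbidden-pattern test at `g` reads only the ball of radius `w` around `g`. Lattice norms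
are integers, so the radius may be rounded down. -/
lemma IsWindow.isLocal {D : Finset (Fin d → ℤ)} (h : IsWindow X D) {w : ℝ}
    (hD : ∀ v ∈ D, ‖v‖ ≤ w) : IsLocal X ⌊w⌋₊ := by
  obtain ⟨W, hW⟩ := h
  intro x hx
  rw [hW]
  intro g
  obtain ⟨y, hy, hxy⟩ := hx g
  rw [hW] at hy
  have h : D.restrict (shift g x) = D.restrict (shift g y) := by
    ext v
    refine hxy _ ?_
    simpa using norm_le_floor (hD v v.2)
  rw [h]
  exact hy g

lemma IsWindowSize.isLocal {w : ℝ} (h : IsWindowSize X w) : IsLocal X ⌊w⌋₊ := by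
  obtain ⟨D, hW, -, hD⟩ := h
  exact hW.isLocal hD

lemma IsSFT.exists_isLocal (h : IsSFT X) : ∃ ω, IsLocal X ω := by
  obtain ⟨D, hD⟩ := h
  exact ⟨_, hD.isLocal (w := ∑ v ∈ D, ‖v‖) fun v hv =>
    Finset.single_le_sum (f := fun v => ‖v‖) (fun v _ => norm_nonneg v) hv⟩

/-- Gluing: if `z` agrees with a point of `X` on each `F i` and with the point `x` of `X` off the
interiors of the `F i`, then `z` lies in `X`. -/
lemma IsLocal.glue {ω : ℕ} (hX : IsLocal X ω) {S : ℝ} (hS : 2 * ω ≤ S) {ι : Type*}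
    (F : ι → Finset (Fin d → ℤ)) {x z : (Fin d → ℤ) → A} (hx : x ∈ X.carrier)
    (h1 : ∀ i, ∃ y ∈ X.carrier, ∀ a ∈ F i, z a = y a)
    (h2 : ∀ a, z a = x a ∨ ∃ i, a ∈ F i ∧ a ∉ boundary S (F i)) : z ∈ X.carrier := by
  refine hX z fun g => ?_
  -- Either the ball around `g` sees only `x`, or it contains a point at depth more than `S ≥ 2ω` in
  -- some `F i`; in that case the ball, of diameter at most `2ω`, lies inside `F i`.
  by_cases h : ∀ a, ‖a - g‖ ≤ ω → z a = x a
  · exact ⟨x, hx, h⟩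
  · push Not at h
    obtain ⟨a, ha, hza⟩ := h
    obtain ⟨i, hi, hia⟩ := (h2 a).resolve_left hza
    obtain ⟨y, hy, hyz⟩ := h1 i
    refine ⟨y, hy, fun b hb => hyz b (mem_of_notMem_boundary hi hia ?_)⟩
    calc ‖a - b‖ = ‖(a - g) - (b - g)‖ := by congr 1; abel
      _ ≤ ‖a - g‖ + ‖b - g‖ := norm_sub_le _ _
      _ ≤ S := by linarith

lemma shift_mem {x : (Fin d → ℤ) → A} (hx : x ∈ X.carrier) (g : Fin d → ℤ) :
    shift g x ∈ X.carrier := X.mapsTo g hx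

lemma restrict_mem_patterns {x : (Fin d → ℤ) → A} (hx : x ∈ X.carrier) (F : Finset (Fin d → ℤ)) :
    F.restrict x ∈ patterns X F := ⟨x, hx, rfl⟩

end Gluing

/-! ### The tiling of `ℤ^d` by translates of a box -/

section Cells

variable {d : ℕ}

/-- The sublattice `N ℤ^d`. -/
def lattice (d N : ℕ) : AddSubgroup (Fin d → ℤ) where
  carrier := {v | ∀ i, (N : ℤ) ∣ v i}
  zero_mem' := fun _ => dvd_zero _
  add_mem' := fun ha hb i => dvd_add (ha i) (hb i)
  neg_mem' := fun ha i => (dvd_neg).2 (ha i)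

lemma mem_lattice {N : ℕ} {v : Fin d → ℤ} : v ∈ lattice d N ↔ ∀ i, (N : ℤ) ∣ v i := Iff.rfl

lemma lattice_anti {M N : ℕ} (h : M ∣ N) : lattice d N ≤ lattice d M :=
  fun _ hv i => (Int.natCast_dvd_natCast.2 h).trans (hv i)

/-- The position of `a` in its cell, for the tiling of `ℤ^d` by translates of `[-k, k]^d`. -/
def cellRep (k : ℕ) (a : Fin d → ℤ) : Fin d → ℤ := fun i => (a i).bmod (2 * k + 1)

/-- The centre of the cell of `a`. -/
def cellBase (k : ℕ) (a : Fin d → ℤ) : Fin d → ℤ := a - cellRep k a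

lemma mem_box_iff {k : ℕ} {a : Fin d → ℤ} : a ∈ box d k ↔ ∀ i, -(k : ℤ) ≤ a i ∧ a i ≤ k := by
  rw [box, Finset.mem_Icc, Pi.le_def, Pi.le_def, ← forall_and]

lemma cellRep_mem (k : ℕ) (a : Fin d → ℤ) : cellRep k a ∈ box d k := by
  refine mem_box_iff.2 fun i => ?_
  have h1 := Int.le_bmod (x := a i) (m := 2 * k + 1) (by omega)
  have h2 := Int.bmod_lt (x := a i) (m := 2 * k + 1) (by omega)
  simp only [cellRep]
  push_cast at h1 h2
  omega

lemma cellBase_mem (k : ℕ) (a : Fin d → ℤ) : cellBase k a ∈ lattice d (2 * k + 1) :=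
  fun _ => Int.dvd_self_sub_bmod

lemma cellBase_add_cellRep (k : ℕ) (a : Fin d → ℤ) : cellBase k a + cellRep k a = a :=
  sub_add_cancel _ _

lemma cellRep_add {k : ℕ} (a : Fin d → ℤ) {h : Fin d → ℤ} (hh : h ∈ lattice d (2 * k + 1)) :
    cellRep k (h + a) = cellRep k a := by
  funext i
  obtain ⟨c, hc⟩ := hh i
  simp only [cellRep, Pi.add_apply, hc]
  rw [add_comm]
  exact Int.add_mul_bmod_self_left ..

lemma cellRep_of_mem {k : ℕ} {a : Fin d → ℤ} (ha : a ∈ box d k) : cellRep k a = a := by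
  funext i
  have := mem_box_iff.1 ha i
  simp only [cellRep]
  rw [Int.bmod_eq_iff (by omega)]
  refine ⟨by omega, by omega, by simp⟩

lemma cellBase_add {k : ℕ} (a : Fin d → ℤ) {h : Fin d → ℤ} (hh : h ∈ lattice d (2 * k + 1)) :
    cellBase k (h + a) = h + cellBase k a := by
  rw [cellBase, cellRep_add a hh, cellBase, add_sub_assoc]

lemma cellBase_of_mem {k : ℕ} {a : Fin d → ℤ} (ha : a ∈ box d k) : cellBase k a = 0 := by
  rw [cellBase, cellRep_of_mem ha, sub_self]

/-- The number of cells meeting `F`. -/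
lemma card_image_cellBase_mul_le (k : ℕ) (F : Finset (Fin d → ℤ)) :
    (F.image (cellBase k)).card * (box d k).card
      ≤ F.card + (boundary (2 * k) F).card * (box d k).card := by
  set I := F.image (cellBase k)
  set J := (boundary (2 * k) F).image (cellBase k)
  -- A cell that meets `F` but not its `2k`-boundary is contained in `F`, as cells have diameter
  -- `2k`; such cells are disjoint.
  have h1 : (I \ J).card * (box d k).card ≤ F.card := by
    rw [← Finset.card_product]
    refine Finset.card_le_card_of_injOn (fun p => p.1 + p.2) ?_ ?_
    · rintro ⟨i, b⟩ hp
      obtain ⟨hi, hb⟩ := Finset.mem_product.1 (Finset.mem_coe.1 hp)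
      obtain ⟨hi, hj⟩ := Finset.mem_sdiff.1 hi
      obtain ⟨a, ha, rfl⟩ := Finset.mem_image.1 hi
      have ha' : a ∉ boundary (2 * k) F := fun h => hj (Finset.mem_image_of_mem _ h)
      refine mem_of_notMem_boundary ha ha' ?_
      have e : a - (cellBase k a + b) = cellRep k a - b := by rw [cellBase]; abel
      have e1 := mem_box.1 (cellRep_mem k a)
      have e2 := mem_box.1 hb
      calc ‖a - (cellBase k a + b)‖ = ‖cellRep k a - b‖ := by rw [e]
        _ ≤ _ := norm_sub_le _ _
        _ ≤ _ := by linarith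
    · rintro ⟨i, b⟩ hp ⟨j, c⟩ hq h
      obtain ⟨hi, hb⟩ := Finset.mem_product.1 (Finset.mem_coe.1 hp)
      obtain ⟨hj, hc⟩ := Finset.mem_product.1 (Finset.mem_coe.1 hq)
      have hL : ∀ i ∈ I, i ∈ lattice d (2 * k + 1) := by
        intro i hi
        obtain ⟨a, -, rfl⟩ := Finset.mem_image.1 hi
        exact cellBase_mem k a
      have hbc := congrArg (cellRep k) h
      simp only [cellRep_add _ (hL _ (Finset.mem_sdiff.1 hi).1),
        cellRep_add _ (hL _ (Finset.mem_sdiff.1 hj).1), cellRep_of_mem hb,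
        cellRep_of_mem hc] at hbc
      subst hbc
      exact Prod.ext (add_right_cancel h) rfl
  have h2 : I.card ≤ (I \ J).card + J.card := by
    have := Finset.card_le_card_sdiff_add_card (s := I) (t := J)
    omega
  have h3 : J.card ≤ (boundary (2 * k) F).card := Finset.card_image_le
  calc I.card * (box d k).card ≤ ((I \ J).card + (boundary (2 * k) F).card) * (box d k).card :=
        Nat.mul_le_mul_right _ (by omega)
    _ = (I \ J).card * (box d k).card + (boundary (2 * k) F).card * (box d k).card := add_mul _ _ _
    _ ≤ _ := Nat.add_le_add_right h1 _

end Cells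

/-! ### Topological entropy -/

section Entropy

universe u

variable {d : ℕ} {A : Type u} [TopologicalSpace A] {X : Subshift A (Fin d → ℤ)}

lemma patterns_nonempty (hX : X.carrier.Nonempty) (F : Finset (Fin d → ℤ)) :
    (patterns X F).Nonempty := hX.image _

variable (X) in
/-- The entropy of the patterns on the box `[-n, n]^d`, per cell. -/
noncomputable def boxEntropy (n : ℕ) : ℝ :=
  Real.logb 2 ((patterns X (box d n)).ncard : ℝ) / ((box d n).card : ℝ)

variable (X) in
/-- Topological entropy as a real number: the infimum of the entropies per cell of the boxes. -/
noncomputable def entropyInf : ℝ := ⨅ n, boxEntropy X n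

lemma logb_natCast_nonneg (n : ℕ) : 0 ≤ Real.logb 2 (n : ℝ) :=
  div_nonneg (Real.log_natCast_nonneg n) (Real.log_nonneg one_le_two)

lemma boxEntropy_nonneg (n : ℕ) : 0 ≤ boxEntropy X n :=
  div_nonneg (logb_natCast_nonneg _) (Nat.cast_nonneg _)

lemma entropyInf_le (n : ℕ) : entropyInf X ≤ boxEntropy X n :=
  ciInf_le ⟨0, by rintro _ ⟨n, rfl⟩; exact boxEntropy_nonneg n⟩ n

variable [Fintype A]

lemma ncard_patterns_pos (hX : X.carrier.Nonempty) (F : Finset (Fin d → ℤ)) :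
    0 < (patterns X F).ncard := (Set.ncard_pos).2 (patterns_nonempty hX F)

lemma ncard_patterns_le_card_pow (F : Finset (Fin d → ℤ)) :
    (patterns X F).ncard ≤ Fintype.card A ^ F.card := by
  refine (Set.ncard_le_card _).trans ?_
  simp

/-- A pattern on `F` can be read off from the patterns that an extending point shows on the cells
meeting `F`. -/
lemma ncard_patterns_le_pow (k : ℕ) (F : Finset (Fin d → ℤ)) :
    (patterns X F).ncard ≤ (patterns X (box d k)).ncard ^ (F.image (cellBase k)).card := by
  have hc : ∀ p : patterns X F, ∃ x ∈ X.carrier, F.restrict x = p.1 := fun p => p.2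
  choose x hx hxp using hc
  let f : patterns X F → (F.image (cellBase k) → patterns X (box d k)) :=
    fun p i => ⟨(box d k).restrict (shift i.1 (x p)), restrict_mem_patterns (shift_mem (hx p) _) _⟩
  have hf : Function.Injective f := by
    intro p q h
    refine Subtype.ext ?_
    rw [← hxp p, ← hxp q]
    ext a
    have h1 := congrFun h ⟨cellBase k a.1, Finset.mem_image_of_mem _ a.2⟩
    have h2 := congrFun (congrArg Subtype.val h1) ⟨cellRep k a.1, cellRep_mem k _⟩
    simpa [f, cellBase_add_cellRep] using h2
  have h3 := Nat.card_le_card_of_injective f hf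
  rwa [Nat.card_fun, Nat.card_coe_set_eq, Nat.card_coe_set_eq, Nat.card_eq_fintype_card,
    Fintype.card_coe] at h3

lemma logb_le_logb {a b : ℝ} (ha : 0 < a) (hab : a ≤ b) : Real.logb 2 a ≤ Real.logb 2 b :=
  Real.logb_le_logb_of_le one_lt_two ha hab

/-- Choose a box nearly realizing the infimum and cover `F n` by its translates: up to a boundary
term, `|F n| / |box|` of them suffice. This gives convergence along boxes and the estimate for
arbitrary Følner sections. -/
lemma eventually_logb_ncard_patterns_le (hX : X.carrier.Nonempty) (F : FolnerSeq (Fin d → ℤ))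
    {ε : ℝ} (hε : 0 < ε) :
    ∀ᶠ n in atTop, Real.logb 2 ((patterns X (F n)).ncard : ℝ) / ((F n).card : ℝ)
      ≤ entropyInf X + ε := by
  obtain ⟨k, hk⟩ := exists_lt_of_ciInf_lt (show (⨅ n, boxEntropy X n) < entropyInf X + ε by
    rw [entropyInf]; linarith)
  set c := Real.logb 2 ((patterns X (box d k)).ncard : ℝ)
  have h1 : Tendsto (fun n => boxEntropy X k +
      ((boundary (2 * k) (F n)).card : ℝ) / ((F n).card : ℝ) * c) atTop (𝓝 (boxEntropy X k)) := by
    simpa using ((F.tendsto_boundary (2 * k)).mul_const c).const_add (boxEntropy X k)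
  filter_upwards [h1.eventually (gt_mem_nhds hk)] with n hn
  refine le_trans ?_ hn.le
  have hB : (0 : ℝ) < (box d k).card := by exact_mod_cast (box_nonempty k).card_pos
  have hF := F.card_pos n
  have h2 : Real.logb 2 ((patterns X (F n)).ncard : ℝ) ≤
      ((F n).image (cellBase k)).card * c := by
    rw [← Real.logb_pow]
    refine logb_le_logb (by exact_mod_cast ncard_patterns_pos hX _) ?_
    exact_mod_cast ncard_patterns_le_pow k (F n)
  have h3 : (((F n).image (cellBase k)).card : ℝ) * (box d k).card
      ≤ (F n).card + (boundary (2 * k) (F n)).card * (box d k).card := by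
    exact_mod_cast card_image_cellBase_mul_le k (F n)
  have h4 : (((F n).image (cellBase k)).card : ℝ) ≤
      (F n).card / (box d k).card + (boundary (2 * k) (F n)).card := by
    rw [div_add' _ _ _ hB.ne', le_div_iff₀ hB]
    exact h3
  rw [div_le_iff₀ hF, boxEntropy]
  refine (h2.trans (mul_le_mul_of_nonneg_right h4 (logb_natCast_nonneg _))).trans (le_of_eq ?_)
  change _ = (c / _ + _) * _
  field_simp

lemma tendsto_boxEntropy (hX : X.carrier.Nonempty) :
    Tendsto (boxEntropy X) atTop (𝓝 (entropyInf X)) := by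
  refine tendsto_order.2 ⟨fun a ha => Eventually.of_forall fun n => ha.trans_le (entropyInf_le n),
    fun a ha => ?_⟩
  filter_upwards [eventually_logb_ncard_patterns_le hX (boxSeq d)
    (half_pos (sub_pos.2 ha))] with n hn
  refine lt_of_le_of_lt hn ?_
  linarith

lemma topEntropy_eq (hX : X.carrier.Nonempty) : topEntropy X = (entropyInf X : EReal) :=
  Tendsto.limsup_eq ((continuous_coe_real_ereal.tendsto _).comp (tendsto_boxEntropy hX))

end Entropy

/-! ### The upper bound -/

lemma limsup_coe_le {u : ℕ → ℝ} {h : ℝ} (hu : ∀ ε > 0, ∀ᶠ m in atTop, u m ≤ h + ε) :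
    limsup (fun m => (u m : EReal)) atTop ≤ (h : EReal) := by
  refine le_of_forall_gt_imp_ge_of_dense fun c hc => ?_
  obtain ⟨y, hy, hyc⟩ := EReal.lt_iff_exists_real_btwn.1 hc
  refine le_trans (limsup_le_of_le (a := (y : EReal)) (by isBoundedDefault) ?_) hyc.le
  filter_upwards [hu (y - h) (sub_pos.2 (EReal.coe_lt_coe_iff.1 hy))] with m hm
  rw [add_sub_cancel] at hm
  exact_mod_cast hm

lemma le_limsup_coe {u : ℕ → ℝ} {h : ℝ} (hu : ∀ ε > 0, ∀ᶠ m in atTop, h - ε ≤ u m) :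
    (h : EReal) ≤ limsup (fun m => (u m : EReal)) atTop := by
  refine le_of_forall_lt_imp_le_of_dense fun c hc => ?_
  obtain ⟨y, hyc, hy⟩ := EReal.lt_iff_exists_real_btwn.1 hc
  refine hyc.le.trans (le_limsup_of_frequently_le (Eventually.frequently ?_) (by isBoundedDefault))
  filter_upwards [hu (h - y) (sub_pos.2 (EReal.coe_lt_coe_iff.1 hy))] with m hm
  rw [sub_sub_cancel] at hm
  exact_mod_cast hm

/-- A nontrivial homomorphism on a product is nontrivial on some factor, and simplicity makes it
injective there. -/
lemma exists_natCard_le_of_hom_ne_one {K P : Type*} [Group K] [Group P] [Finite P] {r : ℕ}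
    {B : Fin r → Type} [∀ i, Group (B i)] (hs : ∀ i, IsSimpleGroup (B i))
    (e : K ≃* ((i : Fin r) → B i)) (ψ : K →* P) {k : K} (hk : ψ k ≠ 1) :
    ∃ j, Nat.card (B j) ≤ Nat.card P := by
  by_contra! hcon
  have h1 : ψ.comp e.symm.toMonoidHom = 1 := by
    refine MonoidHom.pi_ext fun i x => ?_
    have hi : ((ψ.comp e.symm.toMonoidHom).comp (MonoidHom.mulSingle B i)).ker = ⊤ := by
      refine (((hs i).eq_bot_or_eq_top_of_normal _ inferInstance).resolve_left fun hb => ?_)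
      exact absurd (Nat.card_le_card_of_injective _ ((MonoidHom.ker_eq_bot_iff _).1 hb))
        (not_le.2 (hcon i))
    have : x ∈ ((ψ.comp e.symm.toMonoidHom).comp (MonoidHom.mulSingle B i)).ker := by
      rw [hi]; trivial
    exact this
  apply hk
  have := DFunLike.congr_fun h1 (e k)
  simpa using this

/-! ### Orders of products of simple groups with a nontrivial action -/

section SimpleProducts

/-- If a product of at most `N` simple groups acts nontrivially on a set with `P` elements, then
the double logarithm of its order is controlled by `log P`. -/
lemma logb_logb_card_le {K : Type*} [Group K] {M : ℝ} {N P a n : ℕ} (hK : SimpleProduct M N K)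
    {Ω : Type*} [Finite Ω] (ψ : K →* Equiv.Perm Ω) {k : K} (hk : ψ k ≠ 1)
    (hΩ : Nat.card Ω ≤ P) (hP : P ≤ a ^ n) :
    Real.logb 2 (Real.logb 2 (Nat.card K : ℝ)) ≤
      Real.logb 2 N + Real.logb 2 M + Real.logb 2 P + (Real.logb 2 n + Real.logb 2 a) := by
  obtain ⟨r, B, iB, hr, hfin, hs, hM, ⟨e⟩⟩ := hK
  obtain ⟨j, hj⟩ := exists_natCard_le_of_hom_ne_one hs e ψ hk
  have hcard2 : ∀ i, 1 < Nat.card (B i) := fun i => Finite.one_lt_card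
  have hlogpos : ∀ i, 0 < Real.logb 2 (Nat.card (B i) : ℝ) := fun i =>
    Real.logb_pos one_lt_two (by exact_mod_cast hcard2 i)
  have hM1 : 1 ≤ M := by simpa [div_self (hlogpos j).ne'] using hM j j
  have hr0 : 0 < r := Fin.pos_iff_nonempty.2 ⟨j⟩
  rw [Nat.card_perm] at hj
  have hfact : Nat.card (B j) ≤ P ^ P :=
    hj.trans ((Nat.factorial_le hΩ).trans (Nat.factorial_le_pow P))
  have hP2 : 1 < P := by
    by_contra! h
    have := hcard2 j
    have h2 : P ^ P ≤ 1 := by interval_cases P <;> simp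
    omega
  have hn : 0 < n := by
    rcases Nat.eq_zero_or_pos n with rfl | h
    · simp at hP; omega
    · exact h
  have ha : 0 < a := by
    rcases Nat.eq_zero_or_pos a with rfl | h
    · rw [zero_pow hn.ne'] at hP; omega
    · exact h
  -- The crude bound `log a ≤ a` is enough: after another logarithm it contributes only `log n + log
  -- a`.
  have hlogP : Real.logb 2 (P : ℝ) ≤ n * a := by
    have h1 : Real.logb 2 (P : ℝ) ≤ n * Real.logb 2 a := by
      rw [← Real.logb_pow]
      exact logb_le_logb (by exact_mod_cast (by omega : 0 < P)) (by exact_mod_cast hP)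
    refine h1.trans (mul_le_mul_of_nonneg_left ?_ (Nat.cast_nonneg _))
    rw [Real.logb_le_iff_le_rpow one_lt_two (by exact_mod_cast ha), Real.rpow_natCast]
    exact_mod_cast Nat.lt_two_pow_self.le
  have hlogB : ∀ i, Real.logb 2 (Nat.card (B i) : ℝ) ≤ M * (P * (n * a)) := by
    intro i
    have h1 := hM i j
    rw [div_le_iff₀ (hlogpos j)] at h1
    refine h1.trans (mul_le_mul_of_nonneg_left ?_ (by linarith))
    have h2 : Real.logb 2 (Nat.card (B j) : ℝ) ≤ P * Real.logb 2 P := by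
      rw [← Real.logb_pow]
      exact logb_le_logb (by exact_mod_cast (hcard2 j).trans' one_pos) (by exact_mod_cast hfact)
    exact h2.trans (mul_le_mul_of_nonneg_left hlogP (Nat.cast_nonneg _))
  have hcardK : (Nat.card K : ℝ) = ∏ i, (Nat.card (B i) : ℝ) := by
    rw [Nat.card_congr e.toEquiv, Nat.card_pi, Nat.cast_prod]
  have hlogK : Real.logb 2 (Nat.card K : ℝ) = ∑ i, Real.logb 2 (Nat.card (B i) : ℝ) := by
    rw [hcardK, Real.logb_prod]
    exact fun i _ => by exact_mod_cast (hcard2 i).trans' one_pos |>.ne'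
  have hKpos : 0 < Real.logb 2 (Nat.card K : ℝ) := by
    rw [hlogK]
    exact Finset.sum_pos (fun i _ => hlogpos i) ⟨j, Finset.mem_univ _⟩
  have hN : 0 < N := hr0.trans_le hr
  have hle : Real.logb 2 (Nat.card K : ℝ) ≤ N * M * P * (n * a) := by
    rw [hlogK]
    refine (Finset.sum_le_card_nsmul _ _ _ fun i _ => hlogB i).trans ?_
    rw [Finset.card_univ, Fintype.card_fin, nsmul_eq_mul]
    have : (r : ℝ) ≤ N := by exact_mod_cast hr
    calc (r : ℝ) * (M * (P * (n * a))) ≤ N * (M * (P * (n * a))) := by gcongr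
      _ = _ := by ring
  refine (logb_le_logb hKpos hle).trans (le_of_eq ?_)
  have hN' : (N : ℝ) ≠ 0 := by exact_mod_cast hN.ne'
  have hP' : (P : ℝ) ≠ 0 := by exact_mod_cast (by omega : P ≠ 0)
  have hn' : (n : ℝ) ≠ 0 := by exact_mod_cast hn.ne'
  have ha' : (a : ℝ) ≠ 0 := by exact_mod_cast ha.ne'
  have hM' : M ≠ 0 := by linarith
  rw [Real.logb_mul (mul_ne_zero (mul_ne_zero hN' hM') hP') (mul_ne_zero hn' ha'),
    Real.logb_mul (mul_ne_zero hN' hM') hP', Real.logb_mul hN' hM', Real.logb_mul hn' ha']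

end SimpleProducts

/-! ### The action on periodic points -/

section UpperBound

universe u

variable {d : ℕ} {A : Type u} [TopologicalSpace A] (X : Subshift A (Fin d → ℤ))

/-- The points of `X` fixed by all shifts in `H`. -/
abbrev FixedBy (H : AddSubgroup (Fin d → ℤ)) : Type u :=
  {x : X.carrier // ∀ h ∈ H, shiftHomeo X h x = x}

/-- The elements of the stabilized automorphism group commuting with the shifts in `H`. -/
abbrev shiftCentralizer (H : AddSubgroup (Fin d → ℤ)) : Subgroup (stabAut X) :=
  Subgroup.centralizer {z | ∃ h ∈ H, shiftsInStabAut X (Multiplicative.ofAdd h) = z}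

variable {X}

lemma shiftHomeo_apply (g : Fin d → ℤ) (x : X.carrier) (a : Fin d → ℤ) :
    (shiftHomeo X g x).1 a = x.1 (g + a) := rfl

lemma mem_shiftCentralizer_iff {H : AddSubgroup (Fin d → ℤ)} {φ : stabAut X} :
    φ ∈ shiftCentralizer X H ↔
      ∀ h ∈ H, ∀ x, φ.1 (shiftHomeo X h x) = shiftHomeo X h (φ.1 x) := by
  rw [Subgroup.mem_centralizer_iff]
  constructor
  · intro h g hg x
    exact (DFunLike.congr_fun (congrArg Subtype.val (h _ ⟨g, hg, rfl⟩)) x).symm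
  · rintro h _ ⟨g, hg, rfl⟩
    refine Subtype.ext (Homeomorph.ext fun x => (h g hg x).symm)

variable (X) in
/-- The action of the centralizer of the shifts in `H` on the points fixed by these shifts. -/
def fixedAction (H : AddSubgroup (Fin d → ℤ)) :
    shiftCentralizer X H →* Equiv.Perm (FixedBy X H) :=
  MonoidHom.toHomPerm
    { toFun := fun k x => ⟨k.1.1 x.1, fun h hh => by
        rw [← mem_shiftCentralizer_iff.1 k.2 h hh, x.2 h hh]⟩
      map_one' := rfl
      map_mul' := fun _ _ => rfl }

/-- An `H`-periodic point is determined by its values on a fundamental domain of `H`. -/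
lemma fixedBy_restrict_injective {H : AddSubgroup (Fin d → ℤ)} {D : Finset (Fin d → ℤ)}
    (hD : AddSubgroup.IsComplement (D : Set (Fin d → ℤ)) (H : Set (Fin d → ℤ))) :
    Function.Injective (fun x : FixedBy X H =>
      (⟨D.restrict x.1.1, restrict_mem_patterns x.1.2 D⟩ : patterns X D)) := by
  intro x y hxy
  refine Subtype.ext (Subtype.ext (funext fun a => ?_))
  obtain ⟨⟨f, h⟩, rfl⟩ := hD.2 a
  have hx := congrFun (congrArg Subtype.val (x.2 h.1 h.2)) f.1
  have hy := congrFun (congrArg Subtype.val (y.2 h.1 h.2)) f.1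
  rw [shiftHomeo_apply, add_comm] at hx hy
  change x.1.1 (f.1 + h.1) = y.1.1 (f.1 + h.1)
  rw [hx, hy]
  exact congrFun (congrArg Subtype.val hxy) f

/-- The points moved by `φ` form a nonempty open set, which contains a point fixed by some `H n`;
that point remains fixed by all later, smaller `H m`. -/
lemma eventually_exists_fixedBy_ne [DiscreteTopology A] {H : ℕ → AddSubgroup (Fin d → ℤ)}
    (hper : StrongPeriodicDensity X) (hH : IsTower H) {φ : stabAut X} (hφ : φ ≠ 1) :
    ∀ᶠ m in atTop, ∃ x : FixedBy X (H m), φ.1 x.1 ≠ x.1 := by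
  have hφ' : ∃ x, φ.1 x ≠ x := by
    by_contra! h
    exact hφ (Subtype.ext (Homeomorph.ext h))
  obtain ⟨x, hx⟩ := hφ'
  have hopen : IsOpen {y : X.carrier | φ.1 y ≠ y} :=
    isOpen_ne_fun φ.1.continuous continuous_id
  obtain ⟨U, hU, hUx⟩ := isOpen_induced_iff.1 hopen
  have hxU : x.1 ∈ U := by
    have : x ∈ Subtype.val ⁻¹' U := by rw [hUx]; exact hx
    exact this
  have hcl := hper H hH.finiteIndex hH.nested hH.iInf_eq x.2
  obtain ⟨y, hyU, hy⟩ := mem_closure_iff.1 hcl U hU hxU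
  obtain ⟨n, hn⟩ := Set.mem_iUnion.1 hy
  filter_upwards [eventually_ge_atTop n] with m hm
  refine ⟨⟨⟨y, hn.1⟩, fun h hh => Subtype.ext (hn.2 h (hH.nested hm hh))⟩, ?_⟩
  have : (⟨y, hn.1⟩ : X.carrier) ∈ Subtype.val ⁻¹' U := hyU
  rw [hUx] at this
  exact this

lemma tendsto_logb_natCast_div (F : FolnerSeq (Fin d → ℤ)) (hd : 0 < d) (c : ℝ) :
    Tendsto (fun m => (Real.logb 2 ((F m).card : ℝ) + c) / ((F m).card : ℝ)) atTop (𝓝 0) := by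
  have h1 : Tendsto (fun x : ℝ => (Real.logb 2 x + c) / x) atTop (𝓝 0) := by
    have h2 : Tendsto (fun x : ℝ => Real.log x / x) atTop (𝓝 0) :=
      (Real.isLittleO_log_id_atTop).tendsto_div_nhds_zero
    have h3 : Tendsto (fun x : ℝ => c / x) atTop (𝓝 0) := tendsto_const_nhds.div_atTop tendsto_id
    have h4 := (h2.div_const (Real.log 2)).add h3
    rw [zero_div, add_zero] at h4
    refine h4.congr fun x => ?_
    rw [Real.logb, add_div]
    congr 1
    ring
  exact h1.comp (F.tendsto_card hd)

variable [Fintype A]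

/-- In `logb_logb_card_le` only `log P` is of the order of the volume: `log N` is a boundary term,
`log M` is controlled, and the rest is logarithmic in the volume. -/
theorem limsup_le_entropyInf [DiscreteTopology A] (hd : 0 < d) (hper : StrongPeriodicDensity X)
    {f : FolnerSeq (Fin d → ℤ) → ℕ → ℝ} (hf : Controlled f) {R : ℝ} {κ : ℕ}
    {H : ℕ → AddSubgroup (Fin d → ℤ)} (hH : IsTower H) {D : FolnerSeq (Fin d → ℤ)}
    (hD : IsFolnerSection H D) {K : ℕ → Subgroup (stabAut X)}
    (hK : IsLocallyQ (shiftsInStabAut X) (selector f (boundaryCount R κ)) H D K) :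
    limsup (fun m => ((Real.logb 2 (Real.logb 2 (Nat.card (K m) : ℝ)) / ((H m).index : ℝ) : ℝ) :
      EReal)) atTop ≤ (entropyInf X : EReal) := by
  obtain ⟨φ, hφ1, hφ⟩ := hK.common
  have hX : X.carrier.Nonempty := by
    by_contra! h
    refine hφ1 (Subtype.ext (Homeomorph.ext fun x => ?_))
    exact absurd x.2 (Set.eq_empty_iff_forall_notMem.1 h x.1)
  refine limsup_coe_le fun ε hε => ?_
  set c := Real.logb 2 (Fintype.card A : ℝ)
  have hlim : Tendsto (fun m => ((boundary R (D m)).card : ℝ) / ((D m).card : ℝ) * Real.logb 2 κ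
      + Real.logb 2 (f D m) / ((D m).card : ℝ)
      + (Real.logb 2 ((D m).card : ℝ) + c) / ((D m).card : ℝ)) atTop (𝓝 0) := by
    simpa using (((D.tendsto_boundary R).mul_const (Real.logb 2 κ)).add (hf D)).add
      (tendsto_logb_natCast_div D hd c)
  filter_upwards [hlim.eventually (gt_mem_nhds (half_pos hε)),
    eventually_logb_ncard_patterns_le hX D (half_pos hε), hK.eventually_mem,
    eventually_exists_fixedBy_ne hper hH hφ1] with m h1 h2 h3 ⟨x, hx⟩
  have hindex : (H m).index = (D m).card := by
    rw [← (hD.fundamental m).card_left]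
    simp
  have hcard : Nat.card (FixedBy X (H m)) ≤ (patterns X (D m)).ncard := by
    rw [← Nat.card_coe_set_eq]
    exact Nat.card_le_card_of_injective _ (fixedBy_restrict_injective (hD.fundamental m))
  have : Finite (FixedBy X (H m)) :=
    Finite.of_injective _ (fixedBy_restrict_injective (hD.fundamental m))
  have hbound := logb_logb_card_le h3
    ((fixedAction X (H m)).comp (Subgroup.inclusion (hK.le_centralizer m)))
    (k := ⟨φ, hφ m⟩) (fun h => hx (congrArg Subtype.val (DFunLike.congr_fun h x))) hcard
    (ncard_patterns_le_card_pow (D m))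
  have hpos := D.card_pos m
  rw [hindex, div_le_iff₀ hpos]
  refine hbound.trans ?_
  rw [div_le_iff₀ hpos] at h2
  have h4 := (mul_lt_mul_of_pos_right h1 hpos).le
  rw [add_mul, add_mul, div_mul_cancel₀ _ hpos.ne', div_mul_cancel₀ _ hpos.ne', mul_right_comm,
    div_mul_cancel₀ _ hpos.ne'] at h4
  have h5 : Real.logb 2 ((boundaryCount R κ D m : ℕ) : ℝ) =
      ((boundary R (D m)).card : ℝ) * Real.logb 2 κ := by
    rw [boundaryCount, Nat.cast_pow, Real.logb_pow]
  rw [h5]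
  linarith

end UpperBound

/-! ### Contractible subshifts -/

section Contractible

universe u

variable {d : ℕ} {A : Type u} [TopologicalSpace A] {X : Subshift A (Fin d → ℤ)}

variable (X) in
/-- A shift-commuting map which switches from `x` to `y` according to the configuration `c`, away
from a neighbourhood of radius `ρ` of the places where `c` changes. -/
structure IsSwitch (ρ : ℕ) (h : ((Fin d → ℤ) → Bool) → X.carrier → X.carrier → X.carrier) :
    Prop where
  equivariant : ∀ g c x y,
    h (shift g c) (shiftHomeo X g x) (shiftHomeo X g y) = shiftHomeo X g (h c x y)
  eq_left : ∀ c x y g, (∀ a, ‖a - g‖ ≤ ρ → c a = false) → (h c x y).1 g = x.1 g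
  eq_right : ∀ c x y g, (∀ a, ‖a - g‖ ≤ ρ → c a = true) → (h c x y).1 g = y.1 g

/-- Compactness, as in the Curtis–Hedlund–Lyndon theorem: pairs agreeing on larger and larger balls
have a common limit along a nonprincipal ultrafilter, near which the value at `0` is constant. -/
lemma exists_radius_of_continuous [Fintype A] [DiscreteTopology A]
    {h : ((Fin d → ℤ) → Bool) × X.carrier × X.carrier → X.carrier} (hh : Continuous h) :
    ∃ ρ : ℕ, ∀ k k' : ((Fin d → ℤ) → Bool) × X.carrier × X.carrier,
      (∀ a, ‖a‖ ≤ ρ → k.1 a = k'.1 a ∧ k.2.1.1 a = k'.2.1.1 a ∧ k.2.2.1 a = k'.2.2.1 a) →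
        (h k).1 0 = (h k').1 0 := by
  have : CompactSpace X.carrier := isCompact_iff_compactSpace.1 X.isClosed.isCompact
  by_contra! hcon
  choose k k' hk hne using hcon
  let U := hyperfilter ℕ
  obtain ⟨p, hp⟩ : ∃ p, Tendsto k U (𝓝 p) := ⟨_, (U.map k).le_nhds_lim⟩
  obtain ⟨q, hq⟩ : ∃ q, Tendsto k' U (𝓝 q) := ⟨_, (U.map k').le_nhds_lim⟩
  have hev : ∀ a : Fin d → ℤ, ∀ᶠ n : ℕ in (U : Filter ℕ), ‖a‖ ≤ (n : ℝ) := by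
    intro a
    obtain ⟨m, hm⟩ := exists_norm_le_nat a
    refine Eventually.filter_mono Nat.hyperfilter_le_atTop ?_
    filter_upwards [eventually_ge_atTop m] with n hn
    exact hm.trans (by exact_mod_cast hn)
  have hc1 : ∀ a, Continuous fun k : ((Fin d → ℤ) → Bool) × X.carrier × X.carrier => k.1 a :=
    fun a => (continuous_apply a).comp continuous_fst
  have hc2 : ∀ a, Continuous fun k : ((Fin d → ℤ) → Bool) × X.carrier × X.carrier => k.2.1.1 a :=
    fun a => (continuous_apply a).comp
      (continuous_subtype_val.comp (continuous_fst.comp continuous_snd))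
  have hc3 : ∀ a, Continuous fun k : ((Fin d → ℤ) → Bool) × X.carrier × X.carrier => k.2.2.1 a :=
    fun a => (continuous_apply a).comp
      (continuous_subtype_val.comp (continuous_snd.comp continuous_snd))
  have hpq : p = q := by
    refine Prod.ext (funext fun a => ?_) (Prod.ext (Subtype.ext (funext fun a => ?_))
      (Subtype.ext (funext fun a => ?_)))
    · refine tendsto_nhds_unique_of_eventuallyEq (((hc1 a).tendsto p).comp hp)
        (((hc1 a).tendsto q).comp hq) ?_
      filter_upwards [hev a] with n hn using (hk n a hn).1
    · refine tendsto_nhds_unique_of_eventuallyEq (((hc2 a).tendsto p).comp hp)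
        (((hc2 a).tendsto q).comp hq) ?_
      filter_upwards [hev a] with n hn using (hk n a hn).2.1
    · refine tendsto_nhds_unique_of_eventuallyEq (((hc3 a).tendsto p).comp hp)
        (((hc3 a).tendsto q).comp hq) ?_
      filter_upwards [hev a] with n hn using (hk n a hn).2.2
  subst hpq
  have hF : Continuous (fun k => (h k).1 0) :=
    (continuous_apply 0).comp (continuous_subtype_val.comp hh)
  have h1 := ((hF.tendsto p).comp hp).eventually (by
    rw [nhds_discrete]; exact eventually_pure.2 rfl : ∀ᶠ b in 𝓝 ((h p).1 0), b = (h p).1 0)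
  have h2 := ((hF.tendsto p).comp hq).eventually (by
    rw [nhds_discrete]; exact eventually_pure.2 rfl : ∀ᶠ b in 𝓝 ((h p).1 0), b = (h p).1 0)
  obtain ⟨n, hn1, hn2⟩ := (h1.and h2).exists
  exact hne n (hn1.trans hn2.symm)

/-- By equivariance the value at `g` depends only on the ball of radius `ρ` around `g`; if `c` is
constant there, it may be replaced by a globally constant configuration. -/
lemma IsContractible.exists_switch [Fintype A] [DiscreteTopology A] (hX : IsContractible X) :
    ∃ ρ h, IsSwitch X ρ h := by
  obtain ⟨h, hc, heq, h0, h1⟩ := hX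
  obtain ⟨ρ, hρ⟩ := exists_radius_of_continuous hc
  have key : ∀ c x y g, (h (c, x, y)).1 g =
      (h (shift g c, shiftHomeo X g x, shiftHomeo X g y)).1 0 := by
    intro c x y g
    rw [heq, shiftHomeo_apply, add_zero]
  refine ⟨ρ, fun c x y => h (c, x, y), ⟨heq, ?_, ?_⟩⟩
  · intro c x y g hg
    have := hρ (shift g c, shiftHomeo X g x, shiftHomeo X g y)
      (fun _ => false, shiftHomeo X g x, shiftHomeo X g y)
      (fun a ha => ⟨hg _ (by simpa using ha), rfl, rfl⟩)
    rw [key, this, h0, shiftHomeo_apply, add_zero]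
  · intro c x y g hg
    have := hρ (shift g c, shiftHomeo X g x, shiftHomeo X g y)
      (fun _ => true, shiftHomeo X g x, shiftHomeo X g y)
      (fun a ha => ⟨hg _ (by simpa using ha), rfl, rfl⟩)
    rw [key, this, h1, shiftHomeo_apply, add_zero]

variable {ρ : ℕ} {h : ((Fin d → ℤ) → Bool) → X.carrier → X.carrier → X.carrier}

/-- Replacing the boundary of `F` in `x` by that of `y`. -/
lemma IsSwitch.exists_replace_boundary (hh : IsSwitch X ρ h) (F : Finset (Fin d → ℤ)) {S : ℝ}
    (hS : 0 ≤ S) (x y : X.carrier) : ∃ z : X.carrier, (∀ a ∈ boundary S F, z.1 a = y.1 a) ∧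
      ∀ a ∈ F, a ∉ boundary (S + 2 * ρ) F → z.1 a = x.1 a := by
  classical
  -- Switching at depth `S + ρ` puts the `S`-boundary at distance more than `ρ` from the `x` region,
  -- and points deeper than `S + 2ρ` see only that region.
  refine ⟨h (fun a => decide (¬ (a ∈ F ∧ a ∉ boundary (S + ρ) F))) x y, fun a ha => ?_,
    fun a ha ha' => ?_⟩
  · refine hh.eq_right _ _ _ _ fun b hb => decide_eq_true ?_
    rintro ⟨hbF, hb'⟩
    obtain ⟨haF, e, he, hae⟩ := mem_boundary.1 ha
    refine he (mem_of_notMem_boundary hbF hb' ?_)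
    calc ‖b - e‖ = ‖(b - a) + (a - e)‖ := by congr 1; abel
      _ ≤ _ := norm_add_le _ _
      _ ≤ _ := by linarith
  · refine hh.eq_left _ _ _ _ fun b hb => decide_eq_false (not_not.2 ⟨?_, fun hb' => ?_⟩)
    · by_contra hbF
      refine ha' (mem_boundary.2 ⟨ha, b, hbF, ?_⟩)
      rw [norm_sub_rev]
      have : (0 : ℝ) ≤ ρ := Nat.cast_nonneg ρ
      linarith
    · obtain ⟨hbF, e, he, hbe⟩ := mem_boundary.1 hb'
      refine ha' (mem_boundary.2 ⟨ha, e, he, ?_⟩)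
      calc ‖a - e‖ = ‖(a - b) + (b - e)‖ := by congr 1; abel
        _ ≤ _ := norm_add_le _ _
        _ ≤ _ := by rw [norm_sub_rev a b]; linarith

lemma mem_extensions {S : ℝ} {F : Finset (Fin d → ℤ)} {u : boundary S F → A} {p : F → A} :
    p ∈ extensions X S F u ↔ p ∈ patterns X F ∧
      ∀ a (ha : a ∈ boundary S F), p ⟨a, boundary_subset S F ha⟩ = u ⟨a, ha⟩ := by
  refine and_congr_right fun _ => ⟨fun h a ha => congrFun h ⟨a, ha⟩, fun h => ?_⟩
  ext ⟨a, ha⟩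
  exact h a ha

lemma extensions_finite [Finite A] (S : ℝ) (F : Finset (Fin d → ℤ)) (u : boundary S F → A) :
    (extensions X S F u).Finite := Set.toFinite _

/-- Replacing the boundary pattern `u` by `v` loses information only in the collar of width `S +
2ρ`; recording the collar as well makes the replacement injective. -/
lemma IsSwitch.ncard_extensions_le [Fintype A] (hh : IsSwitch X ρ h) (F : Finset (Fin d → ℤ))
    {S : ℝ} (hS : 0 ≤ S) (u : boundary S F → A) {v : boundary S F → A}
    (hv : v ∈ patterns X (boundary S F)) :
    (extensions X S F u).ncard ≤ (extensions X S F v).ncard *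
      Fintype.card A ^ (boundary (S + 2 * ρ) F).card := by
  obtain ⟨y, hy, rfl⟩ := hv
  have hx : ∀ p : extensions X S F u, ∃ x ∈ X.carrier, F.restrict x = p.1 := fun p => p.2.1
  choose x hx hxp using hx
  choose z hz1 hz2 using fun p => hh.exists_replace_boundary F hS ⟨x p, hx p⟩ ⟨y, hy⟩
  let f : extensions X S F u → extensions X S F ((boundary S F).restrict y) ×
      (boundary (S + 2 * ρ) F → A) := fun p =>
    (⟨F.restrict (z p).1, mem_extensions.2 ⟨restrict_mem_patterns (z p).2 F, fun a ha =>
      hz1 p a ha⟩⟩, (boundary (S + 2 * ρ) F).restrict (x p))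
  have hf : Function.Injective f := by
    intro p q hpq
    refine Subtype.ext ?_
    rw [← hxp p, ← hxp q]
    ext ⟨a, ha⟩
    change x p a = x q a
    by_cases hab : a ∈ boundary (S + 2 * ρ) F
    · exact congrFun (congrArg Prod.snd hpq) ⟨a, hab⟩
    · have h1 := congrFun (congrArg Subtype.val (congrArg Prod.fst hpq)) ⟨a, ha⟩
      exact (hz2 p a ha hab).symm.trans (Eq.trans h1 (hz2 q a ha hab))
  have := Nat.card_le_card_of_injective f hf
  rw [Nat.card_prod, Nat.card_fun, Nat.card_coe_set_eq, Nat.card_coe_set_eq] at this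
  simpa using this

/-- Translate two distinct points so that they differ at the deep point `g`, then give both the
boundary pattern `v`; the difference at `g` survives. -/
lemma IsSwitch.one_lt_ncard_extensions [Finite A] (hh : IsSwitch X ρ h)
    (hX : X.carrier.Nontrivial) {F : Finset (Fin d → ℤ)} {S : ℝ} (hS : 0 ≤ S) {g : Fin d → ℤ}
    (hg : g ∈ F) (hg' : g ∉ boundary (S + 2 * ρ) F) {v : boundary S F → A}
    (hv : v ∈ patterns X (boundary S F)) : 1 < (extensions X S F v).ncard := by
  obtain ⟨y, hy, rfl⟩ := hv
  obtain ⟨x, hx, x', hx', hne⟩ := hX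
  obtain ⟨b, hb⟩ := Function.ne_iff.1 hne
  obtain ⟨z, hz1, hz2⟩ := hh.exists_replace_boundary F hS ⟨_, shift_mem hx (b - g)⟩ ⟨y, hy⟩
  obtain ⟨z', hz1', hz2'⟩ := hh.exists_replace_boundary F hS ⟨_, shift_mem hx' (b - g)⟩ ⟨y, hy⟩
  refine (Set.one_lt_ncard (extensions_finite _ _ _)).2 ⟨F.restrict z.1, mem_extensions.2
    ⟨restrict_mem_patterns z.2 F, fun a ha => hz1 a ha⟩, F.restrict z'.1, mem_extensions.2
    ⟨restrict_mem_patterns z'.2 F, fun a ha => hz1' a ha⟩, fun h => hb ?_⟩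
  have h1 : z.1 g = z'.1 g := congrFun h ⟨g, hg⟩
  rw [hz2 g hg hg', hz2' g hg hg'] at h1
  simpa using h1

lemma ncard_extensions_le [Fintype A] (S : ℝ) (F : Finset (Fin d → ℤ)) (u : boundary S F → A) :
    (extensions X S F u).ncard ≤ Fintype.card A ^ F.card :=
  (Set.ncard_le_ncard (fun _ hp => hp.1) (Set.toFinite _)).trans (ncard_patterns_le_card_pow F)

theorem IsContractible.hasBEEPS [Fintype A] [DiscreteTopology A] (hd : 0 < d)
    (hX : IsContractible X) (hX' : X.carrier.Nontrivial) : HasBEEPS X := by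
  intro S hS
  obtain ⟨ρ, h, hh⟩ := hX.exists_switch
  have hA : 1 < Fintype.card A := by
    obtain ⟨x, -, y, -, hne⟩ := hX'
    obtain ⟨b, hb⟩ := Function.ne_iff.1 hne
    exact Fintype.one_lt_card_iff.2 ⟨_, _, hb⟩
  have hA0 : (0 : ℝ) < Fintype.card A := by exact_mod_cast hA.trans' one_pos
  -- The collar factor bounds `|E(u)| / |E(v)|`. The factor `|F n| |A|` bounds `log |E(u)|`, and
  -- hence the quotient of logarithms since `log |E(v)| ≥ 1`.
  refine ⟨fun F n => 2 * (Fintype.card A : ℝ) ^ (boundary (S + 2 * ρ) (F n)).card *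
    (((F n).card : ℝ) * Fintype.card A), fun F => ?_, fun F => ?_⟩
  · have hlim : Tendsto (fun m => ((boundary (S + 2 * ρ) (F m)).card : ℝ) / ((F m).card : ℝ) *
        Real.logb 2 (Fintype.card A : ℝ) + (Real.logb 2 ((F m).card : ℝ) +
          (1 + Real.logb 2 (Fintype.card A : ℝ))) / ((F m).card : ℝ)) atTop (𝓝 0) := by
      simpa using ((F.tendsto_boundary (S + 2 * ρ)).mul_const
        (Real.logb 2 (Fintype.card A : ℝ))).add
        (tendsto_logb_natCast_div F hd (1 + Real.logb 2 (Fintype.card A : ℝ)))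
    refine hlim.congr fun m => ?_
    have hF := (F.card_pos m).ne'
    have hp : (Fintype.card A : ℝ) ^ (boundary (S + 2 * ρ) (F m)).card ≠ 0 :=
      pow_ne_zero _ hA0.ne'
    rw [Real.logb_mul (mul_ne_zero two_ne_zero hp) (mul_ne_zero hF hA0.ne'),
      Real.logb_mul two_ne_zero hp, Real.logb_mul hF hA0.ne', Real.logb_pow,
      Real.logb_self_eq_one one_lt_two]
    ring
  · filter_upwards [F.eventually_exists_notMem_boundary (S + 2 * ρ)] with n ⟨g, hg, hg'⟩
    intro u _ v hv
    have hu' := hh.ncard_extensions_le (F n) hS.le u hv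
    have hv' := hh.one_lt_ncard_extensions hX' hS.le hg hg' hv
    refine ⟨hv', ?_⟩
    have hv0 : (2 : ℝ) ≤ (extensions X S (F n) v).ncard := by exact_mod_cast hv'
    have h1 : ((extensions X S (F n) u).ncard : ℝ) / (extensions X S (F n) v).ncard ≤
        (Fintype.card A : ℝ) ^ (boundary (S + 2 * ρ) (F n)).card := by
      rw [div_le_iff₀ (by linarith), mul_comm]
      exact_mod_cast hu'
    have h2 : Real.logb 2 ((extensions X S (F n) u).ncard : ℝ) ≤
        (F n).card * Fintype.card A := by
      rcases Nat.eq_zero_or_pos (extensions X S (F n) u).ncard with h0 | h0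
      · rw [h0, Nat.cast_zero, Real.logb_zero]
        positivity
      calc Real.logb 2 ((extensions X S (F n) u).ncard : ℝ)
          ≤ Real.logb 2 ((Fintype.card A : ℝ) ^ (F n).card) :=
            logb_le_logb (by exact_mod_cast h0) (by exact_mod_cast ncard_extensions_le S (F n) u)
        _ = (F n).card * Real.logb 2 (Fintype.card A : ℝ) := Real.logb_pow _ _ _
        _ ≤ _ := by
          refine mul_le_mul_of_nonneg_left ?_ (Nat.cast_nonneg _)
          rw [Real.logb_le_iff_le_rpow one_lt_two hA0, Real.rpow_natCast]
          exact_mod_cast Nat.lt_two_pow_self.le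
    have h3 : 1 ≤ Real.logb 2 ((extensions X S (F n) v).ncard : ℝ) := by
      rw [Real.le_logb_iff_rpow_le one_lt_two (by linarith), Real.rpow_one]
      exact hv0
    have h4 : Real.logb 2 ((extensions X S (F n) u).ncard : ℝ) /
        Real.logb 2 ((extensions X S (F n) v).ncard : ℝ) ≤ (F n).card * Fintype.card A :=
      (div_le_self (logb_natCast_nonneg _) h3).trans h2
    have h5 : 0 ≤ Real.logb 2 ((extensions X S (F n) u).ncard : ℝ) /
        Real.logb 2 ((extensions X S (F n) v).ncard : ℝ) :=
      div_nonneg (logb_natCast_nonneg _) (logb_natCast_nonneg _)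
    gcongr

end Contractible

/-! ### Periodic points of contractible shifts of finite type -/

section Periodic

universe u

variable {d : ℕ} {A : Type u} [TopologicalSpace A] {X : Subshift A (Fin d → ℤ)}

lemma shiftHomeo_shiftHomeo (g g' : Fin d → ℤ) (x : X.carrier) :
    shiftHomeo X g (shiftHomeo X g' x) = shiftHomeo X (g + g') x := by
  refine Subtype.ext (funext fun a => ?_)
  simp only [shiftHomeo_apply]
  abel_nf

lemma shiftHomeo_zsmul_eq {v : Fin d → ℤ} {y : X.carrier} (h : shiftHomeo X v y = y) (k : ℤ) :
    shiftHomeo X (k • v) y = y := by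
  have h0 : shiftHomeo X 0 y = y := by
    refine Subtype.ext (funext fun a => ?_)
    rw [shiftHomeo_apply, zero_add]
  have h1 : shiftHomeo X (-v) y = y := by
    conv_lhs => rw [← h]
    rw [shiftHomeo_shiftHomeo, neg_add_cancel, h0]
  induction k using Int.induction_on with
  | zero => rw [zero_smul, h0]
  | succ k ih => rw [add_smul, one_smul, ← shiftHomeo_shiftHomeo, h, ih]
  | pred k ih => rw [sub_smul, one_smul, sub_eq_add_neg, ← shiftHomeo_shiftHomeo, h1, ih]

/-- Along a slowly varying functional `l`, the translates of a point `y` by multiples of `v` can be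
glued to a `v`-periodic point. -/
lemma IsSwitch.exists_periodic {ρ ω N : ℕ}
    {h : ((Fin d → ℤ) → Bool) → X.carrier → X.carrier → X.carrier} (hh : IsSwitch X ρ h)
    (hX : IsLocal X ω) (hω : ω ≤ N) (hρ : ρ ≤ N) (l : (Fin d → ℤ) →+ ℝ) {v : Fin d → ℤ}
    (hv : l v = 1) (hl : ∀ a, ‖a‖ ≤ N → |l a| ≤ 1 / 16) (y : X.carrier) :
    ∃ y' : X.carrier, (∀ a, ‖a‖ ≤ N → y'.1 a = y.1 a) ∧ shiftHomeo X v y' = y' ∧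
      ∀ u, l u = 0 → shiftHomeo X u y = y → shiftHomeo X u y' = y' := by
  classical
  have hω' : (ω : ℝ) ≤ N := by exact_mod_cast hω
  have hρ' : (ρ : ℝ) ≤ N := by exact_mod_cast hρ
  -- On the slab `k ≤ l < k + 1` the new point switches from the `k`-th to the `(k + 1)`-st
  -- translate of `y` across `l = k + 1/2`.
  let c : ℤ → (Fin d → ℤ) → Bool := fun k a => decide ((k : ℝ) + 1 / 2 ≤ l a)
  let y' : ℤ → X.carrier := fun k => shiftHomeo X (-(k • v)) y
  let Θ : ℤ → X.carrier := fun k => h (c k) (y' k) (y' (k + 1))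
  let z : (Fin d → ℤ) → A := fun a => (Θ ⌊l a⌋).1 a
  have hnear : ∀ a b, ‖b - a‖ ≤ N → |l b - l a| ≤ 1 / 16 := fun a b hab => by
    rw [← map_sub]; exact hl _ hab
  -- Adjacent slabs agree near their common face: `3/8 + 1/16 < 1/2`, so the switching hyperplanes
  -- are out of reach.
  have key : ∀ (a : Fin d → ℤ) (n : ℤ), |l a - n| ≤ 3 / 8 → z a = (y' n).1 a := by
    intro a n hn
    rw [abs_le] at hn
    rcases le_or_gt (n : ℝ) (l a) with hna | hna
    · have hfl : ⌊l a⌋ = n := Int.floor_eq_iff.2 ⟨hna, by linarith⟩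
      simp only [z, hfl]
      refine hh.eq_left _ _ _ _ fun b hb => decide_eq_false ?_
      have := (abs_le.1 (hnear a b (hb.trans hρ'))).2
      linarith
    · have hfl : ⌊l a⌋ = n - 1 := Int.floor_eq_iff.2 ⟨by push_cast; linarith, by
        push_cast; linarith⟩
      simp only [z, hfl]
      have h1 : Θ (n - 1) = h (c (n - 1)) (y' (n - 1)) (y' n) := by
        simp only [Θ, sub_add_cancel]
      rw [h1]
      refine hh.eq_right _ _ _ _ fun b hb => decide_eq_true ?_
      have := (abs_le.1 (hnear a b (hb.trans hρ'))).1
      push_cast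
      linarith
  have hz : z ∈ X.carrier := by
    refine hX z fun g => ?_
    have hf1 := Int.floor_le (l g)
    have hf2 := Int.lt_floor_add_one (l g)
    -- A ball centred within `1/4` of an integer level stays within `5/16 < 3/8` of it, where `key`
    -- applies; any other ball stays in one slab.
    by_cases hc1 : l g ≤ ⌊l g⌋ + 1 / 4
    · refine ⟨_, (y' ⌊l g⌋).2, fun a ha => key a _ ?_⟩
      have := abs_le.1 (hnear g a (ha.trans hω'))
      rw [abs_le]
      constructor <;> linarith
    by_cases hc2 : ⌊l g⌋ + 3 / 4 ≤ l g
    · refine ⟨_, (y' (⌊l g⌋ + 1)).2, fun a ha => key a _ ?_⟩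
      have := abs_le.1 (hnear g a (ha.trans hω'))
      rw [abs_le]
      push_cast
      constructor <;> linarith
    · refine ⟨_, (Θ ⌊l g⌋).2, fun a ha => ?_⟩
      have := abs_le.1 (hnear g a (ha.trans hω'))
      have hfl : ⌊l a⌋ = ⌊l g⌋ := Int.floor_eq_iff.2 ⟨by linarith, by linarith⟩
      simp only [z, hfl]
  refine ⟨⟨z, hz⟩, fun a ha => ?_, ?_, fun u hu huy => ?_⟩
  · have h1 := key a 0 (by have := hl a ha; simp only [Int.cast_zero, sub_zero]; linarith)
    refine h1.trans ?_
    simp [y', shiftHomeo_apply]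
  · refine Subtype.ext (funext fun a => ?_)
    change z (v + a) = z a
    have hfl : ⌊l (v + a)⌋ = ⌊l a⌋ + 1 := by
      rw [map_add, hv, add_comm, Int.floor_add_one]
    have hc : ∀ k, shift v (c (k + 1)) = c k := by
      intro k
      funext b
      simp only [c, SymbolicDynamics.FullShift.shift_apply, map_add, hv]
      congr 1
      push_cast
      exact propext ⟨fun h => by linarith, fun h => by linarith⟩
    have hy : ∀ k, shiftHomeo X v (y' (k + 1)) = y' k := by
      intro k
      simp only [y', shiftHomeo_shiftHomeo]
      congr 1
      rw [add_smul, one_smul]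
      abel_nf
    have hΘ : ∀ k, shiftHomeo X v (Θ (k + 1)) = Θ k := by
      intro k
      simp only [Θ]
      rw [← hh.equivariant, hc, hy, hy]
    simp only [z, hfl]
    exact congrFun (congrArg Subtype.val (hΘ ⌊l a⌋)) a
  · refine Subtype.ext (funext fun a => ?_)
    change z (u + a) = z a
    have hfl : ⌊l (u + a)⌋ = ⌊l a⌋ := by rw [map_add, hu, zero_add]
    have hc : ∀ k, shift u (c k) = c k := by
      intro k
      funext b
      simp only [c, SymbolicDynamics.FullShift.shift_apply, map_add, hu, zero_add]
    have hy : ∀ k, shiftHomeo X u (y' k) = y' k := by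
      intro k
      simp only [y', shiftHomeo_shiftHomeo]
      rw [add_comm, ← shiftHomeo_shiftHomeo, huy]
    have hΘ : ∀ k, shiftHomeo X u (Θ k) = Θ k := by
      intro k
      simp only [Θ]
      rw [← hh.equivariant, hc, hy, hy]
    simp only [z, hfl]
    exact congrFun (congrArg Subtype.val (hΘ ⌊l a⌋)) a

/-- The inclusion of `ℤ^d` in Euclidean space. -/
noncomputable def toEuclidean : (Fin d → ℤ) →+ EuclideanSpace ℝ (Fin d) where
  toFun a := WithLp.toLp 2 (fun i => (a i : ℝ))
  map_zero' := by ext i; simp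
  map_add' a b := by ext i; simp

lemma norm_le_norm_toEuclidean (a : Fin d → ℤ) : ‖a‖ ≤ ‖toEuclidean a‖ := by
  rw [pi_norm_le_iff_of_nonneg (norm_nonneg _)]
  intro i
  have := PiLp.norm_apply_le (toEuclidean a) i
  simpa [toEuclidean, Int.norm_eq_abs] using this

lemma norm_toEuclidean_le (a : Fin d → ℤ) : ‖toEuclidean a‖ ≤ d * ‖a‖ := by
  have h1 : toEuclidean a = ∑ i, (a i : ℝ) • EuclideanSpace.single i (1 : ℝ) := by
    ext j
    simp [toEuclidean, Pi.single_apply]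
  rw [h1]
  refine (norm_sum_le _ _).trans ?_
  refine (Finset.sum_le_card_nsmul _ _ ‖a‖ fun i _ => ?_).trans (by simp)
  rw [norm_smul]
  simpa [Int.norm_eq_abs] using norm_le_pi_norm a i

/-- Periods are added one direction at a time. The projection `p` records the directions still to be
treated: elements of `H` in its kernel already fix `y`, and other elements of `H` have projected
length at least `δ`. A nearly shortest projected vector becomes the next period; its direction is
removed from `p`, at the cost of halving `δ`, which is why the hypothesis contains `2 ^ c`. -/
lemma IsSwitch.exists_fixed {ρ ω N : ℕ}
    {h : ((Fin d → ℤ) → Bool) → X.carrier → X.carrier → X.carrier} (hh : IsSwitch X ρ h)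
    (hX : IsLocal X ω) (hω : ω ≤ N) (hρ : ρ ≤ N) (H : AddSubgroup (Fin d → ℤ)) (c : ℕ) :
    ∀ (p : EuclideanSpace ℝ (Fin d) →ₗ[ℝ] EuclideanSpace ℝ (Fin d)) (δ : ℝ) (y : X.carrier),
      d ≤ Module.finrank ℝ (LinearMap.ker p) + c → (∀ e, ‖p e‖ ≤ ‖e‖) → 0 < δ →
      16 * (d * N) * 2 ^ c ≤ δ → (∀ g ∈ H, p (toEuclidean g) ≠ 0 → δ ≤ ‖p (toEuclidean g)‖) →
      (∀ g ∈ H, p (toEuclidean g) = 0 → shiftHomeo X g y = y) →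
      ∃ y' : X.carrier, (∀ a, ‖a‖ ≤ N → y'.1 a = y.1 a) ∧ ∀ g ∈ H, shiftHomeo X g y' = y' := by
  induction c with
  | zero =>
    intro p δ y hker _ _ _ _ hy
    have : LinearMap.ker p = ⊤ := by
      apply Submodule.eq_top_of_finrank_eq
      refine le_antisymm (Submodule.finrank_le _) ?_
      simpa using hker
    exact ⟨y, fun _ _ => rfl, fun g hg => hy g hg (by rw [LinearMap.ker_eq_top.1 this]; rfl)⟩
  | succ c ih =>
    intro p δ y hker hp hδ hNδ hH hy
    by_cases hall : ∀ g ∈ H, p (toEuclidean g) = 0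
    · exact ⟨y, fun _ _ => rfl, fun g hg => hy g hg (hall g hg)⟩
    push Not at hall
    set s : Set ℝ := {t | ∃ g ∈ H, p (toEuclidean g) ≠ 0 ∧ t = ‖p (toEuclidean g)‖} with hs
    have hsne : s.Nonempty := let ⟨g, hg, hg'⟩ := hall; ⟨_, g, hg, hg', rfl⟩
    have hsδ : δ ≤ sInf s := le_csInf hsne (by rintro _ ⟨g, hg, hg', rfl⟩; exact hH g hg hg')
    have hsbdd : BddBelow s := ⟨δ, by rintro _ ⟨g, hg, hg', rfl⟩; exact hH g hg hg'⟩
    have hmin : ∀ g ∈ H, p (toEuclidean g) ≠ 0 → sInf s ≤ ‖p (toEuclidean g)‖ :=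
      fun g hg hg' => csInf_le hsbdd ⟨g, hg, hg', rfl⟩
    set μ := sInf s
    have hμ : 0 < μ := hδ.trans_le hsδ
    -- A near minimizer suffices: with `9/8`, the quantity `‖w‖² / 4` is at most `81/256 · μ²`,
    -- safely below `μ²`.
    obtain ⟨_, ⟨v, hv, hv0, rfl⟩, hvμ⟩ := exists_lt_of_csInf_lt hsne
      (show sInf s < 9 / 8 * μ by change μ < _; linarith)
    set w := p (toEuclidean v) with hw
    have hwμ : μ ≤ ‖w‖ := hmin v hv hv0
    have hwpos : 0 < ‖w‖ := hμ.trans_le hwμ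
    set l : (Fin d → ℤ) →+ ℝ :=
      { toFun := fun a => inner ℝ w (p (toEuclidean a)) * (‖w‖ ^ 2)⁻¹
        map_zero' := by simp
        map_add' := fun a b => by simp [inner_add_right, add_mul] } with hldef
    have hl_apply : ∀ a, l a = inner ℝ w (p (toEuclidean a)) * (‖w‖ ^ 2)⁻¹ := fun _ => rfl
    have hlv : l v = 1 := by
      rw [hl_apply, ← hw, real_inner_self_eq_norm_sq, mul_inv_cancel₀ (by positivity)]
    set p' := p - ((innerₛₗ ℝ w).comp p).smulRight ((‖w‖ ^ 2)⁻¹ • w) with hp'def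
    have hp' : ∀ e, p' e = p e - (inner ℝ w (p e) * (‖w‖ ^ 2)⁻¹) • w := by
      intro e
      simp [hp'def, smul_smul]
    have horth : ∀ e, inner ℝ (p' e) w = 0 := by
      intro e
      rw [hp', inner_sub_left, real_inner_smul_left, real_inner_self_eq_norm_sq, mul_assoc,
        inv_mul_cancel₀ (by positivity), mul_one, real_inner_comm, sub_self]
    have hpyth : ∀ e (t : ℝ), ‖p' e + t • w‖ ^ 2 = ‖p' e‖ ^ 2 + t ^ 2 * ‖w‖ ^ 2 := by
      intro e t
      rw [norm_add_sq_real, real_inner_smul_right, horth, norm_smul, mul_pow, Real.norm_eq_abs,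
        sq_abs]
      ring
    have hp'le : ∀ e, ‖p' e‖ ≤ ‖e‖ := by
      intro e
      refine le_trans (abs_le_of_sq_le_sq' ?_ (norm_nonneg _)).2 (hp e)
      have h1 : p e = p' e + (inner ℝ w (p e) * (‖w‖ ^ 2)⁻¹) • w := by rw [hp']; abel
      rw [h1, hpyth]
      exact le_add_of_nonneg_right (by positivity)
    have hlsmall : ∀ a, ‖a‖ ≤ N → |l a| ≤ 1 / 16 := by
      intro a ha
      have h1 : |inner ℝ w (p (toEuclidean a))| ≤ ‖w‖ * (d * N) :=
        (abs_real_inner_le_norm _ _).trans (mul_le_mul_of_nonneg_left ((hp _).trans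
          ((norm_toEuclidean_le a).trans (mul_le_mul_of_nonneg_left ha (Nat.cast_nonneg _))))
          (norm_nonneg _))
      have h2 : 16 * ((d : ℝ) * N) ≤ ‖w‖ := by
        refine le_trans ?_ (hsδ.trans hwμ)
        refine le_trans (le_mul_of_one_le_right (by positivity) ?_) hNδ
        exact one_le_pow₀ one_le_two
      rw [hl_apply, abs_mul, abs_inv, abs_of_nonneg (by positivity : (0 : ℝ) ≤ ‖w‖ ^ 2),
        ← div_eq_mul_inv, div_le_iff₀ (by positivity)]
      nlinarith
    -- Subtracting a multiple of `v` reduces the `w`-component of `g` to at most half of `w`,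
    -- without changing the orthogonal component.
    have hdecomp : ∀ g ∈ H, ∃ (k : ℤ), g - k • v ∈ H ∧
        ‖p (toEuclidean (g - k • v))‖ ^ 2 ≤ ‖p' (toEuclidean g)‖ ^ 2 + 1 / 4 * ‖w‖ ^ 2 ∧
        l (g - k • v) = l g - k := by
      intro g hg
      refine ⟨round (l g), sub_mem hg (zsmul_mem hv _), ?_, ?_⟩
      · have h1 : p (toEuclidean (g - round (l g) • v)) =
            p' (toEuclidean g) + (l g - round (l g)) • w := by
          rw [hp', map_sub, map_zsmul, map_sub, map_zsmul, ← hw, hl_apply, sub_smul,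
            Int.cast_smul_eq_zsmul]
          abel
        rw [h1, hpyth]
        have h2 := abs_sub_round (l g)
        have h3 : (l g - round (l g)) ^ 2 ≤ 1 / 4 := by
          rw [← sq_abs]
          nlinarith [abs_nonneg (l g - round (l g))]
        nlinarith [sq_nonneg ‖w‖]
      · rw [map_sub, map_zsmul, hlv, zsmul_one]
    obtain ⟨y1, hy1, hy1v, hy1u⟩ := hh.exists_periodic hX hω hρ l hlv hlsmall y
    have hw2 : ‖w‖ ^ 2 ≤ 81 / 64 * μ ^ 2 := by nlinarith
    suffices hex : ∃ y2 : X.carrier, (∀ a, ‖a‖ ≤ N → y2.1 a = y1.1 a) ∧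
        ∀ g ∈ H, shiftHomeo X g y2 = y2 by
      obtain ⟨y2, hy2, hy2H⟩ := hex
      exact ⟨y2, fun a ha => (hy2 a ha).trans (hy1 a ha), hy2H⟩
    refine ih p' (δ / 2) y1 ?_ hp'le (half_pos hδ) ?_ ?_ ?_
    · have hlt : LinearMap.ker p < LinearMap.ker p' := by
        refine lt_of_le_of_ne (fun e he => ?_) (fun heq => hv0 ?_)
        · rw [LinearMap.mem_ker] at he ⊢
          rw [hp', he]
          simp
        · have : toEuclidean v ∈ LinearMap.ker p' := by
            rw [LinearMap.mem_ker, hp', ← hw, real_inner_self_eq_norm_sq,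
              mul_inv_cancel₀ (by positivity), one_smul, sub_self]
          rw [← heq] at this
          exact this
      have := Submodule.finrank_lt_finrank_of_lt hlt
      omega
    · rw [pow_succ] at hNδ
      linarith
    · intro g hg hg'
      obtain ⟨k, hkH, hk, hlk⟩ := hdecomp g hg
      have h1 : p (toEuclidean (g - k • v)) ≠ 0 := by
        intro h0
        apply hg'
        have h2 : p' (toEuclidean g) = p' (toEuclidean (g - k • v)) + k • p' (toEuclidean v) := by
          rw [map_sub, map_sub, map_zsmul, map_zsmul, sub_add_cancel]
        have h3 : p' (toEuclidean v) = 0 := by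
          rw [hp', ← hw, real_inner_self_eq_norm_sq, mul_inv_cancel₀ (by positivity), one_smul,
            sub_self]
        rw [h2, h3, hp', h0]
        simp
      -- Minimality and the reduction give `‖p' g‖² ≥ (1 - 81/256) μ² ≥ (δ / 2)²`.
      have h2 := hmin _ hkH h1
      refine (abs_le_of_sq_le_sq' ?_ (norm_nonneg _)).2
      nlinarith
    · intro g hg hg'
      obtain ⟨k, hkH, hk, hlk⟩ := hdecomp g hg
      rw [hg', norm_zero] at hk
      have h1 : p (toEuclidean (g - k • v)) = 0 := by
        by_contra h0
        have h2 := hmin _ hkH h0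
        nlinarith
      have h2 : l (g - k • v) = 0 := by rw [hl_apply, h1]; simp
      have h3 := hy1u _ h2 (hy _ hkH h1)
      have h5 : g = (g - k • v) + k • v := by abel
      rw [h5, ← shiftHomeo_shiftHomeo, shiftHomeo_zsmul_eq hy1v, h3]

/-- A decreasing sequence with trivial intersection eventually avoids all short nonzero vectors, so
`exists_fixed` applies with `p` the identity and leaves `x` unchanged on a prescribed ball. -/
theorem IsContractible.strongPeriodicDensity [Fintype A] [DiscreteTopology A]
    (hX : IsContractible X) {ω : ℕ} (hω : IsLocal X ω) : StrongPeriodicDensity X := by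
  intro H _ hH hinf x hx
  obtain ⟨ρ, h, hh⟩ := hX.exists_switch
  refine mem_closure_iff.2 fun U hU hxU => ?_
  obtain ⟨I, u, hu, huU⟩ := isOpen_pi_iff.1 hU x hxU
  obtain ⟨N, hN, hωN, hρN⟩ : ∃ N : ℕ, (∀ a ∈ I, ‖a‖ ≤ N) ∧ ω ≤ N ∧ ρ ≤ N := by
    refine ⟨max (∑ a ∈ I, ⌈‖a‖⌉₊) (max ω ρ), fun a ha => (Nat.le_ceil _).trans ?_, by simp, by simp⟩
    exact_mod_cast le_max_of_le_left
      (Finset.single_le_sum (f := fun a => ⌈‖a‖⌉₊) (fun _ _ => Nat.zero_le _) ha)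
  set Δ : ℝ := 16 * (d * N) * 2 ^ d + 1
  obtain ⟨n, hn⟩ : ∃ n, ∀ g ∈ H n, g ≠ 0 → Δ ≤ ‖g‖ := by
    have h1 : ∀ g ∈ box d ⌈Δ⌉₊, ∀ᶠ n in atTop, g ∈ H n → g = 0 := by
      intro g _
      by_cases hg : g = 0
      · exact Eventually.of_forall fun _ _ => hg
      · have h2 : g ∉ ⨅ n, H n := by rwa [hinf, AddSubgroup.mem_bot]
        rw [AddSubgroup.mem_iInf] at h2
        push Not at h2
        obtain ⟨m, hm⟩ := h2
        filter_upwards [eventually_ge_atTop m] with n hn hgn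
        exact absurd (hH hn hgn) hm
    obtain ⟨n, hn⟩ := ((Finset.eventually_all _).2 h1).exists
    refine ⟨n, fun g hg hg0 => ?_⟩
    by_contra! hlt
    exact hg0 (hn g (mem_box.2 (hlt.le.trans (Nat.le_ceil _))) hg)
  suffices hex : ∃ y : X.carrier, (∀ a, ‖a‖ ≤ N → y.1 a = x a) ∧
      ∀ g ∈ H n, shiftHomeo X g y = y by
    obtain ⟨y, hy, hyH⟩ := hex
    refine ⟨y.1, huU fun a ha => ?_, Set.mem_iUnion.2 ⟨n, y.2, fun g hg =>
      congrArg Subtype.val (hyH g hg)⟩⟩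
    rw [hy a (hN a ha)]
    exact (hu a ha).2
  refine hh.exists_fixed hω hωN hρN (H n) d LinearMap.id Δ ⟨x, hx⟩ (by simp)
    (fun _ => le_rfl) (by positivity) (by simp [Δ]) (fun g hg hg0 => ?_) (fun g hg hg0 => ?_)
  · refine (hn g hg ?_).trans (norm_le_norm_toEuclidean g)
    rintro rfl
    simp at hg0
  · have : g = 0 := norm_le_zero_iff.1 ((norm_le_norm_toEuclidean g).trans (by
      have : toEuclidean g = 0 := hg0
      rw [this, norm_zero]))
    subst this
    refine Subtype.ext (funext fun a => ?_)
    rw [shiftHomeo_apply, zero_add]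

end Periodic

/-! ### A Følner section with large boundary

The sets `tileSet i n₀ m` form a Følner section for the lattices `15 ^ m * (2 n₀ + 1) ℤ^d`. Each of
them is a union of translates of the previous one arranged in a cube, except that one translate is
moved to an isolated position; hence the number of boundary points tends to infinity even for
`d = 1`. -/

section TileSets

variable {d : ℕ}

lemma norm_nsmul_pi (N : ℕ) (y : Fin d → ℤ) : ‖N • y‖ = N * ‖y‖ := by
  have h : N • y = (N : ℤ) • y := (natCast_zsmul y N).symm
  rw [h, norm_smul]
  simp

lemma mem_lattice_iff_exists {N : ℕ} {v : Fin d → ℤ} :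
    v ∈ lattice d N ↔ ∃ y : Fin d → ℤ, v = N • y := by
  constructor
  · intro h
    choose y hy using h
    exact ⟨y, funext fun i => by simpa using hy i⟩
  · rintro ⟨y, rfl⟩ i
    exact ⟨y i, by simp⟩

/-- Digits in base `15`: the cube `[-7, 7]^d` with one element moved. -/
noncomputable def digits (i : Fin d) : Finset (Fin d → ℤ) :=
  insert (Pi.single i (-11)) ((box d 7).erase (Pi.single i 4))

variable (i : Fin d)

lemma norm_single (c : ℤ) : ‖(Pi.single i c : Fin d → ℤ)‖ = |(c : ℝ)| := by
  rw [Pi.norm_single, Int.norm_eq_abs]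

/-- The only digit removed from the cube has norm `4`. -/
lemma mem_digits_of_norm_le {t : Fin d → ℤ} (ht : ‖t‖ ≤ 3) : t ∈ digits i := by
  refine Finset.mem_insert_of_mem (Finset.mem_erase.2 ⟨?_, mem_box.2 (ht.trans (by norm_num))⟩)
  rintro rfl
  rw [norm_single] at ht
  norm_num at ht

lemma norm_le_of_mem_digits {t : Fin d → ℤ} (ht : t ∈ digits i) : ‖t‖ ≤ 11 := by
  rcases Finset.mem_insert.1 ht with rfl | h
  · rw [norm_single]
    norm_num
  · exact (mem_box.1 (Finset.mem_of_mem_erase h)).trans (by norm_num)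

/-- The moved digit is isolated: all others have `i`-th coordinate at least `-7`, hence are at
distance at least `4`. -/
lemma eq_of_mem_digits_of_norm_le {t : Fin d → ℤ} (ht : t ∈ digits i)
    (h : ‖t - Pi.single i (-11)‖ ≤ 3) : t = Pi.single i (-11) := by
  rcases Finset.mem_insert.1 ht with h1 | h1
  · exact h1
  · have h2 := (mem_box_iff.1 (Finset.mem_of_mem_erase h1) i).1
    have h3 := (norm_le_pi_norm _ i).trans h
    rw [Int.norm_eq_abs, Pi.sub_apply, Pi.single_eq_same, ← Int.cast_abs] at h3
    have h4 : |t i - -11| ≤ 3 := by exact_mod_cast h3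
    rw [abs_le] at h4
    push_cast at h2
    omega

lemma cellRep_single : cellRep 7 (Pi.single i (-11) : Fin d → ℤ) = Pi.single i 4 := by
  have h1 : (Pi.single i (-11) : Fin d → ℤ) = Pi.single i (-15) + Pi.single i 4 := by
    rw [← Pi.single_add]; norm_num
  rw [h1, cellRep_add, cellRep_of_mem]
  · rw [mem_box, norm_single]
    norm_num
  · refine mem_lattice_iff_exists.2 ⟨Pi.single i (-1), ?_⟩
    rw [← Pi.single_smul]
    norm_num

/-- The new digit `-11` represents the same class modulo `15` as the removed digit `4`. -/
lemma cellRep_injOn_digits : Set.InjOn (cellRep 7) (digits i : Set (Fin d → ℤ)) := by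
  intro s hs t ht hst
  rcases Finset.mem_insert.1 (Finset.mem_coe.1 hs) with rfl | hs <;>
    rcases Finset.mem_insert.1 (Finset.mem_coe.1 ht) with rfl | ht
  · rfl
  · rw [cellRep_single, cellRep_of_mem (Finset.mem_of_mem_erase ht)] at hst
    exact absurd hst.symm (Finset.ne_of_mem_erase ht)
  · rw [cellRep_single, cellRep_of_mem (Finset.mem_of_mem_erase hs)] at hst
    exact absurd hst (Finset.ne_of_mem_erase hs)
  · rwa [cellRep_of_mem (Finset.mem_of_mem_erase ht),
      cellRep_of_mem (Finset.mem_of_mem_erase hs)] at hst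

lemma exists_digit (y : Fin d → ℤ) : ∃ t ∈ digits i, ∃ z : Fin d → ℤ, y = t + 15 • z := by
  obtain ⟨z, hz⟩ := mem_lattice_iff_exists.1 (cellBase_mem 7 y)
  have hy : y = cellRep 7 y + 15 • z := by
    conv_lhs => rw [← cellBase_add_cellRep 7 y, hz, add_comm]
  by_cases h : cellRep 7 y = Pi.single i 4
  · refine ⟨Pi.single i (-11), Finset.mem_insert_self _ _, z + Pi.single i 1, ?_⟩
    rw [smul_add, ← Pi.single_smul, add_left_comm, ← Pi.single_add, add_comm, ← sub_eq_iff_eq_add]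
    conv_lhs => rw [hy, add_sub_cancel_right, h]
    norm_num
  · exact ⟨_, Finset.mem_insert_of_mem (Finset.mem_erase.2 ⟨h, cellRep_mem 7 y⟩), z, hy⟩

lemma card_digits : (digits i).card = 15 ^ d := by
  have h1 : Pi.single i (-11) ∉ (box d 7).erase (Pi.single i 4) := by
    intro h
    have := mem_box.1 (Finset.mem_of_mem_erase h)
    rw [norm_single] at this
    norm_num at this
  have h2 : Pi.single i 4 ∈ box d 7 := by
    rw [mem_box, norm_single]
    norm_num
  rw [digits, Finset.card_insert_of_notMem h1, Finset.card_erase_add_one h2, card_box]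

/-- The side length of the lattice of the `m`-th tiling. -/
def tileSide (n₀ m : ℕ) : ℕ := 15 ^ m * (2 * n₀ + 1)

lemma tileSide_succ (n₀ m : ℕ) : tileSide n₀ (m + 1) = 15 * tileSide n₀ m := by
  rw [tileSide, tileSide, pow_succ]
  ring

lemma tileSide_pos (n₀ m : ℕ) : 0 < tileSide n₀ m := by
  rw [tileSide]
  positivity

lemma lt_tileSide (n₀ m : ℕ) : m < tileSide n₀ m := by
  rw [tileSide]
  have : m < 15 ^ m := Nat.lt_pow_self (by norm_num)
  nlinarith

lemma tileSide_dvd {n₀ m n : ℕ} (h : m ≤ n) : tileSide n₀ m ∣ tileSide n₀ n :=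
  Nat.mul_dvd_mul_right (pow_dvd_pow _ h) _

/-- The tiles of the Følner section. -/
noncomputable def tileSet (n₀ : ℕ) : ℕ → Finset (Fin d → ℤ)
  | 0 => box d n₀
  | m + 1 => Finset.image₂ (fun x t => x + tileSide n₀ m • t) (tileSet n₀ m) (digits i)

variable {i} {n₀ : ℕ}

lemma mem_tileSet_succ {m : ℕ} {x : Fin d → ℤ} : x ∈ tileSet i n₀ (m + 1) ↔
    ∃ y ∈ tileSet i n₀ m, ∃ t ∈ digits i, y + tileSide n₀ m • t = x := Finset.mem_image₂

lemma norm_le_of_mem_tileSet {m : ℕ} {x : Fin d → ℤ} (hx : x ∈ tileSet i n₀ m) :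
    ‖x‖ ≤ tileSide n₀ m := by
  induction m generalizing x with
  | zero =>
    refine (mem_box.1 hx).trans ?_
    rw [tileSide]
    push_cast
    linarith [(Nat.cast_nonneg n₀ : (0 : ℝ) ≤ n₀)]
  | succ m ih =>
    obtain ⟨y, hy, t, ht, rfl⟩ := mem_tileSet_succ.1 hx
    refine (norm_add_le _ _).trans ?_
    rw [norm_nsmul_pi, tileSide_succ]
    -- The constants fit because `1 + 11 ≤ 15`.
    have h1 := ih hy
    have h2 := norm_le_of_mem_digits i ht
    have h3 : (0 : ℝ) ≤ tileSide n₀ m := Nat.cast_nonneg _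
    push_cast
    nlinarith

lemma tileSet_mono (m : ℕ) : tileSet i n₀ m ⊆ tileSet i n₀ (m + 1) := fun x hx =>
  mem_tileSet_succ.2 ⟨x, hx, 0, mem_digits_of_norm_le i (by simp), by simp⟩

lemma zero_mem_tileSet (m : ℕ) : (0 : Fin d → ℤ) ∈ tileSet i n₀ m := by
  induction m with
  | zero => exact zero_mem_box n₀
  | succ m ih => exact tileSet_mono m ih

lemma exists_mem_tileSet (m : ℕ) (a : Fin d → ℤ) :
    ∃ x ∈ tileSet i n₀ m, ∃ y : Fin d → ℤ, a = x + tileSide n₀ m • y := by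
  induction m with
  | zero =>
    obtain ⟨z, hz⟩ := mem_lattice_iff_exists.1 (cellBase_mem n₀ a)
    refine ⟨cellRep n₀ a, cellRep_mem n₀ a, z, ?_⟩
    rw [tileSide, pow_zero, one_mul, ← hz, add_comm, cellBase_add_cellRep]
  | succ m ih =>
    obtain ⟨x, hx, y, rfl⟩ := ih
    obtain ⟨t, ht, z, rfl⟩ := exists_digit i y
    refine ⟨_, mem_tileSet_succ.2 ⟨x, hx, t, ht, rfl⟩, z, ?_⟩
    rw [tileSide_succ, smul_add, mul_comm, mul_smul, add_assoc]

lemma eq_of_mem_tileSet {m : ℕ} {x x' : Fin d → ℤ} (hx : x ∈ tileSet i n₀ m)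
    (hx' : x' ∈ tileSet i n₀ m) (h : x - x' ∈ lattice d (tileSide n₀ m)) : x = x' := by
  induction m generalizing x x' with
  | zero =>
    rw [tileSide, pow_zero, one_mul] at h
    have h1 := cellRep_add x' h
    rw [sub_add_cancel, cellRep_of_mem hx, cellRep_of_mem hx'] at h1
    exact h1
  | succ m ih =>
    obtain ⟨y, hy, t, ht, rfl⟩ := mem_tileSet_succ.1 hx
    obtain ⟨y', hy', t', ht', rfl⟩ := mem_tileSet_succ.1 hx'
    have h1 : y = y' := by
      refine ih hy hy' ?_
      have h2 := lattice_anti (tileSide_dvd (Nat.le_succ m)) h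
      have h3 : tileSide n₀ m • (t - t') ∈ lattice d (tileSide n₀ m) :=
        mem_lattice_iff_exists.2 ⟨_, rfl⟩
      have h4 := sub_mem h2 h3
      rw [smul_sub] at h4
      convert h4 using 1
      abel
    subst h1
    have h5 : t = t' := by
      refine cellRep_injOn_digits i ht ht' ?_
      obtain ⟨z, hz⟩ := mem_lattice_iff_exists.1 h
      rw [add_sub_add_left_eq_sub, ← smul_sub, tileSide_succ, mul_comm, mul_smul] at hz
      have h6 : t - t' = 15 • z := smul_right_injective _ (tileSide_pos n₀ m).ne' hz
      have h7 := cellRep_add (k := 7) t' (mem_lattice_iff_exists.2 ⟨z, h6⟩)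
      rwa [sub_add_cancel] at h7
    rw [h5]

lemma card_tileSet (m : ℕ) : (tileSet i n₀ m).card = tileSide n₀ m ^ d := by
  induction m with
  | zero =>
    change (box d n₀).card = _
    rw [card_box, tileSide, pow_zero, one_mul]
  | succ m ih =>
    rw [tileSet, Finset.card_image₂_iff.2, ih, card_digits, tileSide_succ, mul_pow, mul_comm]
    rintro ⟨x, t⟩ hx ⟨x', t'⟩ hx' h
    have hl : ∀ t : Fin d → ℤ, tileSide n₀ m • t ∈ lattice d (tileSide n₀ m) := fun t =>
      mem_lattice_iff_exists.2 ⟨t, rfl⟩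
    change x + tileSide n₀ m • t = x' + tileSide n₀ m • t' at h
    have h1 : x = x' := by
      refine eq_of_mem_tileSet hx.1 hx'.1 ?_
      rw [sub_eq_sub_iff_add_eq_add.2 (h.trans (add_comm _ _))]
      exact sub_mem (hl t') (hl t)
    rw [h1] at h
    rw [h1, smul_right_injective _ (tileSide_pos n₀ m).ne' (add_left_cancel h)]

lemma isComplement_tileSet (m : ℕ) : AddSubgroup.IsComplement
    (tileSet i n₀ m : Set (Fin d → ℤ)) (lattice d (tileSide n₀ m) : Set (Fin d → ℤ)) := by
  constructor
  · rintro ⟨x, h⟩ ⟨x', h'⟩ he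
    change x.1 + h.1 = x'.1 + h'.1 at he
    have h1 : x.1 = x'.1 := by
      refine eq_of_mem_tileSet x.2 x'.2 ?_
      have : x.1 - x'.1 = h'.1 - h.1 := by
        rw [sub_eq_sub_iff_add_eq_add, he, add_comm]
      rw [this]
      exact sub_mem h'.2 h.2
    refine Prod.ext (Subtype.ext h1) (Subtype.ext ?_)
    rw [h1] at he
    exact add_left_cancel he
  · intro a
    obtain ⟨x, hx, y, rfl⟩ := exists_mem_tileSet (i := i) (n₀ := n₀) m a
    exact ⟨⟨⟨x, hx⟩, ⟨_, mem_lattice_iff_exists.2 ⟨y, rfl⟩⟩⟩, rfl⟩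

/-- The vector `tileSide • y` is a signed sum of three vectors of norm at most `tileSide`. With
`mem_digits_of_norm_le` this makes `y` a digit. -/
lemma mem_digits_of_add_mem {m : ℕ} {x g : Fin d → ℤ} (hx : ‖x‖ ≤ tileSide n₀ m)
    (hg : ‖g‖ ≤ tileSide n₀ m) {x' y : Fin d → ℤ} (hx' : ‖x'‖ ≤ tileSide n₀ m)
    (h : x + g = x' + tileSide n₀ m • y) : ‖y‖ ≤ 3 := by
  have h1 : tileSide n₀ m • y = x + g - x' := by rw [h]; abel
  have h2 : (tileSide n₀ m : ℝ) * ‖y‖ ≤ tileSide n₀ m * 3 := by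
    rw [← norm_nsmul_pi, h1]
    linarith [norm_sub_le (x + g) x', norm_add_le x g]
  exact le_of_mul_le_mul_left h2 (by exact_mod_cast tileSide_pos n₀ m)

/-- The central subtile contributes nothing, since all subtiles reachable from it by `g` have digits
of norm at most `3` and are present. Hence the proportion of leaving points drops by the factor `(15
^ d - 1) / 15 ^ d` at each stage. -/
lemma leave_tileSet_succ_subset {m : ℕ} {g : Fin d → ℤ} (hg : ‖g‖ ≤ tileSide n₀ m) :
    leave (tileSet i n₀ (m + 1)) g ⊆ Finset.image₂ (fun x t => x + tileSide n₀ m • t)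
      (leave (tileSet i n₀ m) g) ((digits i).erase 0) := by
  intro x hx
  obtain ⟨hx, hxg⟩ := mem_leave.1 hx
  obtain ⟨y, hy, t, ht, rfl⟩ := mem_tileSet_succ.1 hx
  refine Finset.mem_image₂.2 ⟨y, mem_leave.2 ⟨hy, fun h => hxg ?_⟩, t,
    Finset.mem_erase.2 ⟨?_, ht⟩, rfl⟩
  · exact mem_tileSet_succ.2 ⟨_, h, t, ht, by abel⟩
  · rintro rfl
    rw [smul_zero, add_zero] at hxg
    obtain ⟨x', hx', z, hz⟩ := exists_mem_tileSet (i := i) (n₀ := n₀) m (y + g)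
    exact hxg (mem_tileSet_succ.2 ⟨x', hx', z, mem_digits_of_norm_le i
      (mem_digits_of_add_mem (norm_le_of_mem_tileSet hy) hg (norm_le_of_mem_tileSet hx') hz),
      hz.symm⟩)

lemma tendsto_leave_tileSet (g : Fin d → ℤ) :
    Tendsto (fun m => ((leave (tileSet i n₀ m) g).card : ℝ) / ((tileSet i n₀ m).card : ℝ))
      atTop (𝓝 0) := by
  obtain ⟨k, hk⟩ := exists_norm_le_nat g
  set u : ℕ → ℝ := fun m => ((leave (tileSet i n₀ m) g).card : ℝ) / ((tileSet i n₀ m).card : ℝ)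
  set q : ℝ := (15 ^ d - 1) / 15 ^ d
  have hq0 : 0 ≤ q := div_nonneg (sub_nonneg.2 (one_le_pow₀ (by norm_num))) (by positivity)
  have hq1 : q < 1 := by
    rw [div_lt_one (by positivity)]
    linarith
  have hstep : ∀ m, k ≤ m → u (m + 1) ≤ q * u m := by
    intro m hm
    have hg : ‖g‖ ≤ tileSide n₀ m :=
      hk.trans (by exact_mod_cast hm.trans (lt_tileSide n₀ m).le)
    have h1 := (Finset.card_le_card (leave_tileSet_succ_subset (i := i) hg)).trans
      (Finset.card_image₂_le _ _ _)
    rw [Finset.card_erase_of_mem (mem_digits_of_norm_le i (by simp)), card_digits] at h1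
    have h2 : ((leave (tileSet i n₀ (m + 1)) g).card : ℝ) ≤
        (leave (tileSet i n₀ m) g).card * (15 ^ d - 1) := by
      have : ((15 ^ d - 1 : ℕ) : ℝ) = 15 ^ d - 1 := by
        rw [Nat.cast_sub (Nat.one_le_pow _ _ (by norm_num))]
        norm_num
      rw [← this]
      exact_mod_cast h1
    simp only [u, q]
    rw [card_tileSet, card_tileSet, tileSide_succ, mul_pow]
    push_cast
    have h3 : (0 : ℝ) < (tileSide n₀ m : ℝ) ^ d :=
      pow_pos (by exact_mod_cast tileSide_pos n₀ m) _
    rw [div_mul_div_comm]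
    refine div_le_div_of_nonneg_right ?_ (by positivity)
    linarith
  have hpow : ∀ j, u (j + k) ≤ q ^ j * u k := by
    intro j
    induction j with
    | zero => simp
    | succ j ih =>
      rw [add_right_comm, pow_succ', mul_assoc]
      exact (hstep _ (Nat.le_add_left _ _)).trans (mul_le_mul_of_nonneg_left ih hq0)
  rw [← tendsto_add_atTop_iff_nat k]
  refine squeeze_zero (fun n => by positivity) hpow ?_
  simpa using (tendsto_pow_atTop_nhds_zero_of_lt_one hq0 hq1).mul_const (u k)

/-- The isolated subtile reproduces all leaving points of the previous stage, as no other subtile is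
adjacent to it. A point with maximal `i`-th coordinate also leaves and lies outside that subtile, so
each stage gains at least one. -/
lemma le_card_leave_tileSet (m : ℕ) :
    m ≤ (leave (tileSet i n₀ m) (Pi.single i 1)).card := by
  induction m with
  | zero => exact Nat.zero_le _
  | succ m ih =>
    obtain ⟨z, hz, hzmax⟩ := Finset.exists_max_image (tileSet i n₀ (m + 1)) (fun x => x i)
      ⟨0, zero_mem_tileSet _⟩
    set s := (leave (tileSet i n₀ m) (Pi.single i 1)).image
      (fun y => y + tileSide n₀ m • Pi.single i (-11))
    have hzs : z ∉ s := by
      intro h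
      obtain ⟨y, hy, rfl⟩ := Finset.mem_image.1 h
      have h1 := hzmax 0 (zero_mem_tileSet _)
      have h2 := (norm_le_pi_norm y i).trans (norm_le_of_mem_tileSet (mem_leave.1 hy).1)
      rw [Int.norm_eq_abs, ← Int.cast_abs] at h2
      have h3 : |y i| ≤ tileSide n₀ m := by exact_mod_cast h2
      have h4 := (abs_le.1 h3).2
      have h5 := tileSide_pos n₀ m
      simp at h1
      omega
    have hsub : insert z s ⊆ leave (tileSet i n₀ (m + 1)) (Pi.single i 1) := by
      refine Finset.insert_subset (mem_leave.2 ⟨hz, fun h => ?_⟩) fun x hx => ?_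
      · have := hzmax _ h
        simp at this
      · obtain ⟨y, hy, rfl⟩ := Finset.mem_image.1 hx
        obtain ⟨hy, hy'⟩ := mem_leave.1 hy
        refine mem_leave.2 ⟨mem_tileSet_succ.2 ⟨y, hy, _, Finset.mem_insert_self _ _, rfl⟩,
          fun h => hy' ?_⟩
        obtain ⟨y', hy1, t, ht, h⟩ := mem_tileSet_succ.1 h
        have h1 : y + Pi.single i 1 = y' + tileSide n₀ m • (t - Pi.single i (-11)) := by
          rw [smul_sub, ← add_sub_assoc, h]
          abel
        have h2 : ‖(Pi.single i 1 : Fin d → ℤ)‖ ≤ tileSide n₀ m := by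
          rw [norm_single]
          simpa using Nat.succ_le_of_lt (tileSide_pos n₀ m)
        have h3 := eq_of_mem_digits_of_norm_le i ht (mem_digits_of_add_mem
          (norm_le_of_mem_tileSet hy) h2 (norm_le_of_mem_tileSet hy1) h1)
        rw [h3, sub_self, smul_zero, add_zero] at h1
        rwa [h1]
    refine le_trans ?_ (Finset.card_le_card hsub)
    rw [Finset.card_insert_of_notMem hzs,
      Finset.card_image_of_injective _ (add_left_injective _)]
    exact Nat.succ_le_succ ih

variable (i n₀) in
/-- The Følner sequence of the tiles `tileSet i n₀ m`. -/
noncomputable def tileSeq : FolnerSeq (Fin d → ℤ) :=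
  FolnerSeq.ofLeave (tileSet i n₀) (fun m => ⟨0, zero_mem_tileSet m⟩) tendsto_leave_tileSet

lemma tileSeq_apply (m : ℕ) : tileSeq i n₀ m = tileSet i n₀ m := rfl

lemma mem_tileSet_iff_of_lt {m n : ℕ} (h : m < n) (x : Fin d → ℤ) :
    x ∈ tileSet i n₀ n ↔ ∃ g ∈ tileSet i n₀ n, g ∈ lattice d (tileSide n₀ m) ∧
      ∃ y ∈ tileSet i n₀ m, x = g + y := by
  have hmul : ∀ {m n : ℕ} (_ : m ≤ n) (t : Fin d → ℤ),
      tileSide n₀ n • t ∈ lattice d (tileSide n₀ m) := fun h t =>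
    lattice_anti (tileSide_dvd h) (mem_lattice_iff_exists.2 ⟨t, rfl⟩)
  induction n, h using Nat.le_induction generalizing x with
  | base =>
    constructor
    · intro hx
      obtain ⟨y, hy, t, ht, rfl⟩ := mem_tileSet_succ.1 hx
      exact ⟨tileSide n₀ m • t, mem_tileSet_succ.2 ⟨0, zero_mem_tileSet m, t, ht, zero_add _⟩,
        hmul le_rfl t, y, hy, add_comm _ _⟩
    · rintro ⟨g, hg, hgl, y, hy, rfl⟩
      obtain ⟨y', hy', t, ht, rfl⟩ := mem_tileSet_succ.1 hg
      have h0 : y' = 0 := by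
        refine eq_of_mem_tileSet hy' (zero_mem_tileSet m) ?_
        have := sub_mem hgl (hmul le_rfl t)
        rwa [add_sub_cancel_right, ← sub_zero y'] at this
      subst h0
      exact mem_tileSet_succ.2 ⟨y, hy, t, ht, by abel⟩
  | succ n hmn ih =>
    have hmn' : m ≤ n := (Nat.lt_of_succ_le hmn).le
    constructor
    · intro hx
      obtain ⟨y, hy, t, ht, rfl⟩ := mem_tileSet_succ.1 hx
      obtain ⟨g, hg, hgl, y, hy', rfl⟩ := (ih y).1 hy
      exact ⟨_, mem_tileSet_succ.2 ⟨g, hg, t, ht, rfl⟩, add_mem hgl (hmul hmn' t), y, hy',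
        by abel⟩
    · rintro ⟨g, hg, hgl, y, hy, rfl⟩
      obtain ⟨g', hg', t, ht, rfl⟩ := mem_tileSet_succ.1 hg
      have hgl' : g' ∈ lattice d (tileSide n₀ m) := by
        have := sub_mem hgl (hmul hmn' t)
        rwa [add_sub_cancel_right] at this
      exact mem_tileSet_succ.2 ⟨g' + y, (ih _).2 ⟨g', hg', hgl', y, hy, rfl⟩, t, ht, by abel⟩

theorem isFolnerSection_tileSeq :
    IsFolnerSection (fun m => lattice d (tileSide n₀ m)) (tileSeq i n₀) where
  fundamental := isComplement_tileSet
  zero_mem := zero_mem_tileSet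
  mono := tileSet_mono
  exhaust g := by
    obtain ⟨m, hm⟩ := exists_norm_le_nat g
    have hm' : ‖g‖ ≤ tileSide n₀ m := hm.trans (by exact_mod_cast (lt_tileSide n₀ m).le)
    obtain ⟨x, hx, y, rfl⟩ := exists_mem_tileSet (i := i) (n₀ := n₀) m g
    refine ⟨m + 1, mem_tileSet_succ.2 ⟨x, hx, y, mem_digits_of_norm_le i ?_, rfl⟩⟩
    exact mem_digits_of_add_mem (x := 0) (by simp) hm' (norm_le_of_mem_tileSet hx) (zero_add _)
  tile _ _ h x := mem_tileSet_iff_of_lt h x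

theorem isTower_lattice (i : Fin d) (n₀ : ℕ) : IsTower (fun m => lattice d (tileSide n₀ m)) where
  normal _ := inferInstance
  finiteIndex m := by
    refine ⟨?_⟩
    rw [← (isComplement_tileSet (i := i) (n₀ := n₀) m).card_left]
    simpa using Finset.nonempty_iff_ne_empty.1 ⟨0, zero_mem_tileSet (i := i) m⟩
  nested _ _ h := lattice_anti (tileSide_dvd h)
  iInf_eq := by
    refine (AddSubgroup.eq_bot_iff_forall _).2 fun v hv => funext fun j => ?_
    rw [AddSubgroup.mem_iInf] at hv
    -- The level is chosen as `|v j|`, so that the side length exceeds the coordinate it divides.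
    refine Int.eq_zero_of_abs_lt_dvd (hv (v j).natAbs j) ?_
    rw [Int.abs_eq_natAbs]
    exact_mod_cast lt_tileSide n₀ _
  exists_section := ⟨tileSeq i n₀, isFolnerSection_tileSeq⟩

lemma le_card_boundary_tileSeq {R : ℝ} (hR : 1 ≤ R) (m : ℕ) :
    m ≤ (boundary R (tileSeq i n₀ m)).card := by
  refine (le_card_leave_tileSet (i := i) (n₀ := n₀) m).trans (Finset.card_le_card fun x hx => ?_)
  obtain ⟨h1, h2⟩ := mem_leave.1 hx
  refine mem_boundary.2 ⟨h1, _, h2, ?_⟩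
  rw [sub_add_cancel_left, norm_neg, norm_single]
  simpa using hR

end TileSets

/-! ### Automorphisms acting by permutations of the patterns of the cells -/

noncomputable section TileMaps

universe u

variable {d : ℕ} {A : Type u} [TopologicalSpace A] {X : Subshift A (Fin d → ℤ)}

/-- The pattern of `x` on the box centred at `g`. -/
def cellPat (n : ℕ) (x : X.carrier) (g : Fin d → ℤ) : patterns X (box d n) :=
  ⟨(box d n).restrict (shift g x.1), restrict_mem_patterns (shift_mem x.2 g) _⟩

lemma cellPat_apply (n : ℕ) (x : X.carrier) (g : Fin d → ℤ) (b : box d n) :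
    (cellPat n x g).1 b = x.1 (g + b) := rfl

lemma exists_cellPat_zero_eq {n : ℕ} (p : patterns X (box d n)) :
    ∃ x : X.carrier, cellPat n x 0 = p := by
  obtain ⟨x, hx, hp⟩ := p.2
  refine ⟨⟨x, hx⟩, Subtype.ext ?_⟩
  rw [← hp]
  ext b
  rw [cellPat_apply, zero_add]
  rfl

/-- A family of maps of patterns which do not change the patterns on the boundary. -/
def PreservesBoundary (S : ℝ) {n : ℕ}
    (π : (Fin d → ℤ) → patterns X (box d n) → patterns X (box d n)) : Prop :=
  ∀ g p a (ha : a ∈ boundary S (box d n)),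
    (π g p).1 ⟨a, boundary_subset _ _ ha⟩ = p.1 ⟨a, boundary_subset _ _ ha⟩

/-- Apply `π g` to the pattern in the cell centred at `g`, for all `g`. -/
def tileFun {n : ℕ} (π : (Fin d → ℤ) → patterns X (box d n) → patterns X (box d n))
    (x : X.carrier) : (Fin d → ℤ) → A :=
  fun a => (π (cellBase n a) (cellPat n x (cellBase n a))).1 ⟨cellRep n a, cellRep_mem n a⟩

lemma mem_boundary_image {S : ℝ} {F : Finset (Fin d → ℤ)} {g a : Fin d → ℤ}
    (h : g + a ∈ boundary S (F.image (fun x => g + x))) : a ∈ boundary S F := by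
  obtain ⟨h1, y, hy, hay⟩ := mem_boundary.1 h
  obtain ⟨a', ha', haa⟩ := Finset.mem_image.1 h1
  obtain rfl := add_left_cancel haa
  refine mem_boundary.2 ⟨ha', y - g, fun hyg => hy ?_, ?_⟩
  · exact Finset.mem_image.2 ⟨_, hyg, by abel⟩
  · convert hay using 2
    abel

lemma tileFun_mem {ω : ℕ} (hX : IsLocal X ω) {S : ℝ} (hS : 2 * ω ≤ S) {n : ℕ}
    {π : (Fin d → ℤ) → patterns X (box d n) → patterns X (box d n)}
    (hπ : PreservesBoundary S π) (x : X.carrier) : tileFun π x ∈ X.carrier := by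
  refine hX.glue hS (fun g : lattice d (2 * n + 1) => (box d n).image (fun b => g.1 + b)) x.2
    (fun g => ?_) (fun a => ?_)
  · obtain ⟨y, hy⟩ := exists_cellPat_zero_eq (π g.1 (cellPat n x g.1))
    refine ⟨_, shift_mem y.2 (-g.1), fun a ha => ?_⟩
    obtain ⟨b, hb, rfl⟩ := Finset.mem_image.1 ha
    simp only [tileFun, cellBase_add b g.2, cellRep_add b g.2, cellBase_of_mem hb,
      cellRep_of_mem hb, add_zero]
    rw [← hy, cellPat_apply]
    simp
  · by_cases h : cellRep n a ∈ boundary S (box d n)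
    · left
      rw [tileFun, hπ _ _ _ h, cellPat_apply, cellBase_add_cellRep]
    · right
      refine ⟨⟨_, cellBase_mem n a⟩, Finset.mem_image.2 ⟨_, cellRep_mem n a,
        cellBase_add_cellRep n a⟩, fun h' => h ?_⟩
      refine mem_boundary_image (g := cellBase n a) ?_
      rwa [cellBase_add_cellRep]

/-- The selfmap of `X` applying `π g` to the pattern in the cell centred at `g`, for all `g`. -/
def tileMap {ω : ℕ} (hX : IsLocal X ω) {S : ℝ} (hS : 2 * ω ≤ S) {n : ℕ}
    (π : (Fin d → ℤ) → patterns X (box d n) → patterns X (box d n))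
    (hπ : PreservesBoundary S π) (x : X.carrier) : X.carrier :=
  ⟨tileFun π x, tileFun_mem hX hS hπ x⟩

variable {ω : ℕ} (hX : IsLocal X ω) {S : ℝ} (hS : 2 * ω ≤ S) {n : ℕ}
  {π π' : (Fin d → ℤ) → patterns X (box d n) → patterns X (box d n)}

lemma tileMap_apply (hπ : PreservesBoundary S π) (x : X.carrier) (a : Fin d → ℤ) :
    (tileMap hX hS π hπ x).1 a =
      (π (cellBase n a) (cellPat n x (cellBase n a))).1 ⟨cellRep n a, cellRep_mem n a⟩ := rfl

lemma cellPat_tileMap (hπ : PreservesBoundary S π) (x : X.carrier) {g : Fin d → ℤ}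
    (hg : g ∈ lattice d (2 * n + 1)) :
    cellPat n (tileMap hX hS π hπ x) g = π g (cellPat n x g) := by
  refine Subtype.ext (funext fun b => ?_)
  rw [cellPat_apply, tileMap_apply]
  simp only [cellBase_add b.1 hg, cellRep_add b.1 hg, cellBase_of_mem b.2, cellRep_of_mem b.2,
    add_zero]

lemma PreservesBoundary.comp (hπ : PreservesBoundary S π) (hπ' : PreservesBoundary S π') :
    PreservesBoundary S (fun g p => π g (π' g p)) :=
  fun g p a ha => (hπ g _ a ha).trans (hπ' g p a ha)

lemma tileMap_tileMap (hπ : PreservesBoundary S π) (hπ' : PreservesBoundary S π')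
    (x : X.carrier) : tileMap hX hS π hπ (tileMap hX hS π' hπ' x) =
      tileMap hX hS (fun g p => π g (π' g p)) (hπ.comp hπ') x := by
  refine Subtype.ext (funext fun a => ?_)
  rw [tileMap_apply, tileMap_apply, cellPat_tileMap hX hS hπ' x (cellBase_mem n a)]

lemma tileMap_eq_self (hπ : PreservesBoundary S π) (h : ∀ g p, π g p = p) (x : X.carrier) :
    tileMap hX hS π hπ x = x := by
  refine Subtype.ext (funext fun a => ?_)
  rw [tileMap_apply, h, cellPat_apply, cellBase_add_cellRep]

lemma continuous_tileMap [Finite A] [DiscreteTopology A] (hπ : PreservesBoundary S π) :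
    Continuous (tileMap hX hS π hπ) := by
  refine Continuous.subtype_mk (continuous_pi fun a => ?_) _
  have h1 : Continuous (fun x : X.carrier => cellPat n x (cellBase n a)) := by
    refine Continuous.subtype_mk (continuous_pi fun b => ?_) _
    exact (continuous_apply (cellBase n a + b.1)).comp continuous_subtype_val
  exact (continuous_of_discreteTopology (f := fun p : patterns X (box d n) =>
    (π (cellBase n a) p).1 ⟨cellRep n a, cellRep_mem n a⟩)).comp h1

lemma tileMap_shiftHomeo {σ : patterns X (box d n) → patterns X (box d n)}
    (hσ : PreservesBoundary S (fun _ => σ)) {h : Fin d → ℤ} (hh : h ∈ lattice d (2 * n + 1))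
    (x : X.carrier) : tileMap hX hS _ hσ (shiftHomeo X h x) =
      shiftHomeo X h (tileMap hX hS _ hσ x) := by
  refine Subtype.ext (funext fun a => ?_)
  rw [shiftHomeo_apply, tileMap_apply, tileMap_apply]
  have h1 : cellPat n (shiftHomeo X h x) (cellBase n a) = cellPat n x (cellBase n (h + a)) := by
    refine Subtype.ext (funext fun b => ?_)
    rw [cellPat_apply, cellPat_apply, shiftHomeo_apply, cellBase_add a hh, add_assoc]
  simp only [h1, cellRep_add a hh]

variable (X S n) in
/-- The permutations of the patterns on a box which do not change the patterns on the boundary. -/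
def boundaryPerm : Subgroup (Equiv.Perm (patterns X (box d n))) where
  carrier := {π | PreservesBoundary S (fun _ => π)}
  one_mem' := fun _ _ _ _ => rfl
  mul_mem' := by
    intro π σ hπ hσ
    exact PreservesBoundary.comp (π := fun _ => π) (π' := fun _ => σ) hπ hσ
  inv_mem' := by
    intro π hπ g p a ha
    have h1 := hπ g (π⁻¹ p) a ha
    have h2 : π (π⁻¹ p) = p := Equiv.apply_symm_apply π p
    simp only [h2] at h1
    exact h1.symm

lemma boundaryPerm_preserves (π : boundaryPerm X S n) : PreservesBoundary S (fun _ => ⇑π.1) := π.2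

lemma boundaryPerm_inv_apply (π : boundaryPerm X S n) (p : patterns X (box d n)) :
    (π⁻¹).1 (π.1 p) = p := Equiv.symm_apply_apply π.1 p

lemma boundaryPerm_apply_inv (π : boundaryPerm X S n) (p : patterns X (box d n)) :
    π.1 ((π⁻¹).1 p) = p := Equiv.apply_symm_apply π.1 p

/-- The action of the boundary preserving permutations of patterns on `X`, applied to all cells
simultaneously. -/
def tileHom [Finite A] [DiscreteTopology A] : boundaryPerm X S n →* (X.carrier ≃ₜ X.carrier) where
  toFun π :=
    { toFun := tileMap hX hS (fun _ => ⇑π.1) (boundaryPerm_preserves π)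
      invFun := tileMap hX hS (fun _ => ⇑(π⁻¹).1) (boundaryPerm_preserves π⁻¹)
      left_inv := fun x => by
        rw [tileMap_tileMap]
        exact tileMap_eq_self _ _ _ (fun _ p => boundaryPerm_inv_apply π p) x
      right_inv := fun x => by
        rw [tileMap_tileMap]
        exact tileMap_eq_self _ _ _ (fun _ p => boundaryPerm_apply_inv π p) x
      continuous_toFun := continuous_tileMap _ _ _
      continuous_invFun := continuous_tileMap _ _ _ }
  map_one' := Homeomorph.ext fun x =>
    tileMap_eq_self hX hS (boundaryPerm_preserves 1) (fun _ _ => rfl) x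
  map_mul' π σ := Homeomorph.ext fun x => (tileMap_tileMap hX hS (boundaryPerm_preserves π) (boundaryPerm_preserves σ) x).symm

variable [Finite A] [DiscreteTopology A]

lemma tileHom_apply (π : boundaryPerm X S n) (x : X.carrier) :
    tileHom hX hS π x = tileMap hX hS (fun _ => ⇑π.1) (boundaryPerm_preserves π) x := rfl

lemma cellPat_tileHom (π : boundaryPerm X S n) (x : X.carrier) :
    cellPat n (tileHom hX hS π x) 0 = π.1 (cellPat n x 0) :=
  cellPat_tileMap hX hS (boundaryPerm_preserves π) x (zero_mem _)

/-- Every pattern occurs in the cell at the origin, where the permutation can be read off. -/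
lemma tileHom_injective : Function.Injective (tileHom (n := n) hX hS) := by
  intro π σ h
  refine Subtype.ext (Equiv.ext fun p => ?_)
  obtain ⟨x, rfl⟩ := exists_cellPat_zero_eq p
  rw [← cellPat_tileHom hX hS π, ← cellPat_tileHom hX hS σ, h]

lemma tileHom_mem_aut (π : boundaryPerm X S n) :
    tileHom hX hS π ∈ aut X (lattice d (2 * n + 1)) := by
  rw [aut, Subgroup.mem_centralizer_iff]
  rintro _ ⟨h, hh, rfl⟩
  exact Homeomorph.ext fun x => (tileMap_shiftHomeo hX hS (boundaryPerm_preserves π) hh x).symm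

end TileMaps

/-! ### Cell permutations viewed on larger boxes -/

noncomputable section Refine

universe u

variable {d : ℕ} {A : Type u} [TopologicalSpace A] {X : Subshift A (Fin d → ℤ)}

/-- A box whose side length is a multiple of that of a smaller one is a union of cells. -/
lemma cellBase_add_mem_box {n m : ℕ} (h : 2 * n + 1 ∣ 2 * m + 1) {a b : Fin d → ℤ}
    (ha : a ∈ box d m) (hb : b ∈ box d n) : cellBase n a + b ∈ box d m := by
  obtain ⟨c, hc⟩ := h
  refine mem_box_iff.2 fun i => ?_
  obtain ⟨q, hq⟩ := cellBase_mem n a i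
  have h1 := mem_box_iff.1 ha i
  have h2 := mem_box_iff.1 hb i
  have h3 := mem_box_iff.1 (cellRep_mem n a) i
  have h4 : a i = cellBase n a i + cellRep n a i := by
    rw [← Pi.add_apply, cellBase_add_cellRep]
  obtain ⟨k, rfl⟩ : ∃ k, c = 2 * k + 1 := by
    rcases Nat.even_or_odd' c with ⟨k, rfl | rfl⟩
    · exfalso
      have : 2 * m + 1 = 2 * ((2 * n + 1) * k) := by rw [hc]; ring
      omega
    · exact ⟨k, rfl⟩
  have hm : (m : ℤ) = n + (2 * n + 1) * k := by
    have : (2 * m + 1 : ℤ) = (2 * n + 1) * (2 * k + 1) := by exact_mod_cast hc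
    linarith
  push_cast at hq
  have hn : (0 : ℤ) < 2 * n + 1 := by positivity
  have hq1 : q ≤ k := by
    by_contra! hlt
    have : (2 * n + 1 : ℤ) * (k + 1) ≤ (2 * n + 1) * q := by
      exact mul_le_mul_of_nonneg_left (by omega) hn.le
    linarith
  have hq2 : -(k : ℤ) ≤ q := by
    by_contra! hlt
    have : (2 * n + 1 : ℤ) * q ≤ (2 * n + 1) * (-k - 1) := by
      exact mul_le_mul_of_nonneg_left (by omega) hn.le
    linarith
  have h5 : (2 * n + 1 : ℤ) * q ≤ (2 * n + 1) * k := mul_le_mul_of_nonneg_left hq1 hn.le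
  have h6 : (2 * n + 1 : ℤ) * (-k) ≤ (2 * n + 1) * q := mul_le_mul_of_nonneg_left hq2 hn.le
  rw [Pi.add_apply, hq]
  constructor <;> linarith

variable {ω : ℕ} (hX : IsLocal X ω) {S : ℝ} (hS : 2 * ω ≤ S) {n m : ℕ}
  {π π' : (Fin d → ℤ) → patterns X (box d n) → patterns X (box d n)}

/-- Divisibility makes the large box a union of cells, so its new pattern depends only on its old
one; hence `refinePat` does not depend on the chosen extension. -/
lemma cellPat_tileMap_congr (h : 2 * n + 1 ∣ 2 * m + 1) (hπ : PreservesBoundary S π)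
    {x x' : X.carrier} (hx : cellPat m x 0 = cellPat m x' 0) :
    cellPat m (tileMap hX hS π hπ x) 0 = cellPat m (tileMap hX hS π hπ x') 0 := by
  refine Subtype.ext (funext fun a => ?_)
  rw [cellPat_apply, cellPat_apply, zero_add, tileMap_apply, tileMap_apply]
  have h1 : cellPat n x (cellBase n a.1) = cellPat n x' (cellBase n a.1) := by
    refine Subtype.ext (funext fun b => ?_)
    have := congrFun (congrArg Subtype.val hx) ⟨_, cellBase_add_mem_box h a.2 b.2⟩
    rw [cellPat_apply, cellPat_apply] at this
    rw [cellPat_apply, cellPat_apply]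
    simpa using this
  rw [h1]

/-- A point near the complement of the large box is as near to the complement of its own cell,
because that cell lies in the box. -/
lemma tileMap_apply_of_mem_boundary (h : 2 * n + 1 ∣ 2 * m + 1) (hπ : PreservesBoundary S π)
    (x : X.carrier) {a : Fin d → ℤ} (ha : a ∈ boundary S (box d m)) :
    (tileMap hX hS π hπ x).1 a = x.1 a := by
  obtain ⟨h1, e, he, hae⟩ := mem_boundary.1 ha
  have h2 : cellRep n a ∈ boundary S (box d n) := by
    refine mem_boundary.2 ⟨cellRep_mem n a, e - cellBase n a, fun hmem => he ?_, ?_⟩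
    · have := cellBase_add_mem_box h h1 hmem
      rwa [add_sub_cancel] at this
    · convert hae using 2
      rw [cellBase]
      abel
  rw [tileMap_apply, hπ _ _ _ h2, cellPat_apply, cellBase_add_cellRep]

/-- The map on patterns of a large box induced by a map of the patterns of cells. -/
def refinePat (π : (Fin d → ℤ) → patterns X (box d n) → patterns X (box d n))
    (hπ : PreservesBoundary S π) (p : patterns X (box d m)) : patterns X (box d m) :=
  cellPat m (tileMap hX hS π hπ (exists_cellPat_zero_eq p).choose) 0

lemma refinePat_cellPat (h : 2 * n + 1 ∣ 2 * m + 1) (hπ : PreservesBoundary S π)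
    (x : X.carrier) :
    refinePat hX hS π hπ (cellPat m x 0) = cellPat m (tileMap hX hS π hπ x) 0 :=
  cellPat_tileMap_congr hX hS h hπ (exists_cellPat_zero_eq (cellPat m x 0)).choose_spec

lemma refinePat_preservesBoundary (h : 2 * n + 1 ∣ 2 * m + 1) (hπ : PreservesBoundary S π) :
    PreservesBoundary S (fun _ => refinePat (m := m) hX hS π hπ) := by
  intro g p a ha
  obtain ⟨x, rfl⟩ := exists_cellPat_zero_eq p
  simp only [refinePat_cellPat hX hS h hπ, cellPat_apply, zero_add]
  exact tileMap_apply_of_mem_boundary hX hS h hπ x ha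

/-- The permutation of the patterns of a large box induced by a permutation of the patterns of
cells. -/
def refinePerm (h : 2 * n + 1 ∣ 2 * m + 1) (π : boundaryPerm X S n) : boundaryPerm X S m :=
  ⟨{  toFun := refinePat hX hS (fun _ => ⇑π.1) (boundaryPerm_preserves π)
      invFun := refinePat hX hS (fun _ => ⇑(π⁻¹).1) (boundaryPerm_preserves π⁻¹)
      left_inv := fun p => by
        obtain ⟨x, rfl⟩ := exists_cellPat_zero_eq p
        rw [refinePat_cellPat hX hS h, refinePat_cellPat hX hS h, tileMap_tileMap,
          tileMap_eq_self _ _ _ (fun _ p => boundaryPerm_inv_apply π p) x]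
      right_inv := fun p => by
        obtain ⟨x, rfl⟩ := exists_cellPat_zero_eq p
        rw [refinePat_cellPat hX hS h, refinePat_cellPat hX hS h, tileMap_tileMap,
          tileMap_eq_self _ _ _ (fun _ p => boundaryPerm_apply_inv π p) x] },
    refinePat_preservesBoundary hX hS h (boundaryPerm_preserves π)⟩

variable [Finite A] [DiscreteTopology A]

lemma refinePerm_cellPat (h : 2 * n + 1 ∣ 2 * m + 1) (π : boundaryPerm X S n) (x : X.carrier) :
    (refinePerm hX hS h π).1 (cellPat m x 0) = cellPat m (tileHom hX hS π x) 0 :=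
  refinePat_cellPat hX hS h (boundaryPerm_preserves π) x

lemma tileHom_refinePerm (h : 2 * n + 1 ∣ 2 * m + 1) (π : boundaryPerm X S n) :
    tileHom hX hS (refinePerm hX hS h π) = tileHom hX hS π := by
  refine Homeomorph.ext fun x => Subtype.ext (funext fun a => ?_)
  have hg := cellBase_mem m a
  set g := cellBase m a with hgdef
  have h1 : cellPat m x g = cellPat m (shiftHomeo X g x) 0 := by
    refine Subtype.ext (funext fun b => ?_)
    rw [cellPat_apply, cellPat_apply, shiftHomeo_apply, zero_add]
  rw [tileHom_apply, tileMap_apply, ← hgdef]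
  have hg' : g ∈ lattice d (2 * n + 1) := lattice_anti h hg
  have h2 : tileHom hX hS π (shiftHomeo X g x) = shiftHomeo X g (tileHom hX hS π x) :=
    tileMap_shiftHomeo hX hS (boundaryPerm_preserves π) hg' x
  simp only [h1, refinePerm_cellPat, h2, cellPat_apply, shiftHomeo_apply, zero_add]
  rw [hgdef, cellBase_add_cellRep]

lemma refinePerm_pow_three (h : 2 * n + 1 ∣ 2 * m + 1) {π : boundaryPerm X S n}
    (hπ : π ^ 3 = 1) : refinePerm hX hS h π ^ 3 = 1 := by
  apply tileHom_injective hX hS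
  rw [map_pow, tileHom_refinePerm, ← map_pow, hπ, map_one, map_one]

/-- If fewer patterns of a cell are fixed by `π` than moved, the same holds for the patterns of a
large box with given boundary. -/
lemma exists_injOn_fixed (h : 2 * n + 1 ∣ 2 * m + 1) (π : boundaryPerm X S n)
    {j : patterns X (box d n) → patterns X (box d n)} (hj : PreservesBoundary S (fun _ => j))
    (hj1 : ∀ p, π.1 p = p → π.1 (j p) ≠ j p) (hj2 : Set.InjOn j {p | π.1 p = p}) :
    ∃ J : patterns X (box d m) → patterns X (box d m), PreservesBoundary S (fun _ => J) ∧
      (∀ p, (refinePerm hX hS h π).1 p = p → (refinePerm hX hS h π).1 (J p) ≠ J p) ∧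
      Set.InjOn J {p | (refinePerm hX hS h π).1 p = p} := by
  classical
  -- Changing the central cell alone suffices: if the large pattern is fixed then so is its central
  -- cell, and moving that cell makes the whole pattern moved. The other cells are untouched, which
  -- preserves injectivity.
  let j0 : (Fin d → ℤ) → patterns X (box d n) → patterns X (box d n) :=
    fun g => if g = 0 then j else id
  have hj0 : PreservesBoundary S j0 := by
    intro g p a ha
    by_cases hg : g = 0
    · simp only [j0, hg, if_true]
      exact hj 0 p a ha
    · simp only [j0, hg, if_false, id]
  have hnm : n ≤ m := by
    have := Nat.le_of_dvd (by omega) h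
    omega
  have hsub : ∀ a ∈ box d n, a ∈ box d m := fun a ha =>
    mem_box.2 ((mem_box.1 ha).trans (by exact_mod_cast hnm))
  have hrestr : ∀ x y : X.carrier, cellPat m x 0 = cellPat m y 0 →
      cellPat n x 0 = cellPat n y 0 := fun x y hxy => Subtype.ext (funext fun b =>
    congrFun (congrArg Subtype.val hxy) ⟨b.1, hsub _ b.2⟩)
  have hfix : ∀ x : X.carrier, (refinePerm hX hS h π).1 (cellPat m x 0) = cellPat m x 0 →
      π.1 (cellPat n x 0) = cellPat n x 0 := by
    intro x hx
    rw [refinePerm_cellPat] at hx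
    rw [← cellPat_tileHom hX hS π]
    exact hrestr _ _ hx
  have hJ : ∀ x, cellPat n (tileMap hX hS j0 hj0 x) 0 = j (cellPat n x 0) := by
    intro x
    rw [cellPat_tileMap hX hS hj0 x (zero_mem _)]
    simp only [j0, if_true]
  refine ⟨refinePat hX hS j0 hj0, refinePat_preservesBoundary hX hS h hj0, fun p hp h' => ?_,
    fun p hp q hq hpq => ?_⟩
  · obtain ⟨x, rfl⟩ := exists_cellPat_zero_eq p
    rw [refinePat_cellPat hX hS h hj0] at h'
    have h1 := hfix _ h'
    rw [hJ] at h1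
    exact hj1 _ (hfix x hp) h1
  · obtain ⟨x, rfl⟩ := exists_cellPat_zero_eq p
    obtain ⟨y, rfl⟩ := exists_cellPat_zero_eq q
    rw [refinePat_cellPat hX hS h hj0, refinePat_cellPat hX hS h hj0] at hpq
    have h1 := hrestr _ _ hpq
    rw [hJ, hJ] at h1
    have h2 := hj2 (hfix x hp) (hfix y hq) h1
    refine Subtype.ext (funext fun a => ?_)
    by_cases ha : cellBase n a.1 = 0
    · have h3 : a.1 ∈ box d n := by
        rw [← cellBase_add_cellRep n a.1, ha, zero_add]
        exact cellRep_mem n _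
      exact congrFun (congrArg Subtype.val h2) ⟨a.1, h3⟩
    · have h3 := congrFun (congrArg Subtype.val hpq) a
      rw [cellPat_apply, cellPat_apply, tileMap_apply, tileMap_apply] at h3
      simp only [zero_add, j0, if_neg ha, id, cellPat_apply, cellBase_add_cellRep] at h3
      rw [cellPat_apply, cellPat_apply, zero_add]
      exact h3

end Refine

/-! ### Permutations of order three of finite sets -/

section OrderThree

lemma pow_three_apply {Ω : Type*} {φ : Equiv.Perm Ω} (h : φ ^ 3 = 1) (p : Ω) :
    φ (φ (φ p)) = p := by
  have := DFunLike.congr_fun h p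
  simpa [pow_succ] using this

/-- A set without fixed points which is invariant under a permutation of order three is a union
of three-cycles. -/
lemma exists_threeCycles {Ω : Type*} [Finite Ω] {φ : Equiv.Perm Ω} (h3 : φ ^ 3 = 1) (s : Set Ω)
    (hs : ∀ p ∈ s, φ p ∈ s) (hs' : ∀ p ∈ s, φ p ≠ p) :
    ∃ (b : ℕ) (ρ : Fin b × ZMod 3 → Ω), Function.Injective ρ ∧ Set.range ρ = s ∧
      ∀ x z, φ (ρ (x, z)) = ρ (x, z + 1) := by
  classical
  have h3' := pow_three_apply h3
  induction hn : s.ncard using Nat.strong_induction_on generalizing s with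
  | _ n ih =>
    rcases s.eq_empty_or_nonempty with rfl | ⟨p, hp⟩
    · exact ⟨0, fun x => x.1.elim0, fun x => x.1.elim0, by
        ext; simp, fun x => x.elim0⟩
    have hpc : φ p ≠ p := hs' p hp
    have hpc2 : φ (φ p) ≠ p := by
      intro h
      have := h3' p
      rw [h] at this
      exact hpc this
    have hpc3 : φ (φ p) ≠ φ p := fun h => hpc (φ.injective h)
    let o : ZMod 3 → Ω := fun z => if z = 0 then p else if z = 1 then φ p else φ (φ p)
    have hz : ∀ z : ZMod 3, z = 0 ∨ z = 1 ∨ z = 2 := by decide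
    have ho0 : o 0 = p := rfl
    have ho1 : o 1 = φ p := rfl
    have ho2 : o 2 = φ (φ p) := rfl
    have hoinj : Function.Injective o := by
      intro z z' h
      rcases hz z with rfl | rfl | rfl <;> rcases hz z' with rfl | rfl | rfl <;>
        simp only [ho0, ho1, ho2] at h <;>
        first
          | rfl
          | exact absurd h hpc
          | exact absurd h.symm hpc
          | exact absurd h hpc2
          | exact absurd h.symm hpc2
          | exact absurd h hpc3
          | exact absurd h.symm hpc3
    have hostep : ∀ z, φ (o z) = o (z + 1) := by
      intro z
      rcases hz z with rfl | rfl | rfl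
      · rfl
      · rfl
      · exact h3' p
    have hos : ∀ z, o z ∈ s := by
      intro z
      rcases hz z with rfl | rfl | rfl
      exacts [hp, hs _ hp, hs _ (hs _ hp)]
    have hback : ∀ q, φ q ∈ Set.range o → q ∈ Set.range o := by
      rintro q ⟨z, hq⟩
      refine ⟨z - 1, φ.injective ?_⟩
      rw [hostep, sub_add_cancel, hq]
    obtain ⟨b, ρ, hρ1, hρ2, hρ3⟩ := ih (s \ Set.range o).ncard (by
      rw [← hn]
      exact Set.ncard_lt_ncard ⟨Set.sdiff_subset, fun hsub => (hsub hp).2 ⟨0, rfl⟩⟩ (Set.toFinite _))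
      (s \ Set.range o) (fun q hq => ⟨hs q hq.1, fun hq' => hq.2 (hback q hq')⟩)
      (fun q hq => hs' q hq.1) rfl
    have hρo : ∀ y z, ρ y ≠ o z := by
      intro y z h
      have : ρ y ∈ s \ Set.range o := by rw [← hρ2]; exact ⟨y, rfl⟩
      exact this.2 ⟨z, h.symm⟩
    refine ⟨b + 1, fun y => Fin.cases (o y.2) (fun x => ρ (x, y.2)) y.1, ?_, ?_, ?_⟩
    · rintro ⟨x, z⟩ ⟨x', z'⟩ h
      induction x using Fin.cases with
      | zero =>
        induction x' using Fin.cases with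
        | zero => exact Prod.ext rfl (hoinj h)
        | succ x' => exact absurd h.symm (hρo _ _)
      | succ x =>
        induction x' using Fin.cases with
        | zero => exact absurd h (hρo _ _)
        | succ x' =>
          have h1 : (x, z) = (x', z') := hρ1 h
          obtain ⟨rfl, rfl⟩ := Prod.mk.inj h1
          rfl
    · apply Set.eq_of_subset_of_subset
      · rintro _ ⟨⟨x, z⟩, rfl⟩
        induction x using Fin.cases with
        | zero => exact hos z
        | succ x =>
          have : ρ (x, z) ∈ s \ Set.range o := by rw [← hρ2]; exact ⟨_, rfl⟩
          exact this.1
      · intro q hq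
        by_cases hqo : q ∈ Set.range o
        · obtain ⟨z, rfl⟩ := hqo
          exact ⟨(0, z), rfl⟩
        · have : q ∈ Set.range ρ := by rw [hρ2]; exact ⟨hq, hqo⟩
          obtain ⟨⟨x, z⟩, rfl⟩ := this
          exact ⟨(x.succ, z), rfl⟩
    · intro x z
      induction x using Fin.cases with
      | zero => exact hostep z
      | succ x => exact hρ3 x z

/-- A set with at least three elements has a permutation of order three with at most as many fixed
as moved points. -/
lemma exists_orderThree {E : Type*} [Finite E] (hE : 3 ≤ Nat.card E) :
    ∃ (φ : E → E) (j : E → E), (∀ p, φ (φ (φ p)) = p) ∧ (∀ p, φ p = p → φ (j p) ≠ j p) ∧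
      Set.InjOn j {p | φ p = p} := by
  classical
  -- Use `a` three-cycles and at most two fixed points, which `j` sends to distinct points of the
  -- first cycle.
  set a := Nat.card E / 3
  set s := Nat.card E % 3
  have ha : 0 < a := Nat.div_pos hE (by norm_num)
  have hs : s < 3 := Nat.mod_lt _ (by norm_num)
  have hcard : Nat.card E = Nat.card ((Fin a × ZMod 3) ⊕ Fin s) := by
    rw [Nat.card_sum, Nat.card_prod]
    simp only [Nat.card_eq_fintype_card, Fintype.card_fin, ZMod.card]
    omega
  obtain ⟨f⟩ := Finite.card_eq.1 hcard
  let φ0 : (Fin a × ZMod 3) ⊕ Fin s → (Fin a × ZMod 3) ⊕ Fin s :=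
    Sum.map (fun x => (x.1, x.2 + 1)) id
  let j0 : (Fin a × ZMod 3) ⊕ Fin s → (Fin a × ZMod 3) ⊕ Fin s :=
    Sum.elim Sum.inl (fun i => Sum.inl (⟨0, ha⟩, ((i : ℕ) : ZMod 3)))
  have hz : ∀ z : ZMod 3, z + 1 ≠ z := by decide
  have hmoved : ∀ x, φ0 (Sum.inl x) ≠ Sum.inl x := by
    intro x hx
    have := congrArg Prod.snd (Sum.inl_injective hx)
    exact hz _ this
  have hfix : ∀ y, φ0 y = y → ∃ i, y = Sum.inr i := by
    rintro (x | i) hy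
    · exact absurd hy (hmoved x)
    · exact ⟨i, rfl⟩
  have hz3 : ∀ z : ZMod 3, z + 1 + 1 + 1 = z := by decide
  refine ⟨fun p => f.symm (φ0 (f p)), fun p => f.symm (j0 (f p)), fun p => ?_, fun p hp => ?_,
    fun p hp q hq hpq => ?_⟩
  · simp only [Equiv.apply_symm_apply]
    rw [Equiv.symm_apply_eq]
    rcases f p with x | i
    · simp [φ0, hz3]
    · rfl
  · rw [Equiv.symm_apply_eq] at hp
    obtain ⟨i, hi⟩ := hfix _ hp
    intro h
    simp only [Equiv.apply_symm_apply] at h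
    have h1 := f.symm.injective h
    rw [hi] at h1
    exact hmoved _ h1
  · rw [Set.mem_ofPred_eq, Equiv.symm_apply_eq] at hp hq
    obtain ⟨i, hi⟩ := hfix _ hp
    obtain ⟨k, hk⟩ := hfix _ hq
    have h1 := f.symm.injective hpq
    rw [hi, hk] at h1
    have h2 := congrArg Prod.snd (Sum.inl_injective h1)
    have h3 : i = k := by
      have h4 := congrArg ZMod.val h2
      simp only [ZMod.val_natCast] at h4
      rw [Nat.mod_eq_of_lt (i.2.trans hs), Nat.mod_eq_of_lt (k.2.trans hs)] at h4
      exact Fin.ext h4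
    exact f.injective (by rw [hi, hk, h3])

lemma exists_orderThree_fiberwise {Ω U : Type*} [Finite Ω] (e : Ω → U)
    (he : ∀ p, 3 ≤ Nat.card {q // e q = e p}) :
    ∃ (φ : Equiv.Perm Ω) (j : Ω → Ω), φ ^ 3 = 1 ∧ (∀ p, e (φ p) = e p) ∧ (∀ p, e (j p) = e p) ∧
      (∀ p, φ p = p → φ (j p) ≠ j p) ∧ Set.InjOn j {p | φ p = p} := by
  have h : ∀ u : Set.range e, 3 ≤ Nat.card {q // e q = u.1} := by
    rintro ⟨_, p, rfl⟩
    exact he p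
  choose f g hf hg hinj using fun u : Set.range e => exists_orderThree (h u)
  let F : Ω → Ω := fun p => (f ⟨e p, p, rfl⟩ ⟨p, rfl⟩).1
  let G : Ω → Ω := fun p => (g ⟨e p, p, rfl⟩ ⟨p, rfl⟩).1
  have hF : ∀ (u : Set.range e) (x : {q // e q = u.1}), F x.1 = (f u x).1 := by
    rintro ⟨u, hu⟩ ⟨x, hx⟩
    change e x = u at hx
    subst hx
    rfl
  have hG : ∀ (u : Set.range e) (x : {q // e q = u.1}), G x.1 = (g u x).1 := by
    rintro ⟨u, hu⟩ ⟨x, hx⟩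
    change e x = u at hx
    subst hx
    rfl
  have hF3 : ∀ p, F (F (F p)) = p := by
    intro p
    have h1 := hF ⟨e p, p, rfl⟩ (f ⟨e p, p, rfl⟩ ⟨p, rfl⟩)
    have h2 := hF ⟨e p, p, rfl⟩ (f ⟨e p, p, rfl⟩ (f ⟨e p, p, rfl⟩ ⟨p, rfl⟩))
    change F (F (f ⟨e p, p, rfl⟩ ⟨p, rfl⟩).1) = p
    rw [h1, h2, hf]
  let φ : Equiv.Perm Ω := ⟨F, fun p => F (F p), hF3, hF3⟩
  refine ⟨φ, G, Equiv.ext fun p => hF3 p, fun p => (f ⟨e p, p, rfl⟩ ⟨p, rfl⟩).2,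
    fun p => (g ⟨e p, p, rfl⟩ ⟨p, rfl⟩).2, fun p hp h => ?_, fun p hp q hq hpq => ?_⟩
  · change F p = p at hp
    change F (g ⟨e p, p, rfl⟩ ⟨p, rfl⟩).1 = (g ⟨e p, p, rfl⟩ ⟨p, rfl⟩).1 at h
    rw [hF] at h
    exact hg _ _ (Subtype.ext hp) (Subtype.ext h)
  · change F p = p at hp
    change F q = q at hq
    have h1 : e p = e q := by
      have h2 : e (G p) = e p := (g ⟨e p, p, rfl⟩ ⟨p, rfl⟩).2
      rw [← h2, hpq]
      exact (g ⟨e q, q, rfl⟩ ⟨q, rfl⟩).2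
    have h2 := hG ⟨e q, q, rfl⟩ ⟨p, h1⟩
    have h3 := hF ⟨e q, q, rfl⟩ ⟨p, h1⟩
    have h4 := @hinj ⟨e q, q, rfl⟩ ⟨p, h1⟩ (Subtype.ext (h3.symm.trans hp)) ⟨q, rfl⟩
      (Subtype.ext hq) (Subtype.ext (h2.symm.trans hpq))
    exact congrArg Subtype.val h4

end OrderThree

/-! ### Products of alternating groups acting on blocks -/

section Blocks

/-- The alternating group on `c` three-cycles. -/
abbrev CycleAlt (c : ℕ) : Type := alternatingGroup (Fin c × ZMod 3)

/-- The rotation of all the three-cycles. -/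
def cycleRotation (c : ℕ) : CycleAlt c :=
  ⟨(Equiv.refl (Fin c)).prodCongr (Equiv.addRight (1 : ZMod 3)), by
    set σ : Equiv.Perm (Fin c × ZMod 3) := (Equiv.refl (Fin c)).prodCongr (Equiv.addRight 1)
    have h3 : σ ^ 3 = 1 := by
      ext ⟨x, z⟩
      · rfl
      · have hz3 : ∀ z : ZMod 3, z + 1 + 1 + 1 = z := by decide
        exact hz3 z
    rw [Equiv.Perm.mem_alternatingGroup]
    have h4 : Equiv.Perm.sign σ ^ 3 = 1 := by rw [← map_pow, h3, map_one]
    rcases Int.units_eq_one_or (Equiv.Perm.sign σ) with h | h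
    · exact h
    · rw [h] at h4
      exact absurd h4 (by decide)⟩

lemma exists_sum_of_mem_closure {r : ℕ} {c : Fin r → ℕ} {b : ℕ}
    (hb : b ∈ AddSubmonoid.closure (Set.range c)) :
    ∃ (q : ℕ) (τ : Fin q → Fin r), ∑ j, c (τ j) = b := by
  induction hb using AddSubmonoid.closure_induction with
  | mem x hx =>
    obtain ⟨i, rfl⟩ := hx
    exact ⟨1, fun _ => i, by simp⟩
  | zero => exact ⟨0, Fin.elim0, by simp⟩
  | add x y _ _ hx hy =>
    obtain ⟨q, τ, rfl⟩ := hx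
    obtain ⟨q', τ', rfl⟩ := hy
    exact ⟨q + q', Fin.append τ τ', by simp [Fin.sum_univ_add]⟩

/-- If the three-cycles of `φ` in each fibre of `e` can be divided into blocks of sizes `c i`, then
`φ` lies in a product of alternating groups acting on the blocks. -/
lemma exists_blockHom {Ω U : Type*} [Finite Ω] [Finite U] {e : Ω → U} {φ : Equiv.Perm Ω}
    (h3 : φ ^ 3 = 1) (he : ∀ p, e (φ p) = e p) (hφ : φ ≠ 1) {r : ℕ} (c : Fin r → ℕ)
    (hc : ∀ (b : ℕ) (u : U), {p | e p = u ∧ φ p ≠ p}.ncard = 3 * b →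
      b ∈ AddSubmonoid.closure (Set.range c)) :
    ∃ (s : Set (Fin r)) (Ψ : (∀ i : s, CycleAlt (c i)) →* Equiv.Perm Ω), s.Nonempty ∧
      Function.Injective Ψ ∧ (∀ a p, e (Ψ a p) = e p) ∧ ∃ a, Ψ a = φ := by
  classical
  have hcyc := fun u : U => exists_threeCycles h3 {p | e p = u ∧ φ p ≠ p}
    (fun p hp => ⟨(he p).trans hp.1, fun h => hp.2 (φ.injective h)⟩) (fun p hp => hp.2)
  choose b ρ hρinj hρrange hρ using hcyc
  have hb : ∀ u, b u ∈ AddSubmonoid.closure (Set.range c) := by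
    intro u
    refine hc _ u ?_
    rw [← hρrange, ← Set.image_univ, Set.ncard_image_of_injective _ (hρinj u), Set.ncard_univ]
    simp [mul_comm]
  choose q τ hτ using fun u => exists_sum_of_mem_closure (hb u)
  -- `J` indexes the blocks of all fibres together and `t` gives the size index of a block. One
  -- factor acts diagonally on all blocks of its index, so the number of factors is bounded by `r`.
  let J := Σ u, Fin (q u)
  let t : J → Fin r := fun j => τ j.1 j.2
  let β : J → Type := fun j => Fin (c (t j)) × ZMod 3
  let cell : ∀ j : J, Fin (c (t j)) → Fin (b j.1) := fun j x =>
    Fin.cast (hτ j.1) (finSigmaFinEquiv ⟨j.2, x⟩)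
  let ε0 : (Σ j, β j) → Ω := fun y => ρ y.1.1 (cell y.1 y.2.1, y.2.2)
  have hρe : ∀ u y, e (ρ u y) = u ∧ φ (ρ u y) ≠ ρ u y := by
    intro u y
    have : ρ u y ∈ {p | e p = u ∧ φ p ≠ p} := by rw [← hρrange]; exact ⟨y, rfl⟩
    exact this
  have hε0 : Function.Injective ε0 := by
    rintro ⟨⟨u, k⟩, x, z⟩ ⟨⟨u', k'⟩, x', z'⟩ h
    have hu : u = u' := by
      rw [← (hρe u (cell ⟨u, k⟩ x, z)).1, ← (hρe u' (cell ⟨u', k'⟩ x', z')).1]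
      exact congrArg e h
    subst hu
    have h1 := hρinj u h
    rw [Prod.mk.injEq] at h1
    obtain ⟨h1, rfl⟩ := h1
    have h2 := finSigmaFinEquiv.injective (Fin.cast_injective _ h1)
    obtain ⟨rfl, h4⟩ := Sigma.mk.inj h2
    obtain rfl := eq_of_heq h4
    rfl
  let ε : (Σ j, β j) ↪ Ω := ⟨ε0, hε0⟩
  have hεrange : ∀ p, p ∈ Set.range ε ↔ φ p ≠ p := by
    intro p
    constructor
    · rintro ⟨y, rfl⟩
      exact (hρe _ _).2
    · intro hp
      have hp' : p ∈ Set.range (ρ (e p)) := by rw [hρrange]; exact ⟨rfl, hp⟩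
      obtain ⟨⟨x, z⟩, hxz⟩ := hp'
      obtain ⟨⟨k, x'⟩, hk⟩ := finSigmaFinEquiv.surjective (Fin.cast (hτ (e p)).symm x)
      refine ⟨⟨⟨e p, k⟩, x', z⟩, ?_⟩
      change ρ (e p) (Fin.cast _ (finSigmaFinEquiv (n := fun j => c (τ (e p) j)) ⟨k, x'⟩), z) = p
      rw [hk]
      exact hxz
  -- Only the indices that occur are kept; a factor with no block would act trivially and spoil
  -- injectivity.
  let s : Set (Fin r) := Set.range t
  let Φ : (∀ i : s, CycleAlt (c i)) →* ∀ j : J, Equiv.Perm (β j) :=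
    MonoidHom.pi fun j => (Subgroup.subtype _).comp
      (Pi.evalMonoidHom (fun i : s => CycleAlt (c i)) ⟨t j, j, rfl⟩)
  let Ψ : (∀ i : s, CycleAlt (c i)) →* Equiv.Perm Ω :=
    (Equiv.Perm.viaEmbeddingHom ε).comp ((Equiv.Perm.sigmaCongrRightHom β).comp Φ)
  have hΨ : ∀ a j y, Ψ a (ε ⟨j, y⟩) = ε ⟨j, (a ⟨t j, j, rfl⟩).1 y⟩ := by
    intro a j y
    exact Equiv.Perm.viaEmbedding_apply _ ε ⟨j, y⟩
  have hΨ' : ∀ a p, p ∉ Set.range ε → Ψ a p = p := by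
    intro a p hp
    exact Equiv.Perm.viaEmbedding_apply_of_notMem _ ε p hp
  have hεe : ∀ j y, e (ε ⟨j, y⟩) = j.1 := fun j y => (hρe _ _).1
  have hne : ∃ p, φ p ≠ p := by
    by_contra! h
    exact hφ (Equiv.ext h)
  refine ⟨s, Ψ, ?_, ?_, ?_, fun i => cycleRotation (c i), ?_⟩
  · obtain ⟨p, hp⟩ := hne
    obtain ⟨⟨j, y⟩, -⟩ := (hεrange p).2 hp
    exact ⟨t j, j, rfl⟩
  · intro a a' h
    refine funext ?_
    rintro ⟨_, j, rfl⟩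
    refine Subtype.ext (Equiv.ext fun y => ?_)
    have h1 := DFunLike.congr_fun h (ε ⟨j, y⟩)
    rw [hΨ, hΨ] at h1
    exact eq_of_heq (Sigma.mk.inj (ε.injective h1)).2
  · intro a p
    by_cases hp : p ∈ Set.range ε
    · obtain ⟨⟨j, y⟩, rfl⟩ := hp
      rw [hΨ, hεe, hεe]
    · rw [hΨ' a p hp]
  · refine Equiv.ext fun p => ?_
    by_cases hp : p ∈ Set.range ε
    · obtain ⟨⟨j, x, z⟩, rfl⟩ := hp
      rw [hΨ]
      exact (hρ _ _ _).symm
    · rw [hΨ' _ p hp]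
      by_contra h
      exact hp ((hεrange p).2 (Ne.symm h))

end Blocks

/-! ### Sizes of the blocks -/

section Sizes

lemma natCard_cycleAlt {c : ℕ} (hc : 0 < c) : 2 * Nat.card (CycleAlt c) = (3 * c).factorial := by
  have : Nontrivial (Fin c × ZMod 3) := ⟨⟨(⟨0, hc⟩, 0), (⟨0, hc⟩, 1), by simp⟩⟩
  have h := two_mul_nat_card_alternatingGroup (α := Fin c × ZMod 3)
  rw [h, Nat.card_perm]
  congr 1
  simp [mul_comm]

lemma isSimpleGroup_cycleAlt {c : ℕ} (hc : 2 ≤ c) : IsSimpleGroup (CycleAlt c) := by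
  refine alternatingGroup.isSimpleGroup ?_
  simp
  omega

lemma two_pow_le_factorial (n : ℕ) : 2 ^ n ≤ (n + 1).factorial := by
  have h := Nat.factorial_mul_pow_le_factorial (m := 1) (n := n)
  rwa [Nat.factorial_one, one_mul, add_comm 1 n] at h

lemma two_pow_le_natCard_cycleAlt {c : ℕ} (hc : 0 < c) : 2 ^ c ≤ Nat.card (CycleAlt c) := by
  have h := natCard_cycleAlt hc
  have h1 := two_pow_le_factorial (3 * c - 1)
  rw [Nat.sub_add_cancel (by omega), ← h] at h1
  have h2 : 2 ^ (c + 1) ≤ 2 ^ (3 * c - 1) := Nat.pow_le_pow_right (by norm_num) (by omega)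
  rw [pow_succ] at h2
  omega

/-- The binomial coefficient is at most `2 ^ (a + b)`, while `a! / b!` is at least `(b + 1) ^ (a -
b) ≥ 8 ^ (a - b)`, which absorbs it and the factor `2`. -/
lemma two_mul_factorial_add_le {a b : ℕ} (hb : 7 ≤ b) (hab : 3 * b ≤ a) :
    2 * (a + b).factorial ≤ a.factorial ^ 2 := by
  have h1 : (a + b).factorial ≤ a.factorial * b.factorial * 2 ^ (a + b) := by
    rw [← Nat.add_choose_mul_factorial_mul_factorial a b, mul_comm (a.factorial * _), mul_assoc]
    exact Nat.mul_le_mul_right _ (Nat.choose_le_two_pow _ _)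
  have h2 : b.factorial * (b + 1) ^ (a - b) ≤ a.factorial := by
    have := Nat.factorial_mul_pow_le_factorial (m := b) (n := a - b)
    rwa [Nat.add_sub_cancel' (by omega)] at this
  have h3 : 2 * 2 ^ (a + b) ≤ (b + 1) ^ (a - b) := by
    calc 2 * 2 ^ (a + b) = 2 ^ (a + b + 1) := by ring
      _ ≤ 2 ^ (3 * (a - b)) := Nat.pow_le_pow_right (by norm_num) (by omega)
      _ = 8 ^ (a - b) := by rw [pow_mul]; norm_num
      _ ≤ _ := Nat.pow_le_pow_left (by omega) _
  calc 2 * (a + b).factorial ≤ 2 * (a.factorial * b.factorial * 2 ^ (a + b)) :=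
        Nat.mul_le_mul_left _ h1
    _ = a.factorial * (b.factorial * (2 * 2 ^ (a + b))) := by ring
    _ ≤ a.factorial * (b.factorial * (b + 1) ^ (a - b)) := by gcongr
    _ ≤ a.factorial * a.factorial := by gcongr
    _ = _ := by ring

lemma logb_natCard_cycleAlt_le {c c' k b : ℕ} (hb : 3 ≤ b) (hbk : 3 * b ≤ k) (hc : c ≤ k + b)
    (hc0 : 0 < c) (hc' : k ≤ c') :
    Real.logb 2 (Nat.card (CycleAlt c)) ≤ 2 * Real.logb 2 (Nat.card (CycleAlt c')) := by
  have h1 := natCard_cycleAlt hc0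
  have h2 := natCard_cycleAlt (c := c') (by omega)
  have h3 : (3 * c).factorial ≤ (3 * k + 3 * b).factorial := Nat.factorial_le (by omega)
  have h4 : (3 * k).factorial ≤ (3 * c').factorial := Nat.factorial_le (by omega)
  have h5 := two_mul_factorial_add_le (a := 3 * k) (b := 3 * b) (by omega) (by omega)
  have h6 : Nat.card (CycleAlt c) ≤ Nat.card (CycleAlt c') ^ 2 := by
    have h7 := Nat.pow_le_pow_left h4 2
    rw [← h2] at h7
    nlinarith
  rw [show (2 : ℝ) = ((2 : ℕ) : ℝ) by norm_num, ← Real.logb_pow]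
  refine logb_le_logb (by exact_mod_cast Nat.card_pos) (by exact_mod_cast h6)

/-- The sizes `k`, `k + β ^ i` for `i < t`, where `k = β ^ t`. -/
def blockSize (β t : ℕ) : Fin (t + 1) → ℕ :=
  Fin.cases (β ^ t) (fun i => β ^ t + β ^ (i : ℕ))

lemma pow_le_blockSize (β t : ℕ) (i : Fin (t + 1)) : β ^ t ≤ blockSize β t i := by
  induction i using Fin.cases with
  | zero => exact le_rfl
  | succ i => exact Nat.le_add_right _ _

lemma blockSize_le {β t : ℕ} (hβ : 0 < β) (i : Fin (t + 1)) :
    blockSize β t i ≤ β ^ t + β ^ (t - 1) := by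
  induction i using Fin.cases with
  | zero => exact Nat.le_add_right _ _
  | succ i => exact Nat.add_le_add_left (Nat.pow_le_pow_right hβ (by omega)) _

/-- Expand `s` in base `β`. A digit `q` in place `i` is supplied by `q` blocks of size `k + β ^ i`,
padded by `β - q` blocks of size `k`; each digit then costs exactly `β k` beyond its value. -/
lemma add_mem_closure_blockSize {β t : ℕ} (hβ : 0 < β) {t' : ℕ} (ht : t' ≤ t) :
    ∀ s < β ^ t', s + t' * β * β ^ t ∈ AddSubmonoid.closure (Set.range (blockSize β t)) := by
  induction t' with
  | zero =>
    intro s hs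
    have : s = 0 := by simpa using hs
    simp [this]
  | succ t' ih =>
    intro s hs
    have hq : s / β ^ t' < β := by
      rw [Nat.div_lt_iff_lt_mul (by positivity)]
      rwa [pow_succ, mul_comm] at hs
    have h1 := ih (by omega) (s % β ^ t') (Nat.mod_lt _ (by positivity))
    have h2 : β ^ t + β ^ t' ∈ AddSubmonoid.closure (Set.range (blockSize β t)) :=
      AddSubmonoid.subset_closure ⟨Fin.succ ⟨t', by omega⟩, rfl⟩
    have h3 : β ^ t ∈ AddSubmonoid.closure (Set.range (blockSize β t)) :=
      AddSubmonoid.subset_closure ⟨0, rfl⟩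
    have h4 := add_mem (add_mem h1 (nsmul_mem h2 (s / β ^ t'))) (nsmul_mem h3 (β - s / β ^ t'))
    convert h4 using 1
    have h5 := Nat.mod_add_div s (β ^ t')
    have h6 : s / β ^ t' + (β - s / β ^ t') = β := by omega
    simp only [smul_eq_mul]
    generalize s / β ^ t' = q at *
    generalize β - q = q' at *
    subst h6
    generalize s % (q + q') ^ t' = z at *
    rw [← h5]
    ring

lemma mem_closure_blockSize {β t b : ℕ} (hβ : 0 < β) (hb : (t * β + 1) * β ^ t ≤ b) :
    b ∈ AddSubmonoid.closure (Set.range (blockSize β t)) := by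
  have h3 : β ^ t ∈ AddSubmonoid.closure (Set.range (blockSize β t)) :=
    AddSubmonoid.subset_closure ⟨0, rfl⟩
  obtain ⟨b', rfl⟩ : ∃ b', b = t * β * β ^ t + b' := Nat.exists_eq_add_of_le
    ((Nat.mul_le_mul_right _ (Nat.le_succ _)).trans hb)
  have h1 := add_mem_closure_blockSize hβ le_rfl (b' % β ^ t)
    (Nat.mod_lt _ (by positivity)) (t := t)
  have h2 := add_mem h1 (nsmul_mem h3 (b' / β ^ t))
  convert h2 using 1
  have h5 := Nat.mod_add_div b' (β ^ t)
  rw [smul_eq_mul, mul_comm (b' / _)]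
  omega

lemma exists_blockSizes {e t : ℕ} (ht : 2 ≤ t) (he : 2 ≤ e) :
    ∃ c : Fin (t + 1) → ℕ, (∀ i, 2 ^ (e * t) ≤ c i) ∧
      (∀ b, (t * 2 ^ e + 1) * 2 ^ (e * t) ≤ b → b ∈ AddSubmonoid.closure (Set.range c)) ∧
      ∀ i j, Real.logb 2 (Nat.card (CycleAlt (c i))) ≤
        2 * Real.logb 2 (Nat.card (CycleAlt (c j))) := by
  have h4 : 4 ≤ 2 ^ e := Nat.pow_le_pow_right (n := 2) (by norm_num) he
  refine ⟨blockSize (2 ^ e) t, fun i => ?_, fun b hb => ?_, fun i j => ?_⟩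
  · rw [pow_mul]
    exact pow_le_blockSize _ _ _
  · rw [pow_mul] at hb
    exact mem_closure_blockSize (by positivity) hb
  · have h5 : (2 ^ e) ^ t = 2 ^ e * (2 ^ e) ^ (t - 1) := by
      rw [← pow_succ', Nat.sub_add_cancel (by omega)]
    refine logb_natCard_cycleAlt_le (k := (2 ^ e) ^ t) (b := (2 ^ e) ^ (t - 1)) ?_ ?_
      (blockSize_le (by positivity) i) (lt_of_lt_of_le (by positivity) (pow_le_blockSize _ _ i))
      (pow_le_blockSize _ _ j)
    · calc 3 ≤ (2 ^ e) ^ 1 := by rw [pow_one]; omega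
        _ ≤ _ := Nat.pow_le_pow_right (by positivity) (by omega)
    · rw [h5]
      exact Nat.mul_le_mul_right _ (by omega)

lemma simpleProduct_of_blocks {r : ℕ} {c : Fin r → ℕ} (hc : ∀ i, 2 ≤ c i)
    (hc' : ∀ i j, Real.logb 2 (Nat.card (CycleAlt (c i))) ≤
        2 * Real.logb 2 (Nat.card (CycleAlt (c j)))) {s : Set (Fin r)} {K : Type*} [Group K]
    (e : K ≃* ∀ i : s, CycleAlt (c i)) {M : ℝ} {N : ℕ} (hM : 2 ≤ M) (hN : r ≤ N) :
    SimpleProduct M N K := by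
  classical
  let τ : Fin (Fintype.card s) ≃ s := (Fintype.equivFin s).symm
  refine ⟨Fintype.card s, fun i => CycleAlt (c (τ i)), fun i => inferInstance, ?_,
    fun i => inferInstance, fun i => isSimpleGroup_cycleAlt (hc _), fun i j => ?_, ⟨e.trans ?_⟩⟩
  · exact ((Fintype.card_subtype_le _).trans (Fintype.card_fin r).le).trans hN
  · refine le_trans ?_ hM
    refine div_le_of_le_mul₀ (logb_natCast_nonneg _) (by norm_num) (hc' _ _)
  · exact
      { (Equiv.piCongrLeft (fun i : s => CycleAlt (c i)) τ).symm with
        map_mul' := fun _ _ => rfl }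

/-- A single factor already has order at least `2 ^ k`. -/
lemma logb_le_logb_logb_natCard {r : ℕ} {c : Fin r → ℕ} {k : ℕ} (hk : 0 < k) (hc : ∀ i, k ≤ c i)
    {s : Set (Fin r)} (hs : s.Nonempty) {K : Type*} [Group K]
    (e : K ≃* ∀ i : s, CycleAlt (c i)) :
    Real.logb 2 k ≤ Real.logb 2 (Real.logb 2 (Nat.card K : ℝ)) := by
  obtain ⟨i, hi⟩ := hs
  have h1 : 2 ^ k ≤ Nat.card K := by
    calc 2 ^ k ≤ 2 ^ c i := Nat.pow_le_pow_right (by norm_num) (hc i)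
      _ ≤ Nat.card (CycleAlt (c i)) := two_pow_le_natCard_cycleAlt (hk.trans_le (hc i))
      _ ≤ Nat.card (∀ i : s, CycleAlt (c i)) :=
        Nat.card_le_card_of_surjective (fun a => a ⟨i, hi⟩) (Function.surjective_eval _)
      _ = Nat.card K := (Nat.card_congr e.toEquiv).symm
  refine logb_le_logb (by exact_mod_cast hk) ?_
  rw [Real.le_logb_iff_rpow_le (by norm_num) (by
    have : 0 < Nat.card K := lt_of_lt_of_le (by positivity) h1
    exact_mod_cast this), Real.rpow_natCast]
  exact_mod_cast h1

end Sizes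

/-! ### Consequences of the BEEPS property -/

section BeepsCounts

universe u

variable {d : ℕ} {A : Type u} [TopologicalSpace A] {X : Subshift A (Fin d → ℤ)}
  {S : ℝ} {f : FolnerSeq (Fin d → ℤ) → ℕ → ℝ}

/-- Take `u = v` in the defining inequality. This is where the constant `2` there is used; it admits
the ratio `2` of block group orders. -/
lemma IsBEEPSFunction.eventually_two_le (hf : IsBEEPSFunction X S f) (hX : X.carrier.Nonempty)
    (F : FolnerSeq (Fin d → ℤ)) : ∀ᶠ n in atTop, 2 ≤ f F n := by
  filter_upwards [hf.2 F] with n hn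
  obtain ⟨u, hu⟩ := patterns_nonempty hX (boundary S (F n))
  obtain ⟨h1, h2⟩ := hn u hu u hu
  have h3 : (1 : ℝ) < (extensions X S (F n) u).ncard := by exact_mod_cast h1
  rw [div_self (by positivity), div_self (Real.logb_pos one_lt_two h3).ne'] at h2
  linarith

lemma IsBEEPSFunction.eventually_ncard_extensions_le (hf : IsBEEPSFunction X S f)
    (hX : X.carrier.Nonempty) (F : FolnerSeq (Fin d → ℤ)) :
    ∀ᶠ n in atTop, ∀ u ∈ patterns X (boundary S (F n)), ∀ v ∈ patterns X (boundary S (F n)),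
      ((extensions X S (F n) u).ncard : ℝ) ≤ f F n * (extensions X S (F n) v).ncard := by
  filter_upwards [hf.2 F, hf.eventually_two_le hX F] with n hn hn2 u hu v hv
  obtain ⟨h1, h2⟩ := hn u hu v hv
  have h3 : (1 : ℝ) < (extensions X S (F n) v).ncard := by exact_mod_cast h1
  -- If `|E(u)| ≥ |E(v)|`, the quotient of logarithms is at least one and can be dropped.
  rcases le_total ((extensions X S (F n) u).ncard : ℝ) (extensions X S (F n) v).ncard with h | h
  · nlinarith
  · have h4 : 1 ≤ Real.logb 2 ((extensions X S (F n) u).ncard : ℝ) /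
        Real.logb 2 ((extensions X S (F n) v).ncard : ℝ) := by
      rw [one_le_div (Real.logb_pos one_lt_two h3)]
      exact logb_le_logb (by linarith) h
    have h5 : ((extensions X S (F n) u).ncard : ℝ) / (extensions X S (F n) v).ncard ≤ f F n := by
      have : 0 ≤ ((extensions X S (F n) u).ncard : ℝ) / (extensions X S (F n) v).ncard := by
        positivity
      nlinarith
    rwa [div_le_iff₀ (by linarith)] at h5

lemma ncard_patterns_le_mul [Fintype A] (F : Finset (Fin d → ℤ)) {c : ℕ}
    (hc : ∀ u ∈ patterns X (boundary S F), (extensions X S F u).ncard ≤ c) :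
    (patterns X F).ncard ≤ c * Fintype.card A ^ (boundary S F).card := by
  classical
  have hfin : (patterns X F).Finite := Set.toFinite _
  have h1 := Finset.card_le_mul_card_image (s := hfin.toFinset)
    (f := Finset.restrict₂ (π := fun _ => A) (boundary_subset S F)) c (fun u hu => ?_)
  · rw [Set.ncard_eq_toFinset_card _ hfin]
    refine h1.trans (Nat.mul_le_mul_left _ ?_)
    calc _ ≤ Fintype.card (boundary S F → A) := Finset.card_le_univ _
      _ = _ := by rw [Fintype.card_fun, Fintype.card_coe]
  · obtain ⟨p, hp, rfl⟩ := Finset.mem_image.1 hu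
    obtain ⟨x, hx, rfl⟩ := hfin.mem_toFinset.1 hp
    refine le_trans ?_ (hc _ (restrict_mem_patterns hx _))
    rw [← Set.ncard_coe_finset]
    refine Set.ncard_le_ncard (fun q hq => ?_) (Set.toFinite _)
    obtain ⟨hq1, hq2⟩ := Finset.mem_filter.1 hq
    exact ⟨hfin.mem_toFinset.1 hq1, hq2⟩

variable (X) in
/-- The least number of extensions to a box of a pattern on its boundary. -/
noncomputable def minExtensions (S : ℝ) (n : ℕ) : ℕ :=
  sInf ((fun u => (extensions X S (box d n) u).ncard) '' patterns X (boundary S (box d n)))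

lemma minExtensions_le (S : ℝ) {n : ℕ} {u : boundary S (box d n) → A}
    (hu : u ∈ patterns X (boundary S (box d n))) :
    minExtensions X S n ≤ (extensions X S (box d n) u).ncard :=
  Nat.sInf_le ⟨u, hu, rfl⟩

lemma exists_minExtensions_eq (hX : X.carrier.Nonempty) (S : ℝ) (n : ℕ) :
    ∃ u ∈ patterns X (boundary S (box d n)),
      (extensions X S (box d n) u).ncard = minExtensions X S n :=
  Nat.sInf_mem ((patterns_nonempty hX _).image _)

/-- There are at most `|A| ^ |∂_S|` boundary patterns, each with at most `f` times the least number
of extensions; both factors are subexponential in the volume. -/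
lemma IsBEEPSFunction.eventually_le_logb_minExtensions [Fintype A] (hf : IsBEEPSFunction X S f)
    (hX : X.carrier.Nonempty) {ε : ℝ} (hε : 0 < ε) :
    ∀ᶠ n in atTop, (entropyInf X - ε) * ((box d n).card : ℝ) ≤
      Real.logb 2 (minExtensions X S n : ℝ) := by
  have hlim : Tendsto (fun n => ((boundary S (boxSeq d n)).card : ℝ) / ((boxSeq d n).card : ℝ) *
      Real.logb 2 (Fintype.card A : ℝ) + Real.logb 2 (f (boxSeq d) n) / ((boxSeq d n).card : ℝ))
      atTop (𝓝 0) := by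
    simpa using (((boxSeq d).tendsto_boundary S).mul_const
      (Real.logb 2 (Fintype.card A : ℝ))).add (hf.1 (boxSeq d))
  filter_upwards [hlim.eventually (gt_mem_nhds hε), hf.2 (boxSeq d),
    hf.eventually_two_le hX (boxSeq d), hf.eventually_ncard_extensions_le hX (boxSeq d)] with
    n hn1 hn2 hn3 hn4
  simp only [boxSeq_apply] at hn1 hn2 hn4
  obtain ⟨v, hv, hvm⟩ := exists_minExtensions_eq hX S n
  rw [← hvm]
  set E := extensions X S (box d n) v
  have hV : (0 : ℝ) < (box d n).card := by exact_mod_cast (box_nonempty n).card_pos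
  have hE : (1 : ℝ) < E.ncard := by exact_mod_cast (hn2 v hv v hv).1
  have hA : 0 < Fintype.card A := by
    obtain ⟨x, -⟩ := hX
    exact Fintype.card_pos_iff.2 ⟨x 0⟩
  have hA0 : (0 : ℝ) < Fintype.card A := by exact_mod_cast hA
  have h1 : ((patterns X (box d n)).ncard : ℝ) ≤
      f (boxSeq d) n * E.ncard * (Fintype.card A : ℝ) ^ (boundary S (box d n)).card := by
    have h2 := ncard_patterns_le_mul (X := X) (S := S) (box d n)
      (c := ⌊f (boxSeq d) n * E.ncard⌋₊) (fun u hu => Nat.le_floor (hn4 u hu v hv))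
    have h3 : ((⌊f (boxSeq d) n * E.ncard⌋₊ : ℕ) : ℝ) ≤ f (boxSeq d) n * E.ncard :=
      Nat.floor_le (by positivity)
    calc ((patterns X (box d n)).ncard : ℝ)
        ≤ (⌊f (boxSeq d) n * E.ncard⌋₊ : ℝ) * (Fintype.card A : ℝ) ^ (boundary S (box d n)).card :=
          by exact_mod_cast h2
      _ ≤ _ := by gcongr
  have h2 := logb_le_logb (by exact_mod_cast ncard_patterns_pos hX (box d n)) h1
  rw [Real.logb_mul (by positivity) (by positivity), Real.logb_mul (by positivity) (by positivity),
    Real.logb_pow] at h2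
  have h3 := entropyInf_le (X := X) n
  rw [boxEntropy, le_div_iff₀ hV] at h3
  have h4 : ((boundary S (box d n)).card : ℝ) * Real.logb 2 (Fintype.card A : ℝ) +
      Real.logb 2 (f (boxSeq d) n) ≤ ε * (box d n).card := by
    rw [← div_le_iff₀ hV, add_div]
    refine le_trans (le_of_eq ?_) hn1.le
    ring
  linarith

end BeepsCounts

/-! ### A permutation of order three of the patterns of a cell -/

noncomputable section CellPermutation

universe u

variable {d : ℕ} {A : Type u} [TopologicalSpace A] {X : Subshift A (Fin d → ℤ)}

/-- The pattern on the boundary of a pattern on a box. -/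
def boundaryPat (S : ℝ) {n : ℕ} (p : patterns X (box d n)) : boundary S (box d n) → A :=
  Finset.restrict₂ (π := fun _ => A) (boundary_subset S (box d n)) p.1

lemma boundaryPat_mem (S : ℝ) {n : ℕ} (p : patterns X (box d n)) :
    boundaryPat S p ∈ patterns X (boundary S (box d n)) := by
  obtain ⟨x, hx, hp⟩ := p.2
  exact ⟨x, hx, by rw [boundaryPat, ← hp]; rfl⟩

lemma preservesBoundary_iff {S : ℝ} {n : ℕ} {J : patterns X (box d n) → patterns X (box d n)} :
    PreservesBoundary S (fun _ => J) ↔ ∀ p, boundaryPat S (J p) = boundaryPat S p :=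
  ⟨fun h p => funext fun a => h 0 p a.1 a.2, fun h _ p a ha => congrFun (h p) ⟨a, ha⟩⟩

lemma ncard_fiber (S : ℝ) {n : ℕ} (u : boundary S (box d n) → A) :
    {p : patterns X (box d n) | boundaryPat S p = u}.ncard =
      (extensions X S (box d n) u).ncard := by
  rw [← Set.ncard_image_of_injective _ Subtype.val_injective]
  congr 1
  ext p
  constructor
  · rintro ⟨q, hq, rfl⟩
    exact ⟨q.2, hq⟩
  · rintro ⟨hp, hpu⟩
    exact ⟨⟨p, hp⟩, hpu, rfl⟩

variable {ω : ℕ} (hX : IsLocal X ω) {S : ℝ} (hS : 2 * ω ≤ S)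

/-- Two extensions per cell give three in a box three cells wide: leave the pattern alone, change
the central cell, or change a neighbouring one. -/
lemma exists_three_le_natCard_fiber [Finite A] {ω : ℕ} (hX : IsLocal X ω) {S : ℝ}
    (hS : 2 * ω ≤ S) (hd : 0 < d) {k : ℕ}
    (hk : ∀ v ∈ patterns X (boundary S (box d k)), 1 < (extensions X S (box d k) v).ncard) :
    ∃ n, ∀ p : patterns X (box d n),
      3 ≤ Nat.card {q : patterns X (box d n) // boundaryPat S q = boundaryPat S p} := by
  classical
  have hJ : ∀ p : patterns X (box d k), ∃ q, boundaryPat S q = boundaryPat S p ∧ q ≠ p := by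
    intro p
    have h1 := hk _ (boundaryPat_mem S p)
    rw [← ncard_fiber] at h1
    obtain ⟨q, hq, hne⟩ := Set.exists_ne_of_one_lt_ncard h1 p
    exact ⟨q, hq, hne⟩
  choose J hJ1 hJ2 using hJ
  have hdvd : 2 * k + 1 ∣ 2 * (3 * k + 1) + 1 := ⟨3, by ring⟩
  refine ⟨3 * k + 1, fun p => ?_⟩
  obtain ⟨x, rfl⟩ := exists_cellPat_zero_eq p
  let P : (Fin d → ℤ) → (Fin d → ℤ) → patterns X (box d k) → patterns X (box d k) :=
    fun b g => if g = b then J else id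
  have hP : ∀ b, PreservesBoundary S (P b) := by
    intro b g q a ha
    by_cases hg : g = b
    · simp only [P, hg, if_true]
      exact preservesBoundary_iff.2 hJ1 0 q a ha
    · simp only [P, hg, if_false, id]
  let y : (Fin d → ℤ) → X.carrier := fun b => tileMap hX hS (P b) (hP b) x
  have hy1 : ∀ b, b ∈ lattice d (2 * k + 1) → cellPat k (y b) b ≠ cellPat k x b := by
    intro b hb
    rw [cellPat_tileMap hX hS (hP b) x hb]
    simp only [P, if_true]
    exact hJ2 _
  have hy2 : ∀ b g, g ∈ lattice d (2 * k + 1) → g ≠ b → cellPat k (y b) g = cellPat k x g := by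
    intro b g hg hgb
    rw [cellPat_tileMap hX hS (hP b) x hg]
    simp only [P, if_neg hgb, id]
  let b₁ : Fin d → ℤ := Pi.single ⟨0, hd⟩ (2 * k + 1 : ℤ)
  have hb₁ : b₁ ∈ lattice d (2 * k + 1) := by
    refine mem_lattice.2 fun i => ?_
    by_cases hi : i = ⟨0, hd⟩
    · subst hi
      simp [b₁]
    · simp [b₁, Pi.single_eq_of_ne hi]
  have hb₁0 : b₁ ≠ 0 := by
    intro h
    have := congrFun h ⟨0, hd⟩
    simp only [b₁, Pi.single_eq_same, Pi.zero_apply] at this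
    omega
  have hsub : ∀ b, (b = 0 ∨ b = b₁) → ∀ z z' : X.carrier,
      cellPat (3 * k + 1) z 0 = cellPat (3 * k + 1) z' 0 → cellPat k z b = cellPat k z' b := by
    intro b hb z z' h
    refine Subtype.ext (funext fun a => ?_)
    have hmem : b + a.1 ∈ box d (3 * k + 1) := by
      refine mem_box_iff.2 fun i => ?_
      have h1 := mem_box_iff.1 a.2 i
      have h2 : b i = 0 ∨ b i = 2 * k + 1 := by
        rcases hb with rfl | rfl
        · exact Or.inl rfl
        · by_cases hi : i = ⟨0, hd⟩
          · subst hi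
            right
            simp [b₁]
          · left
            simp [b₁, Pi.single_eq_of_ne hi]
      rw [Pi.add_apply]
      push_cast
      rcases h2 with h2 | h2 <;> rw [h2] <;> constructor <;> linarith
    have h1 := congrFun (congrArg Subtype.val h) ⟨_, hmem⟩
    rw [cellPat_apply, cellPat_apply, zero_add] at h1
    rw [cellPat_apply, cellPat_apply, h1]
  have hfib : ∀ b, boundaryPat S (cellPat (3 * k + 1) (y b) 0) =
      boundaryPat S (cellPat (3 * k + 1) x 0) := by
    intro b
    refine funext fun a => ?_
    change (y b).1 (0 + a.1) = x.1 (0 + a.1)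
    rw [zero_add]
    exact tileMap_apply_of_mem_boundary hX hS hdvd (hP b) x a.2
  change 3 ≤ Set.ncard {q : patterns X (box d (3 * k + 1)) |
    boundaryPat S q = boundaryPat S (cellPat (3 * k + 1) x 0)}
  refine (Set.two_lt_ncard (Set.toFinite _)).2 ⟨_, rfl, _, hfib 0, _, hfib b₁, fun h => ?_,
    fun h => ?_, fun h => ?_⟩
  · exact hy1 0 (zero_mem _) (hsub 0 (Or.inl rfl) _ _ h).symm
  · exact hy1 b₁ hb₁ (hsub b₁ (Or.inr rfl) _ _ h).symm
  · have h1 := hsub 0 (Or.inl rfl) _ _ h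
    rw [hy2 b₁ 0 (zero_mem _) hb₁0.symm] at h1
    exact hy1 0 (zero_mem _) h1

/-- An order three permutation of the patterns on a box, preserving the patterns on the boundary,
with an injection `j` of the fixed patterns into the moved ones witnessing that at least half of
the patterns with given boundary are moved. -/
structure IsMixing (S : ℝ) {n : ℕ} (π : boundaryPerm X S n)
    (j : patterns X (box d n) → patterns X (box d n)) : Prop where
  pow_three : π ^ 3 = 1
  preserves : PreservesBoundary S (fun _ => j)
  moved : ∀ p, π.1 p = p → π.1 (j p) ≠ j p
  injOn : Set.InjOn j {p | π.1 p = p}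

lemma exists_isMixing [Finite A] {ω : ℕ} (hX : IsLocal X ω) {S : ℝ} (hS : 2 * ω ≤ S) (hd : 0 < d) {k : ℕ}
    (hk : ∀ v ∈ patterns X (boundary S (box d k)), 1 < (extensions X S (box d k) v).ncard) :
    ∃ (n : ℕ) (π : boundaryPerm X S n) (j : _), IsMixing S π j := by
  obtain ⟨n, hn⟩ := exists_three_le_natCard_fiber hX hS hd hk
  obtain ⟨φ, j, h1, h2, h3, h4, h5⟩ := exists_orderThree_fiberwise (boundaryPat S) hn
  exact ⟨n, ⟨φ, preservesBoundary_iff.2 h2⟩, j, Subtype.ext h1, preservesBoundary_iff.2 h3, h4, h5⟩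

lemma IsMixing.ne_one {n : ℕ} {π : boundaryPerm X S n} {j : _} (h : IsMixing S π j)
    (hne : X.carrier.Nonempty) : π ≠ 1 := by
  rintro rfl
  obtain ⟨x, hx⟩ := hne
  exact h.moved (cellPat n ⟨x, hx⟩ 0) rfl rfl

lemma IsMixing.refine [Finite A] [DiscreteTopology A] {n m : ℕ} (hnm : 2 * n + 1 ∣ 2 * m + 1)
    {π : boundaryPerm X S n} {j : _} (h : IsMixing S π j) :
    ∃ J, IsMixing S (refinePerm hX hS hnm π) J := by
  obtain ⟨J, h1, h2, h3⟩ := exists_injOn_fixed hX hS hnm π h.preserves h.moved h.injOn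
  exact ⟨J, refinePerm_pow_three hX hS hnm h.pow_three, h1, h2, h3⟩

lemma IsMixing.ncard_extensions_le [Finite A] {n : ℕ} {π : boundaryPerm X S n} {j : _} (h : IsMixing S π j)
    (u : boundary S (box d n) → A) : (extensions X S (box d n) u).ncard ≤
      2 * {p : patterns X (box d n) | boundaryPat S p = u ∧ π.1 p ≠ p}.ncard := by
  rw [← ncard_fiber]
  have h1 : {p : patterns X (box d n) | boundaryPat S p = u} =
      {p | boundaryPat S p = u ∧ π.1 p = p} ∪ {p | boundaryPat S p = u ∧ π.1 p ≠ p} := by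
    ext p
    by_cases hp : π.1 p = p <;> simp [hp]
  have h2 : {p : patterns X (box d n) | boundaryPat S p = u ∧ π.1 p = p}.ncard ≤
      {p : patterns X (box d n) | boundaryPat S p = u ∧ π.1 p ≠ p}.ncard :=
    Set.ncard_le_ncard_of_injOn j
      (fun p hp => ⟨(preservesBoundary_iff.1 h.preserves p).trans hp.1, h.moved p hp.2⟩)
      (fun p hp q hq hpq => h.injOn hp.2 hq.2 hpq) (Set.toFinite _)
  rw [h1]
  refine (Set.ncard_union_le _ _).trans ?_
  omega

end CellPermutation

/-! ### Positive entropy and block subgroups -/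

noncomputable section BlockSubgroups

universe u

variable {d : ℕ} {A : Type u} [TopologicalSpace A] {X : Subshift A (Fin d → ℤ)}

/-- Using `j` where necessary, some point shows a moved pattern in every cell. Applying `π` on an
arbitrary set of cells then gives distinct patterns. -/
lemma IsMixing.two_pow_le_ncard_patterns [Finite A] {ω : ℕ} (hX : IsLocal X ω) {S : ℝ}
    (hS : 2 * ω ≤ S) (hne : X.carrier.Nonempty) {n m : ℕ} (hnm : 2 * n + 1 ∣ 2 * m + 1)
    {π : boundaryPerm X S n} {j : _} (h : IsMixing S π j) :
    2 ^ ((box d m).image (cellBase n)).card ≤ (patterns X (box d m)).ncard := by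
  classical
  obtain ⟨x₀, hx₀⟩ := hne
  have hj0 : PreservesBoundary S (n := n) (X := X)
      (fun _ p => if π.1 p = p then j p else p) := by
    intro g p a ha
    by_cases hp : π.1 p = p
    · simp only [hp, if_true]
      exact h.preserves g p a ha
    · simp only [hp, if_false]
  obtain ⟨x, hx⟩ : ∃ x : X.carrier, ∀ g ∈ lattice d (2 * n + 1),
      π.1 (cellPat n x g) ≠ cellPat n x g := by
    refine ⟨tileMap hX hS _ hj0 ⟨x₀, hx₀⟩, fun g hg => ?_⟩
    rw [cellPat_tileMap hX hS hj0 _ hg]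
    by_cases hp : π.1 (cellPat n ⟨x₀, hx₀⟩ g) = cellPat n ⟨x₀, hx₀⟩ g
    · rw [if_pos hp]
      exact h.moved _ hp
    · rwa [if_neg hp]
  let P : Finset (Fin d → ℤ) → (Fin d → ℤ) → patterns X (box d n) → patterns X (box d n) :=
    fun T g => if g ∈ T then π.1 else id
  have hP : ∀ T, PreservesBoundary S (P T) := by
    intro T g p a ha
    by_cases hg : g ∈ T
    · simp only [P, hg, if_true]
      exact π.2 g p a ha
    · simp only [P, hg, if_false, id]
  let B := (box d m).image (cellBase n)
  let q : Finset (Fin d → ℤ) → patterns X (box d m) := fun T =>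
    cellPat m (tileMap hX hS (P T) (hP T) x) 0
  have hq : ∀ T T', q T = q T' → ∀ g ∈ B, g ∈ T → g ∈ T' := by
    intro T T' hTT g hg hgT
    by_contra hgT'
    obtain ⟨a, ha, rfl⟩ := Finset.mem_image.1 hg
    refine hx _ (cellBase_mem n a) ?_
    have h1 : cellPat n (tileMap hX hS (P T) (hP T) x) (cellBase n a) =
        cellPat n (tileMap hX hS (P T') (hP T') x) (cellBase n a) := by
      refine Subtype.ext (funext fun b => ?_)
      have h2 := congrFun (congrArg Subtype.val hTT) ⟨_, cellBase_add_mem_box hnm ha b.2⟩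
      simp only [q, cellPat_apply, zero_add] at h2
      rw [cellPat_apply, cellPat_apply, h2]
    rw [cellPat_tileMap _ _ _ _ (cellBase_mem n a), cellPat_tileMap _ _ _ _ (cellBase_mem n a)] at h1
    rw [show P T (cellBase n a) = π.1 from if_pos hgT,
      show P T' (cellBase n a) = id from if_neg hgT'] at h1
    exact h1
  rw [← Finset.card_powerset, ← Set.ncard_coe_finset]
  refine Set.ncard_le_ncard_of_injOn (fun T => (q T).1) (fun T _ => (q T).2) ?_ (Set.toFinite _)
  intro T hT T' hT' hTT
  have hTT := Subtype.ext hTT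
  have hT := Finset.mem_powerset.1 (Finset.mem_coe.1 hT)
  have hT' := Finset.mem_powerset.1 (Finset.mem_coe.1 hT')
  exact Finset.ext fun g => ⟨fun hg => hq T T' hTT g (hT hg) hg,
    fun hg => hq T' T hTT.symm g (hT' hg) hg⟩

lemma card_box_le_card_image_cellBase_mul (n : ℕ) (F : Finset (Fin d → ℤ)) :
    F.card ≤ (F.image (cellBase n)).card * (box d n).card := by
  rw [← Finset.card_product]
  refine Finset.card_le_card_of_injOn (fun a => (cellBase n a, cellRep n a)) (fun a ha => ?_)
    (fun a _ b _ hab => ?_)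
  · exact Finset.mem_coe.2 (Finset.mem_product.2
      ⟨Finset.mem_image_of_mem _ (Finset.mem_coe.1 ha), cellRep_mem n a⟩)
  · obtain ⟨h1, h2⟩ := Prod.mk.inj hab
    rw [← cellBase_add_cellRep n a, h1, h2, cellBase_add_cellRep]

lemma IsMixing.entropyInf_pos [Fintype A] {ω : ℕ} (hX : IsLocal X ω) {S : ℝ}
    (hS : 2 * ω ≤ S) (hne : X.carrier.Nonempty) {n : ℕ}
    {π : boundaryPerm X S n} {j : _} (h : IsMixing S π j) : 0 < entropyInf X := by
  have hn : (0 : ℝ) < (box d n).card := by exact_mod_cast (box_nonempty n).card_pos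
  refine lt_of_lt_of_le (inv_pos.2 hn) ?_
  have hm : Tendsto (fun t : ℕ => n + (2 * n + 1) * t) atTop atTop :=
    tendsto_atTop_mono (fun t => (Nat.le_mul_of_pos_left t (Nat.succ_pos _)).trans
      (Nat.le_add_left _ _)) tendsto_id
  refine ge_of_tendsto' ((tendsto_boxEntropy hne).comp hm) fun t => ?_
  set m := n + (2 * n + 1) * t
  have hnm : 2 * n + 1 ∣ 2 * m + 1 := ⟨2 * t + 1, by ring⟩
  have hV : (0 : ℝ) < (box d m).card := by exact_mod_cast (box_nonempty m).card_pos
  have h1 := h.two_pow_le_ncard_patterns hX hS hne hnm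
  have h2 : ((box d m).card : ℝ) ≤ ((box d m).image (cellBase n)).card * (box d n).card := by
    exact_mod_cast card_box_le_card_image_cellBase_mul n (box d m)
  have h3 : (((box d m).image (cellBase n)).card : ℝ) ≤
      Real.logb 2 ((patterns X (box d m)).ncard : ℝ) := by
    rw [Real.le_logb_iff_rpow_le one_lt_two (by exact_mod_cast ncard_patterns_pos hne _),
      Real.rpow_natCast]
    exact_mod_cast h1
  change _ ≤ boxEntropy X m
  rw [boxEntropy, le_div_iff₀ hV, inv_mul_le_iff₀ hn, mul_comm]
  exact h2.trans (mul_le_mul_of_nonneg_right h3 hn.le)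

lemma finiteIndex_lattice (hd : 0 < d) (n : ℕ) : (lattice d (2 * n + 1)).FiniteIndex := by
  have := (isTower_lattice (⟨0, hd⟩ : Fin d) n).finiteIndex 0
  simpa [tileSide] using this

/-- The action of boundary preserving permutations of patterns, in the stabilized automorphism
group. -/
def tileStab [Finite A] [DiscreteTopology A] (hd : 0 < d) {ω : ℕ} (hX : IsLocal X ω) {S : ℝ}
    (hS : 2 * ω ≤ S) (n : ℕ) : boundaryPerm X S n →* stabAut X :=
  (tileHom hX hS).codRestrict (stabAut X)
    (fun π => ⟨_, finiteIndex_lattice hd n, tileHom_mem_aut hX hS π⟩)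

variable [Finite A] [DiscreteTopology A] (hd : 0 < d) {ω : ℕ} (hX : IsLocal X ω) {S : ℝ}
    (hS : 2 * ω ≤ S) {n : ℕ}

lemma tileStab_injective : Function.Injective (tileStab hd hX hS n) := fun _ _ h =>
  tileHom_injective hX hS (congrArg Subtype.val h)

lemma tileStab_refinePerm {m : ℕ} (hnm : 2 * n + 1 ∣ 2 * m + 1) (π : boundaryPerm X S n) :
    tileStab hd hX hS m (refinePerm hX hS hnm π) = tileStab hd hX hS n π :=
  Subtype.ext (tileHom_refinePerm hX hS hnm π)

lemma tileStab_mem_shiftCentralizer (π : boundaryPerm X S n) :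
    tileStab hd hX hS n π ∈ shiftCentralizer X (lattice d (2 * n + 1)) :=
  mem_shiftCentralizer_iff.2 fun _ hh x =>
    tileMap_shiftHomeo hX hS (boundaryPerm_preserves π) hh x

/-- The three-cycles of the permutation, divided into blocks, give a product of alternating
groups. -/
lemma IsMixing.exists_subgroup (hne : X.carrier.Nonempty) {π : boundaryPerm X S n} {j : _}
    (h : IsMixing S π j) {r : ℕ} (c : Fin r → ℕ)
    (hc : ∀ (b : ℕ) (u : boundary S (box d n) → A),
      {p : patterns X (box d n) | boundaryPat S p = u ∧ π.1 p ≠ p}.ncard = 3 * b →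
        b ∈ AddSubmonoid.closure (Set.range c)) :
    ∃ K : Subgroup (stabAut X), K ≤ shiftCentralizer X (lattice d (2 * n + 1)) ∧
      tileStab hd hX hS n π ∈ K ∧
      ∃ s : Set (Fin r), s.Nonempty ∧ Nonempty (K ≃* ∀ i : s, CycleAlt (c i)) := by
  obtain ⟨s, Ψ, hs, hinj, hfib, a, ha⟩ := exists_blockHom (e := boundaryPat S) (φ := π.1)
    (congrArg Subtype.val h.pow_three) (preservesBoundary_iff.1 π.2)
    (fun h1 => h.ne_one hne (Subtype.ext h1)) c hc
  let Ψ' : (∀ i : s, CycleAlt (c i)) →* boundaryPerm X S n :=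
    Ψ.codRestrict _ fun a => preservesBoundary_iff.2 (hfib a)
  have hΨ' : Function.Injective ((tileStab hd hX hS n).comp Ψ') :=
    (tileStab_injective hd hX hS).comp fun a b hab => hinj (congrArg Subtype.val hab)
  refine ⟨((tileStab hd hX hS n).comp Ψ').range, ?_, ⟨a, ?_⟩, s, hs,
    ⟨(MonoidHom.ofInjective hΨ').symm⟩⟩
  · rintro _ ⟨b, rfl⟩
    exact tileStab_mem_shiftCentralizer hd hX hS _
  · exact congrArg (tileStab hd hX hS n) (Subtype.ext ha : Ψ' a = π)

end BlockSubgroups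

/-! ### Choice of the block sizes -/

section BlockSizes

/-- With `β = 2 ^ e` and `e = l / (m + 2)`, two spare powers of `β` cover the threshold of
representability, because `m + 1 ≤ 2 ^ e`. Up to rounding, the exponent falls from `l` only by the
factor `m / (m + 2)`. -/
lemma exists_blockSizes_of_le {m l : ℕ} (hm : 2 ≤ m) (hl : (m + 2) ^ 2 ≤ l) :
    ∃ c : Fin (m + 1) → ℕ, (∀ i, 2 ^ (l / (m + 2) * m) ≤ c i) ∧
      (∀ b, 2 ^ l ≤ b → b ∈ AddSubmonoid.closure (Set.range c)) ∧
      ∀ i j, Real.logb 2 (Nat.card (CycleAlt (c i))) ≤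
        2 * Real.logb 2 (Nat.card (CycleAlt (c j))) := by
  set e := l / (m + 2)
  have he : m + 2 ≤ e := (Nat.le_div_iff_mul_le (by omega)).2 (by rwa [← sq])
  obtain ⟨c, h1, h2, h3⟩ := exists_blockSizes hm (show 2 ≤ e by omega)
  refine ⟨c, h1, fun b hb => h2 b (le_trans ?_ hb), h3⟩
  have h4 : m + 1 ≤ 2 ^ e :=
    Nat.lt_two_pow_self.le.trans (Nat.pow_le_pow_right (by norm_num) (by omega))
  calc (m * 2 ^ e + 1) * 2 ^ (e * m) ≤ ((m + 1) * 2 ^ e) * 2 ^ (e * m) := by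
        refine Nat.mul_le_mul_right _ ?_
        have : 0 < 2 ^ e := by positivity
        linarith
    _ ≤ (2 ^ e * 2 ^ e) * 2 ^ (e * m) := by gcongr
    _ = 2 ^ (e * (m + 2)) := by ring
    _ ≤ 2 ^ l := Nat.pow_le_pow_right (by norm_num) (Nat.div_mul_le_self _ _)

end BlockSizes

/-! ### Local sequences with entropy at least the topological entropy -/

noncomputable section LowerBound

universe u

lemma boundary_eq_empty {d : ℕ} {S : ℝ} (hS : S < 1) (F : Finset (Fin d → ℤ)) :
    boundary S F = ∅ := by
  refine Finset.eq_empty_of_forall_notMem fun x hx => ?_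
  obtain ⟨h1, y, hy, hxy⟩ := mem_boundary.1 hx
  have h2 := norm_le_floor hxy
  rw [Nat.floor_eq_zero.2 hS, Nat.cast_zero, norm_le_zero_iff, sub_eq_zero] at h2
  exact hy (h2 ▸ h1)

variable {d : ℕ} {A : Type u} [TopologicalSpace A] {X : Subshift A (Fin d → ℤ)}

lemma IsMixing.exists_subgroup_of_le [Finite A] [DiscreteTopology A] (hd : 0 < d) {ω : ℕ}
    (hX : IsLocal X ω) {S : ℝ} (hS : 2 * ω ≤ S) (hne : X.carrier.Nonempty) {n : ℕ} {π : boundaryPerm X S n}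
    {j : _} (h : IsMixing S π j) {m l N : ℕ} (hm : 2 ≤ m) (hl : (m + 2) ^ 2 ≤ l)
    (hmin : 8 * 2 ^ l ≤ minExtensions X S n) (hN : m + 1 ≤ N ∨ S < 1 ∧ 1 ≤ N) :
    ∃ K : Subgroup (stabAut X), K ≤ shiftCentralizer X (lattice d (2 * n + 1)) ∧
      tileStab hd hX hS n π ∈ K ∧ (∀ M, 2 ≤ M → SimpleProduct M N K) ∧
      ((l / (m + 2) * m : ℕ) : ℝ) ≤ Real.logb 2 (Real.logb 2 (Nat.card K : ℝ)) := by
  set k := l / (m + 2) * m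
  have hk1 : 1 ≤ k := by
    have : 1 ≤ l / (m + 2) := (Nat.le_div_iff_mul_le (by omega)).2 (by nlinarith)
    exact Nat.mul_pos this (by omega)
  have hkl : k ≤ l :=
    (Nat.mul_le_mul_left _ (by omega)).trans (Nat.div_mul_le_self l (m + 2))
  have hk2 : 2 ≤ 2 ^ k := by
    simpa using Nat.pow_le_pow_right (n := 2) (by norm_num) hk1
  -- At least half of the `8 * 2 ^ l` extensions are moved, so each occurring fibre has at least
  -- `4/3 * 2 ^ l` three-cycles.
  have hlarge : ∀ p : patterns X (box d n), 4 * 2 ^ l ≤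
      {q : patterns X (box d n) | boundaryPat S q = boundaryPat S p ∧ π.1 q ≠ q}.ncard := by
    intro p
    have h1 := minExtensions_le S (boundaryPat_mem S p)
    have h2 := h.ncard_extensions_le (boundaryPat S p)
    omega
  obtain ⟨r, c, hr, hc1, hc2, hc3⟩ : ∃ (r : ℕ) (c : Fin r → ℕ), r ≤ N ∧ (∀ i, 2 ^ k ≤ c i) ∧
      (∀ (b : ℕ) (u : boundary S (box d n) → A),
        {p : patterns X (box d n) | boundaryPat S p = u ∧ π.1 p ≠ p}.ncard = 3 * b →
          b ∈ AddSubmonoid.closure (Set.range c)) ∧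
      ∀ i j, Real.logb 2 (Nat.card (CycleAlt (c i))) ≤
        2 * Real.logb 2 (Nat.card (CycleAlt (c j))) := by
    rcases hN with hN | ⟨hS1, hN⟩
    · obtain ⟨c, hc1, hc2, hc3⟩ := exists_blockSizes_of_le hm hl
      refine ⟨m + 1, c, hN, hc1, fun b u hb => ?_, hc3⟩
      rcases Set.eq_empty_or_nonempty
        {p : patterns X (box d n) | boundaryPat S p = u ∧ π.1 p ≠ p} with he | ⟨p, rfl, -⟩
      · rw [he, Set.ncard_empty] at hb
        obtain rfl : b = 0 := by omega
        exact zero_mem _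
      · refine hc2 b ?_
        have := hlarge p
        omega
    -- With empty boundary there is one fibre, and all its three-cycles form a single block.
    · have hemp : IsEmpty (boundary S (box d n)) := by
        rw [boundary_eq_empty hS1]
        infer_instance
      obtain ⟨x, hx⟩ := hne
      have h1 := hlarge (cellPat n ⟨x, hx⟩ 0)
      set u₀ := boundaryPat S (cellPat n ⟨x, hx⟩ 0)
      refine ⟨1, fun _ => {q : patterns X (box d n) |
        boundaryPat S q = u₀ ∧ π.1 q ≠ q}.ncard / 3, hN, fun _ => ?_, fun b u hb => ?_,
        fun _ _ => ?_⟩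
      · have h2 : 2 ^ k ≤ 2 ^ l := Nat.pow_le_pow_right (by norm_num) hkl
        refine (Nat.le_div_iff_mul_le (by norm_num)).2 ?_
        omega
      · refine AddSubmonoid.subset_closure ⟨0, ?_⟩
        rw [Subsingleton.elim u u₀] at hb
        simp only [hb]
        omega
      · exact le_mul_of_one_le_left (logb_natCast_nonneg _) one_le_two
  obtain ⟨K, hK1, hK2, s, hs, ⟨e⟩⟩ := h.exists_subgroup hd hX hS hne c hc2
  refine ⟨K, hK1, hK2, fun M hM => simpleProduct_of_blocks (fun i => hk2.trans (hc1 i)) hc3 e hM hr,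
    ?_⟩
  have h1 := logb_le_logb_logb_natCard (by positivity) hc1 hs e
  rw [Nat.cast_pow, Nat.cast_ofNat, Real.logb_pow, Real.logb_self_eq_one one_lt_two, mul_one] at h1
  exact h1

/-- The radius of the box of side length `tileSide n₀ m`. -/
def tileRadius (n₀ m : ℕ) : ℕ := tileSide n₀ m / 2

lemma two_mul_tileRadius_add_one (n₀ m : ℕ) : 2 * tileRadius n₀ m + 1 = tileSide n₀ m := by
  have h : Odd (tileSide n₀ m) := (Odd.pow (by decide)).mul ⟨n₀, rfl⟩
  rw [tileRadius]
  exact Nat.two_mul_div_two_add_one_of_odd h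

lemma tendsto_tileRadius (n₀ : ℕ) : Tendsto (tileRadius n₀) atTop atTop := by
  refine tendsto_atTop.2 fun b => ?_
  filter_upwards [eventually_ge_atTop (2 * b)] with m hm
  have h1 := lt_tileSide n₀ m
  have h2 := two_mul_tileRadius_add_one n₀ m
  omega

/-- The logarithm of the number of extensions of patterns on the boundary, up to a constant. -/
def extensionLog (X : Subshift A (Fin d → ℤ)) (S : ℝ) (n : ℕ) : ℕ :=
  Nat.log 2 (minExtensions X S n) - 3

/-- The `4` is the `3` subtracted for the factor `8`, plus one for rounding the logarithm down. -/
lemma logb_minExtensions_le (X : Subshift A (Fin d → ℤ)) (S : ℝ) (n : ℕ) :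
    Real.logb 2 (minExtensions X S n : ℝ) ≤ extensionLog X S n + 4 := by
  have h1 : Nat.log 2 (minExtensions X S n) + 1 ≤ extensionLog X S n + 4 := by
    rw [extensionLog]
    omega
  rcases Nat.eq_zero_or_pos (minExtensions X S n) with h0 | h0
  · rw [h0, Nat.cast_zero, Real.logb_zero]
    positivity
  rw [Real.logb_le_iff_le_rpow one_lt_two (by exact_mod_cast h0)]
  have h2 : minExtensions X S n ≤ 2 ^ (extensionLog X S n + 4) :=
    (Nat.lt_pow_succ_log_self (by norm_num) _).le.trans (Nat.pow_le_pow_right (by norm_num) h1)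
  have h3 : ((extensionLog X S n : ℝ) + 4) = ((extensionLog X S n + 4 : ℕ) : ℝ) := by push_cast; ring
  rw [h3, Real.rpow_natCast]
  exact_mod_cast h2

lemma eight_mul_two_pow_le {S : ℝ} {n : ℕ} (h : 0 < extensionLog X S n) :
    8 * 2 ^ extensionLog X S n ≤ minExtensions X S n := by
  have h1 : 0 < Nat.log 2 (minExtensions X S n) := by
    rw [extensionLog] at h
    omega
  have h2 : minExtensions X S n ≠ 0 := by
    intro h0
    rw [h0, Nat.log_zero_right] at h1
    exact lt_irrefl _ h1
  calc 8 * 2 ^ extensionLog X S n = 2 ^ (extensionLog X S n + 3) := by ring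
    _ = 2 ^ Nat.log 2 (minExtensions X S n) := by
      congr 1
      rw [extensionLog] at h ⊢
      omega
    _ ≤ _ := Nat.pow_log_le_self 2 h2

lemma tendsto_pow_div_tileSide_pow (hd : 0 < d) (n₀ k : ℕ) :
    Tendsto (fun m : ℕ => (m : ℝ) ^ k / (tileSide n₀ m : ℝ) ^ d) atTop (𝓝 0) := by
  refine squeeze_zero (fun m => by positivity) (fun m => ?_)
    (tendsto_pow_const_div_const_pow_of_one_lt k (r := 15) (by norm_num))
  have h1 : 15 ^ m ≤ tileSide n₀ m ^ d :=
    (Nat.le_mul_of_pos_right _ (Nat.succ_pos _)).trans (Nat.le_self_pow hd.ne' _)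
  exact div_le_div_of_nonneg_left (by positivity) (by positivity) (by exact_mod_cast h1)

/-- Growth of the sequence of exponents of block sizes. -/
lemma eventually_le_div_of_log {l : ℕ → ℕ} {V : ℕ → ℝ} {h : ℝ} (hV : ∀ m, 0 < V m)
    (hlim : ∀ k : ℕ, Tendsto (fun m : ℕ => (m : ℝ) ^ k / V m) atTop (𝓝 0))
    (hl : ∀ ε > 0, ∀ᶠ m in atTop, (h - ε) * V m ≤ l m + 4) :
    (0 < h → ∀ᶠ m in atTop, (m + 2) ^ 2 ≤ l m) ∧
      ∀ ε > 0, ∀ᶠ m in atTop, h - ε ≤ ((l m / (m + 2) * m : ℕ) : ℝ) / V m := by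
  constructor
  · intro hpos
    have h2 : Tendsto (fun m : ℕ => (m : ℝ) ^ 2 / V m + 4 * ((m : ℝ) ^ 1 / V m) +
        8 * ((m : ℝ) ^ 0 / V m)) atTop (𝓝 0) := by
      simpa using ((hlim 2).add ((hlim 1).const_mul 4)).add ((hlim 0).const_mul 8)
    filter_upwards [hl (h / 2) (by positivity),
      h2.eventually (gt_mem_nhds (show 0 < h / 2 by positivity))] with m hm1 hm2
    have h3 : (m : ℝ) ^ 2 / V m + 4 * ((m : ℝ) ^ 1 / V m) + 8 * ((m : ℝ) ^ 0 / V m) =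
        (m ^ 2 + 4 * m + 8) / V m := by ring
    rw [h3, div_lt_iff₀ (hV m)] at hm2
    have h4 : ((m + 2 : ℕ) : ℝ) ^ 2 ≤ l m := by
      push_cast
      nlinarith
    exact_mod_cast h4
  · intro ε hε
    have h2 : Tendsto (fun m : ℕ => (m : ℝ) / (m + 2) * ((h - ε / 2) - 4 * ((m : ℝ) ^ 0 / V m)) -
        (m : ℝ) ^ 1 / V m) atTop (𝓝 (h - ε / 2)) := by
      have h3 : Tendsto (fun m : ℕ => (m : ℝ) / (m + 2)) atTop (𝓝 1) :=
        tendsto_natCast_div_add_atTop 2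
      simpa using (h3.mul (((hlim 0).const_mul 4).const_sub (h - ε / 2))).sub (hlim 1)
    filter_upwards [hl (ε / 2) (by positivity),
      h2.eventually (lt_mem_nhds (show h - ε < h - ε / 2 by linarith))] with m hm1 hm2
    refine hm2.le.trans ?_
    have hVm := hV m
    rw [le_div_iff₀ hVm]
    have h5 : (l m : ℝ) / (m + 2) ≤ (l m / (m + 2) : ℕ) + 1 := by
      rw [div_le_iff₀ (by positivity)]
      have h6 := (Nat.lt_mul_div_succ (l m) (show 0 < m + 2 by omega)).le
      rw [mul_comm] at h6
      exact_mod_cast h6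
    have h7 : ((m : ℝ) / (m + 2) * ((h - ε / 2) - 4 * ((m : ℝ) ^ 0 / V m)) -
        (m : ℝ) ^ 1 / V m) * V m = (m : ℝ) / (m + 2) * ((h - ε / 2) * V m - 4) - m := by
      field_simp
    rw [h7]
    have h8 : (m : ℝ) / (m + 2) * ((h - ε / 2) * V m - 4) ≤ (m : ℝ) / (m + 2) * l m :=
      mul_le_mul_of_nonneg_left (by linarith) (by positivity)
    have h9 : (m : ℝ) / (m + 2) * l m = (l m : ℝ) / (m + 2) * m := by ring
    have h10 := mul_le_mul_of_nonneg_right h5 (Nat.cast_nonneg (α := ℝ) m)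
    push_cast
    linarith

end LowerBound

/-! ### The local entropy of the stabilized automorphism group -/

section Main

universe u

variable {d : ℕ} {A : Type u} [TopologicalSpace A] {X : Subshift A (Fin d → ℤ)}

/-- If a nonzero shift `g` acted trivially, every point would be `g`-periodic. A point and its
modification in one cell agree on a translate of the cell by a multiple of `g` disjoint from it,
hence would agree on the cell as well. -/
lemma IsMixing.shiftsInStabAut_injective {ω : ℕ} (hX : IsLocal X ω) {S : ℝ}
    (hS : 2 * ω ≤ S) (hne : X.carrier.Nonempty) {n : ℕ} {π : boundaryPerm X S n} {j : _}
    (h : IsMixing S π j) : Function.Injective (shiftsInStabAut X) := by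
  classical
  rw [injective_iff_map_eq_one]
  intro g hg
  by_contra hg1
  have hfix : ∀ x : X.carrier, shiftHomeo X g.toAdd x = x := fun x =>
    DFunLike.congr_fun (congrArg Subtype.val hg) x
  obtain ⟨i, hi⟩ := Function.ne_iff.1 (show g.toAdd ≠ 0 from hg1)
  rw [Pi.zero_apply] at hi
  obtain ⟨p, hp⟩ : ∃ p, π.1 p ≠ p := by
    by_contra! h1
    exact h.ne_one hne (Subtype.ext (Equiv.ext h1))
  obtain ⟨x, rfl⟩ := exists_cellPat_zero_eq p
  let P : (Fin d → ℤ) → patterns X (box d n) → patterns X (box d n) :=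
    fun b => if b = 0 then π.1 else id
  have hP : PreservesBoundary S P := by
    intro b p a ha
    by_cases hb : b = 0
    · simp only [P, hb, if_true]
      exact π.2 0 p a ha
    · simp only [P, hb, if_false, id]
  set y := tileMap hX hS P hP x with hy
  have hy0 : cellPat n y 0 = π.1 (cellPat n x 0) := by
    rw [hy, cellPat_tileMap hX hS hP x (zero_mem _)]
    simp only [P, if_true]
  have hyx : ∀ a, a ∉ box d n → y.1 a = x.1 a := by
    intro a ha
    have hb : cellBase n a ≠ 0 := by
      intro hb
      apply ha
      rw [← cellBase_add_cellRep n a, hb, zero_add]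
      exact cellRep_mem n a
    rw [hy, tileMap_apply, show P (cellBase n a) = id from if_neg hb, id, cellPat_apply,
      cellBase_add_cellRep]
  refine hp (hy0.symm.trans (Subtype.ext (funext fun a => ?_)))
  rw [cellPat_apply, cellPat_apply, zero_add]
  have hper : ∀ z : X.carrier, z.1 a.1 = z.1 ((2 * n + 1 : ℤ) • g.toAdd + a.1) := by
    intro z
    rw [← shiftHomeo_apply, shiftHomeo_zsmul_eq (hfix z)]
  rw [hper y, hper x]
  refine hyx _ fun hmem => ?_
  have h1 := mem_box_iff.1 hmem i
  have h2 := mem_box_iff.1 a.2 i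
  rw [Pi.add_apply, Pi.smul_apply, smul_eq_mul] at h1
  rcases lt_or_gt_of_ne hi with h3 | h3
  · have : (2 * n + 1 : ℤ) * g.toAdd i ≤ (2 * n + 1) * (-1) :=
      mul_le_mul_of_nonneg_left (by omega) (by positivity)
    linarith
  · have : (2 * n + 1 : ℤ) * 1 ≤ (2 * n + 1) * g.toAdd i :=
      mul_le_mul_of_nonneg_left (by omega) (by positivity)
    linarith

lemma HasBEEPS.exists_isMixing [Fintype A] (hd : 0 < d) (hB : HasBEEPS X) {ω : ℕ} (hX : IsLocal X ω) {S : ℝ}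
    (hS : 2 * ω ≤ S) (hS0 : 0 < S) :
    ∃ (n : ℕ) (π : boundaryPerm X S n) (j : _), IsMixing S π j := by
  obtain ⟨g, hg⟩ := hB S hS0
  obtain ⟨k, hk⟩ := (hg.2 (boxSeq d)).exists
  exact LocalQEntropy.exists_isMixing hX hS hd fun v hv => (hk v hv v hv).1

lemma IsBEEPSFunction.one_lt_card [Fintype A] {S : ℝ} {f : FolnerSeq (Fin d → ℤ) → ℕ → ℝ}
    (hf : IsBEEPSFunction X S f) (hne : X.carrier.Nonempty) : 1 < Fintype.card A := by
  obtain ⟨k, hk⟩ := (hf.2 (boxSeq d)).exists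
  obtain ⟨v, hv⟩ := patterns_nonempty hne (boundary S (boxSeq d k))
  have h1 := (hk v hv v hv).1.trans_le (ncard_extensions_le _ _ _)
  by_contra! h2
  exact absurd h1 (not_lt.2 (pow_le_one₀ (Nat.zero_le _) h2))

/-- The permutations live on boxes while the Følner section consists of the sets `tileSet`; both
have the volume of a fundamental domain of the same lattice, so the two choices are independent. -/
theorem exists_isLocallyQ [Fintype A] [DiscreteTopology A] (hd : 0 < d) (hne : X.carrier.Nonempty) {ω : ℕ} (hX : IsLocal X ω)
    (hB : HasBEEPS X) {S : ℝ} {f : FolnerSeq (Fin d → ℤ) → ℕ → ℝ} (hf : IsBEEPSFunction X S f)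
    {R : ℝ} {κ : ℕ} (hκ : Fintype.card A ≤ κ) (hR : 1 ≤ R ∨ ω = 0) :
    ∃ (H : ℕ → AddSubgroup (Fin d → ℤ)) (D : FolnerSeq (Fin d → ℤ))
      (K : ℕ → Subgroup (stabAut X)), IsTower H ∧ IsFolnerSection H D ∧
      IsLocallyQ (shiftsInStabAut X) (selector f (boundaryCount R κ)) H D K ∧
      (entropyInf X : EReal) ≤ limsup (fun m =>
        ((Real.logb 2 (Real.logb 2 (Nat.card (K m) : ℝ)) / ((H m).index : ℝ) : ℝ) : EReal))
        atTop := by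
  classical
  have hκ2 : 2 ≤ κ := (hf.one_lt_card hne).trans_le hκ
  -- The gluing width `T` is unrelated to `S`. The value `1/2` keeps it positive, yet below one when
  -- `ω = 0`.
  set T : ℝ := max (2 * ω) (1 / 2)
  have hT : 2 * ω ≤ T := le_max_left _ _
  have hT0 : 0 < T := lt_of_lt_of_le (by norm_num) (le_max_right _ _)
  obtain ⟨g, hg⟩ := hB T hT0
  obtain ⟨n₀, π, j, hmix⟩ := hB.exists_isMixing hd hX hT hT0
  let i : Fin d := ⟨0, hd⟩
  let H : ℕ → AddSubgroup (Fin d → ℤ) := fun m => lattice d (tileSide n₀ m)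
  let D := tileSeq i n₀
  let n := tileRadius n₀
  let l := fun m => extensionLog X T (n m)
  let φ : stabAut X := tileStab hd hX hT n₀ π
  have hn : ∀ m, 2 * n m + 1 = tileSide n₀ m := two_mul_tileRadius_add_one n₀
  have hdvd : ∀ m, 2 * n₀ + 1 ∣ 2 * n m + 1 := fun m => by
    rw [hn]
    exact Dvd.intro_left _ rfl
  have hcount : ∀ m, m + 1 ≤ boundaryCount R κ D m ∨ T < 1 ∧ 1 ≤ boundaryCount R κ D m := by
    intro m
    rcases hR with hR | hω
    · left
      calc m + 1 ≤ 2 ^ m := Nat.lt_two_pow_self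
        _ ≤ κ ^ m := Nat.pow_le_pow_left hκ2 m
        _ ≤ _ := Nat.pow_le_pow_right (by omega) (le_card_boundary_tileSeq hR m)
    · right
      refine ⟨max_lt ?_ (by norm_num), Nat.one_le_pow _ _ (by omega)⟩
      rw [hω]
      norm_num
  have key : ∀ m, ∃ K : Subgroup (stabAut X), K ≤ shiftCentralizer X (H m) ∧ φ ∈ K ∧
      (2 ≤ m ∧ (m + 2) ^ 2 ≤ l m →
        (∀ M, 2 ≤ M → SimpleProduct M (boundaryCount R κ D m) K) ∧
        ((l m / (m + 2) * m : ℕ) : ℝ) ≤ Real.logb 2 (Real.logb 2 (Nat.card K : ℝ))) := by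
    intro m
    by_cases hm : 2 ≤ m ∧ (m + 2) ^ 2 ≤ l m
    · obtain ⟨J, hJ⟩ := hmix.refine hX hT (hdvd m)
      obtain ⟨K, h1, h2, h3, h4⟩ := hJ.exists_subgroup_of_le hd hX hT hne hm.1 hm.2
        (eight_mul_two_pow_le (lt_of_lt_of_le (by positivity) hm.2)) (hcount m)
      rw [tileStab_refinePerm] at h2
      rw [hn] at h1
      exact ⟨K, h1, h2, fun _ => ⟨h3, h4⟩⟩
    -- For the finitely many remaining `m`, only containment in the centralizer and membership of
    -- `φ` matter.
    · refine ⟨shiftCentralizer X (H m), le_rfl, ?_, fun h => absurd h hm⟩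
      have h1 := tileStab_mem_shiftCentralizer hd hX hT (refinePerm hX hT (hdvd m) π)
      rwa [tileStab_refinePerm, hn] at h1
  choose K hK1 hK2 hK3 using key
  have hcard : ∀ m, ((box d (n m)).card : ℝ) = (tileSide n₀ m : ℝ) ^ d := by
    intro m
    rw [card_box, hn]
    push_cast
    rfl
  have hindex : ∀ m, ((H m).index : ℝ) = (tileSide n₀ m : ℝ) ^ d := by
    intro m
    rw [← ((isFolnerSection_tileSeq (i := i) (n₀ := n₀)).fundamental m).card_left]
    simp only [tileSeq_apply, Nat.card_eq_fintype_card, Finset.coe_sort_coe, Fintype.card_coe,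
      card_tileSet]
    push_cast
    rfl
  obtain ⟨hl1, hl2⟩ := eventually_le_div_of_log (l := l) (V := fun m => (tileSide n₀ m : ℝ) ^ d)
    (h := entropyInf X) (fun m => pow_pos (by exact_mod_cast tileSide_pos n₀ m) d)
    (tendsto_pow_div_tileSide_pow hd n₀) (fun ε hε => by
      filter_upwards [(tendsto_tileRadius n₀).eventually
        (hg.eventually_le_logb_minExtensions hne hε)] with m hm
      rw [← hcard]
      exact hm.trans (logb_minExtensions_le X T (n m)))
  have hev := (eventually_ge_atTop 2).and (hl1 (hmix.entropyInf_pos hX hT hne))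
  refine ⟨H, D, K, isTower_lattice i n₀, isFolnerSection_tileSeq, ⟨hK1, ?_, φ, ?_, hK2⟩,
    le_limsup_coe fun ε hε => ?_⟩
  · filter_upwards [hev, hf.eventually_two_le hne D] with m hm1 hm2
    exact (hK3 m hm1).1 _ hm2
  · intro h1
    exact hmix.ne_one hne (tileStab_injective hd hX hT (h1.trans (map_one _).symm))
  · filter_upwards [hev, hl2 ε hε] with m hm1 hm2
    rw [hindex]
    refine hm2.trans (div_le_div_of_nonneg_right (hK3 m hm1).2 (by positivity))

theorem localQEntropy_eq [Fintype A] [DiscreteTopology A] (hd : 0 < d) (hne : X.carrier.Nonempty) {ω : ℕ} (hX : IsLocal X ω)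
    (hB : HasBEEPS X) (hper : StrongPeriodicDensity X) {S : ℝ}
    {f : FolnerSeq (Fin d → ℤ) → ℕ → ℝ} (hf : IsBEEPSFunction X S f)
    {R : ℝ} {κ : ℕ} (hκ : Fintype.card A ≤ κ) (hR : 1 ≤ R ∨ ω = 0) :
    Function.Injective (shiftsInStabAut X) ∧
      HasLocallyQ (shiftsInStabAut X) (selector f (boundaryCount R κ)) ∧
      localQEntropy (shiftsInStabAut X) (selector f (boundaryCount R κ)) = topEntropy X := by
  obtain ⟨H, D, K, hH, hD, hK, hlim⟩ := exists_isLocallyQ hd hne hX hB hf hκ hR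
  refine ⟨?_, ⟨H, D, K, hH, hD, hK⟩, ?_⟩
  · obtain ⟨n, π, j, h⟩ := hB.exists_isMixing hd hX (S := max (2 * ω) 1) (le_max_left _ _)
      (lt_of_lt_of_le one_pos (le_max_right _ _))
    exact h.shiftsInStabAut_injective hX (le_max_left _ _) hne
  · rw [topEntropy_eq hne]
    refine le_antisymm ?_ (hlim.trans ?_)
    · exact iSup_le fun H => iSup_le fun hH => iSup_le fun D => iSup_le fun hD =>
        iSup_le fun K => iSup_le fun hK => limsup_le_entropyInf hd hper hf.1 hH hD hK
    · exact le_iSup_of_le H <| le_iSup_of_le hH <| le_iSup_of_le D <| le_iSup_of_le hD <|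
        le_iSup_of_le K <| le_iSup_of_le hK le_rfl

end Main

end LocalQEntropy

theorem mainTheorem5 {d : ℕ} (hd : 0 < d) {A : Type*} [Fintype A] [TopologicalSpace A]
    [DiscreteTopology A] (X : Subshift A (Fin d → ℤ)) :
    (((X.carrier.Nontrivial ∧ LocalQEntropy.IsContractible X) ∨
        (X.carrier.Nonempty ∧ LocalQEntropy.HasBEEPS X ∧
          LocalQEntropy.StrongPeriodicDensity X)) →
      ∀ (w R S : ℝ) (κ : ℕ) (f : LocalQEntropy.FolnerSeq (Fin d → ℤ) → ℕ → ℝ),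
        LocalQEntropy.IsWindowSize X w → w < S → S ≤ R →
        LocalQEntropy.IsBEEPSFunction X S f → Fintype.card A ≤ κ →
        Function.Injective (LocalQEntropy.shiftsInStabAut X) ∧
        LocalQEntropy.HasLocallyQ (LocalQEntropy.shiftsInStabAut X)
          (LocalQEntropy.selector f (LocalQEntropy.boundaryCount R κ)) ∧
        LocalQEntropy.localQEntropy (LocalQEntropy.shiftsInStabAut X)
          (LocalQEntropy.selector f (LocalQEntropy.boundaryCount R κ)) =
            LocalQEntropy.topEntropy X) ∧
    (LocalQEntropy.IsSFT X → X.carrier.Nontrivial → LocalQEntropy.IsContractible X →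
      ∃ Q : LocalQEntropy.EntropyClassSelector (Fin d → ℤ),
        LocalQEntropy.HasLocallyQ (LocalQEntropy.shiftsInStabAut X) Q ∧
        LocalQEntropy.localQEntropy (LocalQEntropy.shiftsInStabAut X) Q =
          LocalQEntropy.topEntropy X) := by
  constructor
  · intro h w R S κ f hw hwS hSR hf hκ
    -- If `R < 1` then `w < S ≤ R < 1`, and membership in `X` is decided at single sites.
    have hR : 1 ≤ R ∨ ⌊w⌋₊ = 0 := by
      rcases le_or_gt 1 R with h1 | h1
      · exact Or.inl h1
      · exact Or.inr (Nat.floor_eq_zero.2 (by linarith))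
    rcases h with ⟨hX, hX'⟩ | ⟨hX, hB, hper⟩
    · exact LocalQEntropy.localQEntropy_eq hd hX.nonempty hw.isLocal (hX'.hasBEEPS hd hX)
        (hX'.strongPeriodicDensity hw.isLocal) hf hκ hR
    · exact LocalQEntropy.localQEntropy_eq hd hX hw.isLocal hB hper hf hκ hR
  · intro hD hX hX'
    obtain ⟨ω, hω⟩ := hD.exists_isLocal
    obtain ⟨f, hf⟩ := hX'.hasBEEPS hd hX 1 one_pos
    exact ⟨_, (LocalQEntropy.localQEntropy_eq hd hX.nonempty hω (hX'.hasBEEPS hd hX)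
      (hX'.strongPeriodicDensity hω) hf le_rfl (Or.inl (le_refl (1 : ℝ)))).2⟩
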